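/- Write $\langle z\rangle=(1+|z|^2)^{1/2}$, $\partial/\partial\bar z=\frac12(\partial_x+i\partial_y)$ (in the sense of distributions), and let $L$ be Lebesgue measure on $\mathbb C$. Let $\mathcal B$ be a complex Banach space and $P$ a densely defined closed operator in $\mathcal B$ with $\sigma(P)\subset\mathbb R$ and $\|(z-P)^{-1}\|\le C|\operatorname{Im}z|^{-N_0^0}\langle z\rangle^{N_1^0}$ for $z\in\mathbb C\setminus\mathbb R$, with some $C,N_0^0,N_1^0\in\mathbb R$. Let $\mathcal E$ be the space of $f\in C^\infty(\mathbb R;\mathbb C)$ for which there are $a_k\in\mathbb C$ such that for every $N\in\mathbb N$, $f(x)=\sum_{k=0}^N a_kx^{-k}+x^{-N-1}r_{N+1}(x)$ for $|x|>1$, with $r_{N+1}$ bounded together with all its derivatives. For $f\in\mathcal E$ put $$f(P)=a_0 1-\frac1\pi\int_{\mathbb C}\frac{\partial\tilde f}{\partial\bar z}(z)(z-P)^{-1}L(dz),$$ where $a_0=\lim_{|x|\to\infty}f(x)$ and $\tilde f$ is any bounded continuous extension of $f$ to $\mathbb C$ with $\partial\tilde f/\partial\bar z=\mathcal O_{M,N}(\langle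 z\rangle^{-M}|\operatorname{Im}z|^{N})$ for all $M,N\in\mathbb N$. That $f(P)$ is well defined means that such $\tilde f$ exist, that the integral converges absolutely for each of them, and that the result does not depend on the choice. Let $f\in\mathcal E$ and $K=\overline{f(\mathbb R)}$ (a compact set). Let $g$ be continuous on $K$, and suppose that $g$ has a bounded Lipschitz extension $\tilde g:\mathbb C\to\mathbb C$ with $\partial\tilde g/\partial\bar\zeta=\mathcal O(\operatorname{dist}(\zeta,K)^N)$ for every $N\in\mathbb N$; call any such $\tilde g$ a flat extension of $g$. Then: 1. $f(P)$ is well defined, and $\sigma(f(P))\subset K$. 2. $g\circ f\in\mathcal E$, and $(g\circ f)(P)$ is well defined. 3. $g$ has a compactly supported flat extension. For every flat extension $\tilde g$ with $\partial\tilde g/\partial\bar\zeta=\mathcal O(\langle\zeta\rangle^{-1-\epsilon})$ for some $\epsilon>0$ (for instance every compactly supported one), the limit $\tilde g(\infty)=\lim_{|\zeta|\to\infty}\tilde g(\zeta)$ exists and the integral in $$g(f(P)):=\tilde g(\infty)1-\frac1\pi\int_{\mathbb C}\frac{\partial\tilde g}{\partial\bar\zeta}(\zeta)(\zeta-f(P))^{-1}L(d\zeta)$$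 converges absolutely, and $$g(f(P))=(g\circ f)(P).$$ 4. There are $C^1$ extensions $\tilde f$ of $f$ to $\mathbb C$ with $\partial\tilde f/\partial\bar z=\mathcal O_N((|\operatorname{Im}z|/\langle z\rangle^2)^N)$ for every $N\in\mathbb N$ and $\nabla\tilde f=\mathcal O(\langle z\rangle^{-2})$. For every such $\tilde f$ and every flat extension $\tilde g$ of $g$, the function $\tilde h=\tilde g\circ\tilde f$ is a bounded continuous extension of $g\circ f$ with $\partial\tilde h/\partial\bar z=\mathcal O_{M,N}(\langle z\rangle^{-M}|\operatorname{Im}z|^N)$ for all $M,N\in\mathbb N$, it has a limit $\tilde h(\infty)$ at infinity, and $$(g\circ f)(P)=\tilde h(\infty)1-\frac1\pi\int_{\mathbb C}\frac{\partial\tilde h}{\partial\bar z}(z)(z-P)^{-1}L(dz),$$ where the integral converges absolutely. -/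

import Mathlib

open MeasureTheory Filter Topology
open scoped ContDiff

namespace SmoothCalculus

noncomputable section

/-! ### Wirtinger derivative -/

/-- The Japanese bracket `⟨z⟩ = (1 + |z|^2)^{1/2}`. -/
def bracket (z : ℂ) : ℝ := Real.sqrt (1 + ‖z‖ ^ 2)

/-- The classical derivative `∂F/∂z̄ = (∂_x F + i ∂_y F) / 2`; only used for `C¹` functions. -/
def dbar (F : ℂ → ℂ) (z : ℂ) : ℂ :=
  (1 / 2) * (fderiv ℝ F z 1 + Complex.I * fderiv ℝ F z Complex.I)

/-- `∂F/∂z̄ = φ` in the sense of distributions on `ℂ`. -/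
structure HasWeakDbar (F φ : ℂ → ℂ) : Prop where
  locallyIntegrable : LocallyIntegrable F volume
  locallyIntegrable_dbar : LocallyIntegrable φ volume
  integral_eq : ∀ ψ : ℂ → ℂ, ContDiff ℝ ∞ ψ → HasCompactSupport ψ →
    ∫ z, F z * dbar ψ z = - ∫ z, φ z * ψ z

/-! ### Closed operators and their resolvents -/

section Operator

variable {B : Type*} [NormedAddCommGroup B] [NormedSpace ℂ B]

/-- `R` is a bounded two-sided inverse of `z - P : D(P) → B`. -/
def IsResolventAt (P : B →ₗ.[ℂ] B) (z : ℂ) (R : B →L[ℂ] B) : Prop :=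
  (∀ u : B, ∃ x : P.domain, (x : B) = R u ∧ z • (x : B) - P x = u) ∧
    ∀ x : P.domain, R (z • (x : B) - P x) = x

/-- The spectrum of the operator `P` with domain `P.domain`. -/
def opSpectrum (P : B →ₗ.[ℂ] B) : Set ℂ := {z | ¬ ∃ R : B →L[ℂ] B, IsResolventAt P z R}

open Classical in
/-- The resolvent `(z - P)⁻¹`; it has the value `0` at points of the spectrum. -/
def opResolvent (P : B →ₗ.[ℂ] B) (z : ℂ) : B →L[ℂ] B :=
  if h : ∃ R : B →L[ℂ] B, IsResolventAt P z R then h.choose else 0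

theorem IsResolventAt.unique {P : B →ₗ.[ℂ] B} {z : ℂ} {R S : B →L[ℂ] B}
    (hR : IsResolventAt P z R) (hS : IsResolventAt P z S) : R = S := by
  ext u
  obtain ⟨x, hx, hxu⟩ := hR.1 u
  rw [← hx, ← hS.2 x, hxu]

theorem IsResolventAt.opResolvent_eq {P : B →ₗ.[ℂ] B} {z : ℂ} {R : B →L[ℂ] B}
    (hR : IsResolventAt P z R) : opResolvent P z = R := by
  have h : ∃ R : B →L[ℂ] B, IsResolventAt P z R := ⟨R, hR⟩
  unfold opResolvent
  rw [dif_pos h]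
  exact h.choose_spec.unique hR

/-- `P` is a densely defined closed operator with real spectrum, and
`‖(z - P)⁻¹‖ = O(|Im z|^{-N₀} ⟨z⟩^{N₁})` for `z ∉ ℝ`. -/
structure IsTemperate (P : B →ₗ.[ℂ] B) : Prop where
  dense : Dense (P.domain : Set B)
  closed : P.IsClosed
  real_spectrum : ∀ z ∈ opSpectrum P, z.im = 0
  resolvent_bound : ∃ C N₀ N₁ : ℝ, ∀ z : ℂ, z.im ≠ 0 →
    ‖opResolvent P z‖ ≤ C * |z.im| ^ (-N₀) * bracket z ^ N₁

end Operator

/-! ### The space `𝓔` and almost holomorphic extensions -/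

/-- Membership in `𝓔`: `f` is smooth on `ℝ` and `f(x) ∼ ∑ a_k x^{-k}` as `|x| → ∞`, where for every
`N` the remainder `r_{N+1}` in `f(x) = ∑_{k ≤ N} a_k x^{-k} + x^{-N-1} r_{N+1}(x)`, `|x| > 1`, is
bounded together with all its derivatives. -/
def MemE (f : ℝ → ℂ) : Prop :=
  ContDiff ℝ ∞ f ∧ ∃ a : ℕ → ℂ, ∀ N j : ℕ, ∃ C : ℝ, ∀ x : ℝ, 1 < |x| →
    ‖iteratedDeriv j
      (fun t : ℝ => (t : ℂ) ^ (N + 1) *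
        (f t - ∑ k ∈ Finset.range (N + 1), a k * ((t : ℂ) ^ k)⁻¹)) x‖ ≤ C

/-- `F` is a bounded continuous extension of `f` to `ℂ` with distributional derivative
`∂F/∂z̄ = φ = O_{N₀,N₁}(⟨z⟩^{-N₁} |Im z|^{N₀})` for all `N₀, N₁` (in particular `φ` is bounded). -/
structure IsAlmostHolExt (f : ℝ → ℂ) (F φ : ℂ → ℂ) : Prop where
  continuous : Continuous F
  bounded : ∃ C : ℝ, ∀ z, ‖F z‖ ≤ C
  extends_fun : ∀ x : ℝ, F x = f x
  dbar_eq : HasWeakDbar F φ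
  dbar_bound : ∀ N₀ N₁ : ℕ, ∃ C : ℝ, ∀ᵐ z : ℂ,
    ‖φ z‖ ≤ C * (bracket z ^ N₁)⁻¹ * |z.im| ^ N₀

/-- `F` is a `C¹` extension of `f` with `∂F/∂z̄ = O_N((|Im z| / ⟨z⟩²)^N)` for all `N` and
`∇F = O(⟨z⟩^{-2})`. -/
structure IsStrongAlmostHolExt (f : ℝ → ℂ) (F : ℂ → ℂ) : Prop where
  contDiff : ContDiff ℝ 1 F
  extends_fun : ∀ x : ℝ, F x = f x
  dbar_bound : ∀ N : ℕ, ∃ C : ℝ, ∀ z : ℂ, ‖dbar F z‖ ≤ C * (|z.im| / bracket z ^ 2) ^ N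
  grad_bound : ∃ C : ℝ, ∀ z : ℂ, ‖fderiv ℝ F z‖ ≤ C * (bracket z ^ 2)⁻¹

/-- `G` is a bounded Lipschitz extension of `g : K → ℂ` to `ℂ` whose distributional derivative
`∂G/∂ζ̄ = γ` is `O(dist(ζ, K)^∞)`. -/
structure IsFlatLipschitzExt (K : Set ℂ) (g : ℂ → ℂ) (G γ : ℂ → ℂ) : Prop where
  bounded : ∃ C : ℝ, ∀ ζ, ‖G ζ‖ ≤ C
  lipschitz : ∃ L : NNReal, LipschitzWith L G
  extends_fun : ∀ ζ ∈ K, G ζ = g ζ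
  dbar_eq : HasWeakDbar G γ
  dbar_bound : ∀ N : ℕ, ∃ C : ℝ, ∀ᵐ ζ : ℂ, ‖γ ζ‖ ≤ C * Metric.infDist ζ K ^ N

/-! ### The functional calculi -/

section Calculus

variable {B : Type*} [NormedAddCommGroup B] [NormedSpace ℂ B]

/-- The Cauchy–Green expression `c·1 - π⁻¹ ∫ φ(z) R(z) L(dz)`. -/
def cauchyGreen (c : ℂ) (φ : ℂ → ℂ) (R : ℂ → B →L[ℂ] B) : B →L[ℂ] B :=
  c • ContinuousLinearMap.id ℂ B - ((Real.pi : ℂ)⁻¹) • ∫ z : ℂ, φ z • R z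

/-- `f(P)` is well defined and equal to `A`: the function `f` belongs to `𝓔`, it has an almost
holomorphic extension, and for every such extension `F` the integral in
`a₀·1 - π⁻¹ ∫ (∂F/∂z̄)(z) (z - P)⁻¹ L(dz)`, `a₀ = lim_{|x| → ∞} f(x)`,
converges absolutely and the expression equals `A`. -/
structure IsFunctionOf (P : B →ₗ.[ℂ] B) (f : ℝ → ℂ) (A : B →L[ℂ] B) : Prop where
  memE : MemE f
  exists_ext : ∃ F φ : ℂ → ℂ, IsAlmostHolExt f F φ
  eq_formula : ∃ a₀ : ℂ, Tendsto f (cocompact ℝ) (𝓝 a₀) ∧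
    ∀ F φ : ℂ → ℂ, IsAlmostHolExt f F φ →
      Integrable (fun z => φ z • opResolvent P z) ∧
        A = cauchyGreen a₀ φ (opResolvent P)

theorem IsFunctionOf.unique {P : B →ₗ.[ℂ] B} {f : ℝ → ℂ} {A A' : B →L[ℂ] B}
    (h : IsFunctionOf P f A) (h' : IsFunctionOf P f A') : A = A' := by
  obtain ⟨F, φ, hF⟩ := h.exists_ext
  obtain ⟨a, ha, e⟩ := h.eq_formula
  obtain ⟨a', ha', e'⟩ := h'.eq_formula
  rw [(e F φ hF).2, (e' F φ hF).2, tendsto_nhds_unique ha ha']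

/-- `g(A)` is well defined by the Cauchy–Green formula and equal to `H`, for a bounded operator `A`
with spectrum in `K`: `g` has a compactly supported flat Lipschitz extension, and for
every flat Lipschitz extension `G` with `∂G/∂ζ̄ = O(⟨ζ⟩^{-1-ε})` for some `ε > 0` (as holds if `G` has
compact support) the limit `c` of `G` at infinity exists (it is `0` if `G` has compact support), the
integral in `c·1 - π⁻¹ ∫ (∂G/∂ζ̄)(ζ) (ζ - A)⁻¹ L(dζ)` converges absolutely, and the expression
equals `H`. -/
structure IsCauchyGreenFunctionOf (K : Set ℂ) (g : ℂ → ℂ) (A H : B →L[ℂ] B) : Prop where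
  spectrum_subset : spectrum ℂ A ⊆ K
  exists_ext : ∃ G γ : ℂ → ℂ, IsFlatLipschitzExt K g G γ ∧ HasCompactSupport G
  eq_formula : ∀ G γ : ℂ → ℂ, IsFlatLipschitzExt K g G γ →
    (∃ ε : ℝ, 0 < ε ∧ ∃ C : ℝ, ∀ᵐ ζ : ℂ, ‖γ ζ‖ ≤ C * bracket ζ ^ (-1 - ε)) →
    ∃ c : ℂ, Tendsto G (cocompact ℂ) (𝓝 c) ∧
      Integrable (fun ζ => γ ζ • resolvent A ζ) ∧
        H = cauchyGreen c γ (resolvent A)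

end Calculus

end

end SmoothCalculus

/-!
The proof replaces the operator `P` by its Cayley transform `U`, a bounded invertible operator. The
resolvent estimates turn into Cauchy estimates for the power series of `(1 - z U)⁻¹` and of
`(1 - z U⁻¹)⁻¹`, so that `‖Uⁿ‖` grows polynomially in `|n|` (`IsTemperate.exists_hasPolyGrowth`).
Functions `h` that are smooth on the circle `ℝ ∪ {∞}` have rapidly decreasing Fourier coefficients
`ĥ(n)` in the coordinate `x = tan (θ / 2)`, and `circleCalc U h = ∑ ĥ(n) Uⁿ` is a multiplicative
calculus that commutes with absolutely convergent integrals (`circleCalc_mul`, `circleCalc_integral`).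
All operators in the theorem are values of it: `A = circleCalc U f` and `H = circleCalc U (g ∘ f)`.

A bounded continuous function `F` whose derivative `γ = ∂F/∂z̄` decays faster than `|z|^{-1}` equals
its limit at infinity plus the Cauchy transform `π⁻¹ ∫ γ(w) / (z - w)` (Weyl's lemma and Liouville's
theorem, `HasWeakDbar.exists_eq_cauchyTransform`). If `F` is an almost holomorphic extension of `f`,
this writes `f` as an integral of the functions `1 / (x - w)`; if `G` is a flat extension of `g`, it
writes `g ∘ f` as an integral of the functions `1 / (f - ζ)`. The calculus maps `1 / (x - w)` to
`(P - w)⁻¹` and, being multiplicative, `1 / (ζ - f)` to `(ζ - A)⁻¹`. Applying it to the two integral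
representations gives the two Cauchy–Green formulas, for every extension at once
(`IsTemperate.circleCalc_eq_cauchyGreen`, `isCauchyGreenFunctionOf_circleCalc`).

It remains to produce extensions. Functions in `𝓔` are smooth on the circle
(`MemE.isCircleSmooth`), and extending the Fourier modes `((1 + i x) / (1 - i x))ⁿ` meromorphically,
cut off at height `1 / |n|`, gives an extension `F` of `f`
(`IsCircleSmooth.exists_isStrongAlmostHolExt`). The composition `G ∘ F` is an almost holomorphic
extension of `g ∘ f` (`IsFlatLipschitzExt.comp`): the distance from `F z` to the range of `f` is
`O(|Im z| / ⟨z⟩²)`, and the chain rule holds almost everywhere where `F` is a local diffeomorphism,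
while elsewhere `∇F` is controlled by `∂F/∂z̄`. Conversely the restriction to the real line of any
almost holomorphic extension is in `𝓔`, by expansion of the Cauchy kernel (`IsFlatDensity.memE`), so
`g ∘ f` is in `𝓔`.
-/


namespace SmoothCalculus

noncomputable section

/-! ### The Japanese bracket -/

theorem one_le_bracket (z : ℂ) : 1 ≤ bracket z := by
  unfold bracket
  rw [Real.one_le_sqrt]
  nlinarith [norm_nonneg z]

theorem bracket_pos (z : ℂ) : 0 < bracket z := lt_of_lt_of_le one_pos (one_le_bracket z)

theorem bracket_sq (z : ℂ) : bracket z ^ 2 = 1 + ‖z‖ ^ 2 :=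
  Real.sq_sqrt (by positivity)

theorem norm_le_bracket (z : ℂ) : ‖z‖ ≤ bracket z :=
  Real.le_sqrt_of_sq_le (by linarith)

theorem abs_im_le_bracket (z : ℂ) : |z.im| ≤ bracket z :=
  (Complex.abs_im_le_norm z).trans (norm_le_bracket z)

theorem bracket_le_one_add_norm (z : ℂ) : bracket z ≤ 1 + ‖z‖ := by
  unfold bracket
  rw [Real.sqrt_le_left (by positivity)]
  nlinarith [norm_nonneg z]

theorem continuous_bracket : Continuous bracket := by
  unfold bracket; fun_prop

/-- The weight `⟨z⟩ (1 + |Im z|⁻¹)`, whose powers dominate the resolvent off the real axis. -/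
def axisWeight (z : ℂ) : ℝ := bracket z * (1 + |z.im|⁻¹)

theorem one_le_axisWeight (z : ℂ) : 1 ≤ axisWeight z := by
  have h := one_le_bracket z
  have : 0 ≤ |z.im|⁻¹ := by positivity
  unfold axisWeight
  nlinarith

theorem axisWeight_pos (z : ℂ) : 0 < axisWeight z :=
  lt_of_lt_of_le one_pos (one_le_axisWeight z)

theorem bracket_le_axisWeight (z : ℂ) : bracket z ≤ axisWeight z := by
  have h := bracket_pos z
  have : 0 ≤ |z.im|⁻¹ := by positivity
  unfold axisWeight
  nlinarith

theorem inv_abs_im_le_axisWeight (z : ℂ) : |z.im|⁻¹ ≤ axisWeight z := by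
  have h := one_le_bracket z
  have : 0 ≤ |z.im|⁻¹ := by positivity
  unfold axisWeight
  nlinarith

theorem measurable_axisWeight : Measurable axisWeight := by
  unfold axisWeight
  have := continuous_bracket.measurable
  fun_prop

/-- A function bounded by every `⟨z⟩^{-N₁} |Im z|^{N₀}` absorbs powers of the axis weight. -/
theorem exists_mul_axisWeight_pow_le {φ : ℂ → ℂ}
    (h : ∀ N₀ N₁ : ℕ, ∃ C : ℝ, ∀ᵐ z : ℂ, ‖φ z‖ ≤ C * (bracket z ^ N₁)⁻¹ * |z.im| ^ N₀) (m N : ℕ) :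
    ∃ C : ℝ, 0 ≤ C ∧ ∀ᵐ z : ℂ, ‖φ z‖ * axisWeight z ^ m ≤ C * (bracket z ^ N)⁻¹ := by
  obtain ⟨C, hC⟩ := h m (2 * m + N)
  refine ⟨2 ^ m * |C|, by positivity, ?_⟩
  filter_upwards [hC] with z hz
  have hb := bracket_pos z
  by_cases him : z.im = 0
  · rcases Nat.eq_zero_or_pos m with rfl | hm
    · simp only [pow_zero, mul_one, mul_zero, zero_add, one_mul] at hz ⊢
      exact hz.trans (by gcongr; exact le_abs_self C)
    · have : ‖φ z‖ ≤ 0 := by simpa [him, hm.ne'] using hz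
      have : ‖φ z‖ = 0 := le_antisymm this (norm_nonneg _)
      rw [this, zero_mul]; positivity
  · have hy : 0 < |z.im| := abs_pos.mpr him
    have key : |z.im| * axisWeight z ≤ 2 * bracket z ^ 2 := by
      have : |z.im| * axisWeight z = bracket z * (|z.im| + 1) := by
        unfold axisWeight; field_simp
      rw [this]
      nlinarith [abs_im_le_bracket z, one_le_bracket z]
    have hq := axisWeight_pos z
    calc ‖φ z‖ * axisWeight z ^ m
        ≤ (|C| * (bracket z ^ (2 * m + N))⁻¹ * |z.im| ^ m) * axisWeight z ^ m := by
          gcongr; exact hz.trans (by gcongr; exact le_abs_self C)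
      _ = |C| * (bracket z ^ (2 * m + N))⁻¹ * (|z.im| * axisWeight z) ^ m := by ring
      _ ≤ |C| * (bracket z ^ (2 * m + N))⁻¹ * (2 * bracket z ^ 2) ^ m := by gcongr
      _ = 2 ^ m * |C| * (bracket z ^ N)⁻¹ := by
          rw [pow_add, pow_mul, mul_pow]; field_simp

/-! ### Resolvents of temperate operators -/

/-- A power bounded away from the unit circle polynomially: if the resolvent of `V` is of polynomial
growth in the unit disc, the powers of `V` grow polynomially, by Cauchy's estimate on the circle of
radius `n / (n + 1)`. -/
theorem exists_norm_pow_le_of_resolvent_growth {A : Type*} [NormedRing A] [NormedAlgebra ℂ A]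
    [CompleteSpace A] (V : A) (C : ℝ) (M : ℕ)
    (h : ∀ z : ℂ, ‖z‖ < 1 → ∃ W : A, W * (1 - z • V) = 1 ∧ (1 - z • V) * W = 1 ∧
      ‖W‖ ≤ C * ((1 - ‖z‖)⁻¹) ^ M) :
    ∃ C' : ℝ, ∀ n : ℕ, ‖V ^ n‖ ≤ C' * (1 + (n : ℝ)) ^ M := by
  have hinv : ∀ z : ℂ, ‖z‖ < 1 → IsUnit (1 - z • V) ∧
      ‖Ring.inverse (1 - z • V)‖ ≤ C * ((1 - ‖z‖)⁻¹) ^ M := by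
    intro z hz
    obtain ⟨W, h1, h2, h3⟩ := h z hz
    let u : Aˣ := ⟨1 - z • V, W, h2, h1⟩
    refine ⟨⟨u, rfl⟩, ?_⟩
    have : Ring.inverse (1 - z • V) = W := Ring.inverse_unit u
    rwa [this]
  have hC : 0 ≤ C := by
    have := (norm_nonneg _).trans (hinv 0 (by simp)).2
    simpa using this
  refine ⟨max ‖(1 : A)‖ (C * Real.exp 1), fun n => ?_⟩
  rcases Nat.eq_zero_or_pos n with rfl | hn
  · simp
  have hn' : (0 : ℝ) < n := by exact_mod_cast hn
  let r : NNReal := (n : NNReal) / (n + 1)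
  have hr : (r : ℝ) = n / (n + 1) := by simp [r]
  have hr0 : 0 < r := by positivity
  have hr1 : (r : ℝ) < 1 := by rw [hr, div_lt_one (by positivity)]; linarith
  have hd : DifferentiableOn ℂ (fun z : ℂ => Ring.inverse (1 - z • V)) (Metric.closedBall 0 r) := by
    intro z hz
    apply DifferentiableAt.differentiableWithinAt
    have hu := (hinv z (lt_of_le_of_lt (mem_closedBall_zero_iff.mp hz) hr1)).1
    have H₁ : Differentiable ℂ fun w : ℂ => 1 - w • V := (differentiable_id.smul_const V).const_sub 1
    exact DifferentiableAt.comp z (differentiableAt_inverse hu) H₁.differentiableAt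
  have h1 := hd.hasFPowerSeriesOnBall hr0
  have h2 := spectrum.hasFPowerSeriesOnBall_inverse_one_sub_smul ℂ V
  have h3 := HasFPowerSeriesAt.eq_formalMultilinearSeries h2.hasFPowerSeriesAt h1.hasFPowerSeriesAt
  have h4 : ‖V ^ n‖ = ‖cauchyPowerSeries (fun z : ℂ => Ring.inverse (1 - z • V)) 0 r n‖ := by
    rw [← h3, ContinuousMultilinearMap.norm_mkPiRing]
  have h5 := norm_cauchyPowerSeries_le (fun z : ℂ => Ring.inverse (1 - z • V)) 0 r n
  have hcirc : ∀ θ : ℝ, ‖Ring.inverse (1 - (circleMap 0 r θ) • V)‖ ≤ C * (1 + (n : ℝ)) ^ M := by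
    intro θ
    have hnorm : ‖circleMap 0 r θ‖ = r := by simp
    have := (hinv (circleMap 0 r θ) (by rw [hnorm]; exact hr1)).2
    rw [hnorm] at this
    have e : (1 - (r : ℝ))⁻¹ = 1 + n := by rw [hr]; field_simp; ring
    rwa [e] at this
  have h6 : (2 * Real.pi)⁻¹ * ∫ θ : ℝ in (0)..2 * Real.pi,
      ‖Ring.inverse (1 - (circleMap 0 r θ) • V)‖ ≤ C * (1 + (n : ℝ)) ^ M := by
    have := intervalIntegral.norm_integral_le_of_norm_le_const (a := 0) (b := 2 * Real.pi)
      (f := fun θ => ‖Ring.inverse (1 - (circleMap 0 r θ) • V)‖)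
      (fun θ _ => by rw [norm_norm]; exact hcirc θ)
    have h7 := (le_abs_self _).trans this
    rw [sub_zero, abs_of_pos Real.two_pi_pos] at h7
    rw [inv_mul_le_iff₀ Real.two_pi_pos]
    linarith
  have h8 : |(r : ℝ)|⁻¹ ^ n ≤ Real.exp 1 := by
    rw [abs_of_nonneg r.coe_nonneg, hr, inv_div]
    have : ((n : ℝ) + 1) / n ≤ Real.exp (1 / n) := by
      have := Real.add_one_le_exp (1 / (n : ℝ))
      have e : ((n : ℝ) + 1) / n = 1 / n + 1 := by field_simp; ring
      rwa [e]
    calc (((n : ℝ) + 1) / n) ^ n ≤ Real.exp (1 / n) ^ n := by gcongr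
      _ = Real.exp 1 := by rw [← Real.exp_nat_mul]; congr 1; field_simp
  calc ‖V ^ n‖ ≤ _ := h4.le.trans h5
    _ ≤ (C * (1 + (n : ℝ)) ^ M) * Real.exp 1 := by gcongr
    _ = (C * Real.exp 1) * (1 + (n : ℝ)) ^ M := by ring
    _ ≤ _ := by gcongr; exact le_max_right _ _

section Operator

variable {B : Type*} [NormedAddCommGroup B] [NormedSpace ℂ B]

theorem IsResolventAt.sub_eq {P : B →ₗ.[ℂ] B} {z w : ℂ} {R S : B →L[ℂ] B}
    (hR : IsResolventAt P z R) (hS : IsResolventAt P w S) : R - S = (w - z) • (R * S) := by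
  ext u
  obtain ⟨x, hx, hxu⟩ := hS.1 u
  have h1 := hR.2 x
  have h2 : z • (x : B) - P x = u - (w - z) • S u := by
    rw [← hx, ← hxu, sub_smul]; abel
  rw [h2, map_sub, map_smul, hx] at h1
  exact sub_eq_iff_eq_add.mpr (sub_eq_iff_eq_add'.mp h1)

namespace IsTemperate

variable {P : B →ₗ.[ℂ] B}

theorem isResolventAt (hP : IsTemperate P) {z : ℂ} (hz : z.im ≠ 0) :
    IsResolventAt P z (opResolvent P z) := by
  have h : ∃ R : B →L[ℂ] B, IsResolventAt P z R := by
    by_contra h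
    exact hz (hP.real_spectrum z h)
  obtain ⟨R, hR⟩ := h
  rwa [hR.opResolvent_eq]

theorem resolvent_identity (hP : IsTemperate P) {z w : ℂ} (hz : z.im ≠ 0) (hw : w.im ≠ 0) :
    opResolvent P z - opResolvent P w = (w - z) • (opResolvent P z * opResolvent P w) :=
  (hP.isResolventAt hz).sub_eq (hP.isResolventAt hw)

theorem exists_norm_resolvent_le (hP : IsTemperate P) :
    ∃ (C : ℝ) (M : ℕ), 0 ≤ C ∧ ∀ z : ℂ, z.im ≠ 0 → ‖opResolvent P z‖ ≤ C * axisWeight z ^ M := by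
  obtain ⟨C, N₀, N₁, h⟩ := hP.resolvent_bound
  refine ⟨|C|, ⌈|N₀|⌉₊ + ⌈|N₁|⌉₊, abs_nonneg C, fun z hz => (h z hz).trans ?_⟩
  have hq := one_le_axisWeight z
  have hy : 0 < |z.im| := abs_pos.mpr hz
  have aux : ∀ t N : ℝ, 0 < t → t ≤ axisWeight z → t⁻¹ ≤ axisWeight z →
      t ^ N ≤ axisWeight z ^ ⌈|N|⌉₊ := by
    intro t N ht h1 h2
    have h3 : axisWeight z ^ |N| ≤ axisWeight z ^ ⌈|N|⌉₊ := by
      rw [← Real.rpow_natCast]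
      exact Real.rpow_le_rpow_of_exponent_le hq (Nat.le_ceil _)
    refine le_trans ?_ h3
    rcases le_total 0 N with hN | hN
    · rw [abs_of_nonneg hN]; exact Real.rpow_le_rpow ht.le h1 hN
    · rw [abs_of_nonpos hN, ← inv_inv t, Real.inv_rpow (by positivity),
        ← Real.rpow_neg (by positivity)]
      exact Real.rpow_le_rpow (by positivity) h2 (by linarith)
  have h1 := aux |z.im| (-N₀) hy ((abs_im_le_bracket z).trans (bracket_le_axisWeight z))
    (inv_abs_im_le_axisWeight z)
  have h2 := aux (bracket z) N₁ (bracket_pos z) (bracket_le_axisWeight z)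
    ((inv_le_one_of_one_le₀ (one_le_bracket z)).trans hq)
  rw [abs_neg] at h1
  rw [pow_add, mul_assoc]
  have hb := bracket_pos z
  gcongr
  exact le_abs_self C

/-- The factor `-1 - 2ι (-ι - P)⁻¹`, for `ι = ± i`; these are the Cayley transform
`(1 + iP)(1 - iP)⁻¹` of `P` and its inverse. -/
def cayleyFactor (P : B →ₗ.[ℂ] B) (ι : ℂ) : B →L[ℂ] B := -1 - (2 * ι) • opResolvent P (-ι)

theorem cayleyFactor_mul (hP : IsTemperate P) {ι : ℂ} (hι : ι ^ 2 = -1) (hi : ι.im ≠ 0) :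
    cayleyFactor P ι * cayleyFactor P (-ι) = 1 := by
  have h := hP.resolvent_identity (z := -ι) (w := ι) (by simpa using hi) hi
  unfold cayleyFactor
  rw [neg_neg]
  set R := opResolvent P (-ι)
  set S := opResolvent P ι
  have h2 : (2 * ι) • R - (2 * ι) • S = (-4 : ℂ) • (R * S) := by
    rw [← smul_sub, h, smul_smul]
    congr 1
    linear_combination 4 * hι
  have h3 : ((2 * ι) • R) * ((2 * -ι) • S) = (4 : ℂ) • (R * S) := by
    rw [smul_mul_smul_comm]; congr 1; linear_combination (-4) * hι
  have h4 : (-1 - (2 * ι) • R) * (-1 - (2 * -ι) • S)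
      = 1 + ((2 * ι) • R - (2 * ι) • S) + ((2 * ι) • R) * ((2 * -ι) • S) := by
    have e : (2 * -ι) • S = -((2 * ι) • S) := by rw [← neg_smul]; congr 1; ring
    rw [e]
    generalize (2 * ι) • R = X
    generalize (2 * ι) • S = Y
    noncomm_ring
  rw [h4, h2, h3, neg_smul]; abel

/-- The Cayley transform `(1 + iP)(1 - iP)⁻¹` as an invertible bounded operator. -/
def cayley (hP : IsTemperate P) : (B →L[ℂ] B)ˣ where
  val := cayleyFactor P Complex.I
  inv := cayleyFactor P (-Complex.I)
  val_inv := hP.cayleyFactor_mul (by simp) (by simp)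
  inv_val := by
    simpa using hP.cayleyFactor_mul (ι := -Complex.I) (by simp) (by simp)

/-- For `|z| < 1`, the inverse of `1 - zV`, `V` a Cayley factor, is `(1 + z)⁻¹ (1 - (w + ι)(w - P)⁻¹)`
with `w = -ι (1 - z) / (1 + z)`. -/
theorem exists_norm_cayleyFactor_pow_le [CompleteSpace B] (hP : IsTemperate P) {ι : ℂ}
    (hι : ι = Complex.I ∨ ι = -Complex.I) :
    ∃ (C : ℝ) (M : ℕ), ∀ n : ℕ, ‖cayleyFactor P ι ^ n‖ ≤ C * (1 + (n : ℝ)) ^ M := by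
  have hι2 : ι ^ 2 = -1 := by rcases hι with rfl | rfl <;> simp
  have hιn : ‖ι‖ = 1 := by rcases hι with rfl | rfl <;> simp
  have hιim : ι.im ≠ 0 := by rcases hι with rfl | rfl <;> simp
  have hιre : ι.re = 0 := by rcases hι with rfl | rfl <;> simp
  have hιim2 : |ι.im| = 1 := by rcases hι with rfl | rfl <;> simp
  obtain ⟨C, M, hC, hR⟩ := hP.exists_norm_resolvent_le
  suffices h : ∀ z : ℂ, ‖z‖ < 1 → ∃ W : B →L[ℂ] B, W * (1 - z • cayleyFactor P ι) = 1 ∧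
      (1 - z • cayleyFactor P ι) * W = 1 ∧
      ‖W‖ ≤ (‖(1 : B →L[ℂ] B)‖ + 4 * C * 15 ^ M) * ((1 - ‖z‖)⁻¹) ^ (2 * M + 2) by
    obtain ⟨C', h'⟩ := exists_norm_pow_le_of_resolvent_growth _ _ _ h
    exact ⟨C', 2 * M + 2, h'⟩
  intro z hz
  set δ := 1 - ‖z‖ with hδ
  have hδ0 : 0 < δ := by linarith
  have hδ1 : δ ≤ 1 := by linarith [norm_nonneg z]
  have hz1 : δ ≤ ‖1 + z‖ := by
    have := norm_sub_norm_le (1 : ℂ) (-z)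
    simp only [norm_one, norm_neg, sub_neg_eq_add] at this
    linarith
  have hz0 : 1 + z ≠ 0 := by rw [← norm_pos_iff]; linarith
  set w := -ι * ((1 - z) / (1 + z)) with hw
  have hwι : w + ι = 2 * ι * z / (1 + z) := by rw [hw]; field_simp; ring
  have hwim : |w.im| = (1 - ‖z‖ ^ 2) / ‖1 + z‖ ^ 2 := by
    have e : ((1 - z) / (1 + z)).re = (1 - ‖z‖ ^ 2) / ‖1 + z‖ ^ 2 := by
      rw [Complex.div_re, ← Complex.normSq_eq_norm_sq, ← Complex.normSq_eq_norm_sq, ← add_div]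
      congr 1
      simp [Complex.normSq_apply]; ring
    rw [hw, Complex.mul_im]
    simp only [Complex.neg_re, Complex.neg_im, hιre, e]
    rw [neg_zero, zero_mul, zero_add, abs_mul, abs_neg, hιim2, one_mul, abs_of_nonneg]
    have : 0 ≤ 1 - ‖z‖ ^ 2 := by nlinarith [norm_nonneg z]
    positivity
  have hz2 : ‖1 + z‖ ≤ 2 := by
    have := norm_add_le (1 : ℂ) z
    rw [norm_one] at this; linarith
  have hwim2 : δ / 4 ≤ |w.im| := by
    rw [hwim, div_le_div_iff₀ (by norm_num) (by positivity)]
    have h1 : ‖1 + z‖ ^ 2 ≤ 4 := by nlinarith [norm_nonneg (1 + z)]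
    have h2 : δ ≤ 1 - ‖z‖ ^ 2 := by nlinarith [norm_nonneg z]
    nlinarith
  have hwim0 : w.im ≠ 0 := by rw [← abs_pos]; linarith
  have hwn : ‖w‖ ≤ 2 / δ := by
    rw [hw, norm_mul, norm_neg, hιn, one_mul, norm_div]
    have : ‖1 - z‖ ≤ 2 := by
      have := norm_sub_le (1 : ℂ) z
      rw [norm_one] at this; linarith
    gcongr
  have hq : axisWeight w ≤ 15 / δ ^ 2 := by
    have h1 : bracket w ≤ 3 / δ := by
      refine (bracket_le_one_add_norm w).trans ?_
      have : 1 ≤ 1 / δ := by rw [le_div_iff₀ hδ0]; linarith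
      calc 1 + ‖w‖ ≤ 1 / δ + 2 / δ := add_le_add this hwn
        _ = 3 / δ := by ring
    have h2 : 1 + |w.im|⁻¹ ≤ 5 / δ := by
      have h3 : |w.im|⁻¹ ≤ 4 / δ := by
        rw [← inv_div]; exact inv_anti₀ (by positivity) hwim2
      have : 1 ≤ 1 / δ := by rw [le_div_iff₀ hδ0]; linarith
      calc 1 + |w.im|⁻¹ ≤ 1 / δ + 4 / δ := add_le_add this h3
        _ = 5 / δ := by ring
    calc axisWeight w ≤ 3 / δ * (5 / δ) := by
          unfold axisWeight; gcongr
      _ = 15 / δ ^ 2 := by field_simp; norm_num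
  have hid := hP.resolvent_identity (z := -ι) (w := w) (by simpa using hιim) hwim0
  have hid2 := hP.resolvent_identity (z := w) (w := -ι) hwim0 (by simpa using hιim)
  set R := opResolvent P (-ι)
  set S := opResolvent P w
  have hV : 1 - z • cayleyFactor P ι = (1 + z) • (1 + (w + ι) • R) := by
    rw [hwι]
    unfold cayleyFactor
    rw [smul_add, smul_smul, mul_div_cancel₀ _ hz0, smul_sub, add_smul, one_smul, smul_neg, smul_smul]
    rw [show z * (2 * ι) = 2 * ι * z by ring]; abel
  have hX : (w + ι) • R - (w + ι) • S = ((w + ι) • R) * ((w + ι) • S) := by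
    rw [← smul_sub, hid, sub_neg_eq_add, smul_smul, smul_mul_smul_comm]
  have hY : (w + ι) • R - (w + ι) • S = ((w + ι) • S) * ((w + ι) • R) := by
    rw [← neg_sub, ← smul_sub, hid2, ← neg_add', ← smul_neg, ← neg_smul, neg_neg, add_comm ι w,
      smul_smul, smul_mul_smul_comm]
  generalize hXR : (w + ι) • R = X at hV hX hY
  have e1 : (1 + X) * (1 - (w + ι) • S) = 1 := by
    calc (1 + X) * (1 - (w + ι) • S) = 1 + (X - (w + ι) • S) - X * ((w + ι) • S) := by
          generalize (w + ι) • S = Y; noncomm_ring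
      _ = 1 := by rw [hX]; abel
  have e2 : (1 - (w + ι) • S) * (1 + X) = 1 := by
    calc (1 - (w + ι) • S) * (1 + X) = 1 + (X - (w + ι) • S) - ((w + ι) • S) * X := by
          generalize (w + ι) • S = Y; noncomm_ring
      _ = 1 := by rw [hY]; abel
  refine ⟨(1 + z)⁻¹ • (1 - (w + ι) • S), ?_, ?_, ?_⟩
  · rw [hV, smul_mul_smul_comm, e2, inv_mul_cancel₀ hz0, one_smul]
  · rw [hV, smul_mul_smul_comm, e1, mul_inv_cancel₀ hz0, one_smul]
  · have hδi : 1 ≤ δ⁻¹ := (one_le_inv₀ hδ0).mpr hδ1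
    have hS : ‖S‖ ≤ C * (15 ^ M * (δ⁻¹) ^ (2 * M)) := by
      refine (hR w hwim0).trans ?_
      gcongr
      calc axisWeight w ^ M ≤ (15 / δ ^ 2) ^ M := by
            gcongr; exact (axisWeight_pos w).le
        _ = _ := by rw [div_pow, ← pow_mul, inv_pow, div_eq_mul_inv]
    have hwi : ‖w + ι‖ ≤ 2 * δ⁻¹ := by
      rw [hwι, norm_div, norm_mul, norm_mul, hιn]
      simp only [Complex.norm_ofNat, mul_one]
      rw [← div_eq_mul_inv]
      have : ‖z‖ ≤ 1 := hz.le
      calc 2 * ‖z‖ / ‖1 + z‖ ≤ 2 * 1 / δ := by gcongr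
        _ = _ := by ring
    rw [norm_smul, norm_inv]
    have h1 : ‖1 + z‖⁻¹ ≤ δ⁻¹ := inv_anti₀ hδ0 hz1
    have h2 : ‖(1 : B →L[ℂ] B) - (w + ι) • S‖ ≤
        (‖(1 : B →L[ℂ] B)‖ + 4 * C * 15 ^ M) * δ⁻¹ ^ (2 * M + 1) := by
      have h3 : ‖(w + ι) • S‖ ≤ 2 * δ⁻¹ * (C * (15 ^ M * (δ⁻¹) ^ (2 * M))) := by
        rw [norm_smul]; gcongr
      have h4 : 1 ≤ δ⁻¹ ^ (2 * M + 1) := one_le_pow₀ hδi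
      have h5 : ‖(1 : B →L[ℂ] B)‖ ≤ ‖(1 : B →L[ℂ] B)‖ * δ⁻¹ ^ (2 * M + 1) :=
        le_mul_of_one_le_right (norm_nonneg _) h4
      refine (norm_sub_le _ _).trans ?_
      have h6 : 0 ≤ C * 15 ^ M * δ⁻¹ ^ (2 * M + 1) := by positivity
      have h7 : 2 * δ⁻¹ * (C * (15 ^ M * (δ⁻¹) ^ (2 * M))) = 2 * (C * 15 ^ M * δ⁻¹ ^ (2 * M + 1)) := by
        ring
      nlinarith
    calc ‖1 + z‖⁻¹ * ‖(1 : B →L[ℂ] B) - (w + ι) • S‖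
        ≤ δ⁻¹ * ((‖(1 : B →L[ℂ] B)‖ + 4 * C * 15 ^ M) * δ⁻¹ ^ (2 * M + 1)) := by gcongr
      _ = _ := by ring

/-- The integer powers of the Cayley transform grow polynomially. -/
theorem exists_norm_cayley_zpow_le [CompleteSpace B] (hP : IsTemperate P) :
    ∃ (C : ℝ) (M : ℕ), 0 ≤ C ∧
      ∀ n : ℤ, ‖((hP.cayley ^ n : (B →L[ℂ] B)ˣ) : B →L[ℂ] B)‖ ≤ C * (1 + |(n : ℝ)|) ^ M := by
  obtain ⟨C₁, M₁, h₁⟩ := hP.exists_norm_cayleyFactor_pow_le (Or.inl rfl)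
  obtain ⟨C₂, M₂, h₂⟩ := hP.exists_norm_cayleyFactor_pow_le (Or.inr rfl)
  refine ⟨max |C₁| |C₂|, max M₁ M₂, by positivity, fun n => ?_⟩
  have hn : 1 ≤ 1 + |(n : ℝ)| := by linarith [abs_nonneg (n : ℝ)]
  obtain ⟨k, rfl | rfl⟩ := n.eq_nat_or_neg
  · rw [zpow_natCast, Units.val_pow_eq_pow_val]
    refine (h₁ k).trans ?_
    simp only [Int.cast_natCast, Nat.abs_cast] at hn ⊢
    exact mul_le_mul ((le_abs_self _).trans (le_max_left _ _))
      (pow_le_pow_right₀ hn (le_max_left _ _)) (by positivity) (by positivity)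
  · rw [zpow_neg, zpow_natCast, ← inv_pow, Units.val_pow_eq_pow_val]
    refine (h₂ k).trans ?_
    simp only [Int.cast_neg, Int.cast_natCast, abs_neg, Nat.abs_cast] at hn ⊢
    exact mul_le_mul ((le_abs_self _).trans (le_max_right _ _))
      (pow_le_pow_right₀ hn (le_max_right _ _)) (by positivity) (by positivity)

end IsTemperate

end Operator

/-! ### Smooth functions on the projective line `ℝ ∪ {∞}` -/

/-- The vector field `(1 + x²)/2 · d/dx`; it is `d/dθ` in the coordinate `x = tan (θ / 2)` on the
circle `ℝ ∪ {∞}`. -/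
def circleDeriv (h : ℝ → ℂ) : ℝ → ℂ := fun x => (((1 + x ^ 2) / 2 : ℝ) : ℂ) * deriv h x

/-- `h` is smooth, and the iterated derivatives along the circle up to order `m` have equal limits at
`± ∞`, i.e. they are continuous on `ℝ ∪ {∞}`. -/
def IsCircleDiff (m : ℕ) (h : ℝ → ℂ) : Prop :=
  ContDiff ℝ ∞ h ∧ ∀ j ≤ m, ∃ c : ℂ, Tendsto (circleDeriv^[j] h) (cocompact ℝ) (𝓝 c)

/-- `h` is smooth as a function on the circle `ℝ ∪ {∞}`. -/
def IsCircleSmooth (h : ℝ → ℂ) : Prop := ∀ m, IsCircleDiff m h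

theorem contDiff_circleDeriv {h : ℝ → ℂ} (hh : ContDiff ℝ ∞ h) : ContDiff ℝ ∞ (circleDeriv h) := by
  unfold circleDeriv
  have h1 : ContDiff ℝ ∞ (deriv h) := (contDiff_infty_iff_deriv.mp hh).2
  have h2 : ContDiff ℝ ∞ (fun x : ℝ => (((1 + x ^ 2) / 2 : ℝ) : ℂ)) :=
    Complex.ofRealCLM.contDiff.comp ((contDiff_const.add (contDiff_id.pow 2)).div_const 2)
  exact h2.mul h1

theorem contDiff_circleDeriv_iterate {h : ℝ → ℂ} (hh : ContDiff ℝ ∞ h) (j : ℕ) :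
    ContDiff ℝ ∞ (circleDeriv^[j] h) := by
  induction j with
  | zero => exact hh
  | succ j ih => rw [Function.iterate_succ_apply']; exact contDiff_circleDeriv ih

theorem circleDeriv_add {h k : ℝ → ℂ} (hh : ContDiff ℝ ∞ h) (hk : ContDiff ℝ ∞ k) :
    circleDeriv (h + k) = circleDeriv h + circleDeriv k := by
  ext x
  have h1 := (hh.differentiable (by simp)).differentiableAt (x := x)
  have h2 := (hk.differentiable (by simp)).differentiableAt (x := x)
  simp only [circleDeriv, Pi.add_apply, deriv_add h1 h2]; ring

theorem circleDeriv_mul {h k : ℝ → ℂ} (hh : ContDiff ℝ ∞ h) (hk : ContDiff ℝ ∞ k) :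
    circleDeriv (h * k) = circleDeriv h * k + h * circleDeriv k := by
  ext x
  have h1 := (hh.differentiable (by simp)).differentiableAt (x := x)
  have h2 := (hk.differentiable (by simp)).differentiableAt (x := x)
  simp only [circleDeriv, Pi.add_apply, Pi.mul_apply, deriv_mul h1 h2]; ring

theorem circleDeriv_const_smul (c : ℂ) (h : ℝ → ℂ) : circleDeriv (c • h) = c • circleDeriv h := by
  ext x
  simp only [circleDeriv, Pi.smul_apply, deriv_const_smul_field, smul_eq_mul]; ring

theorem circleDeriv_const (c : ℂ) : circleDeriv (fun _ => c) = 0 := by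
  ext x; simp [circleDeriv]

theorem circleDeriv_iterate_add {h k : ℝ → ℂ} (hh : ContDiff ℝ ∞ h) (hk : ContDiff ℝ ∞ k) (j : ℕ) :
    circleDeriv^[j] (h + k) = circleDeriv^[j] h + circleDeriv^[j] k := by
  induction j with
  | zero => rfl
  | succ j ih =>
    simp only [Function.iterate_succ_apply', ih]
    exact circleDeriv_add (contDiff_circleDeriv_iterate hh j) (contDiff_circleDeriv_iterate hk j)

theorem circleDeriv_iterate_const_smul (c : ℂ) (h : ℝ → ℂ) (j : ℕ) :
    circleDeriv^[j] (c • h) = c • circleDeriv^[j] h := by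
  induction j with
  | zero => rfl
  | succ j ih => simp only [Function.iterate_succ_apply', ih, circleDeriv_const_smul]

namespace IsCircleDiff

theorem contDiff {m : ℕ} {h : ℝ → ℂ} (hh : IsCircleDiff m h) : ContDiff ℝ ∞ h := hh.1

theorem mono {m k : ℕ} {h : ℝ → ℂ} (hh : IsCircleDiff m h) (hk : k ≤ m) : IsCircleDiff k h :=
  ⟨hh.1, fun j hj => hh.2 j (hj.trans hk)⟩

theorem succ_iff {m : ℕ} {h : ℝ → ℂ} : IsCircleDiff (m + 1) h ↔
    ContDiff ℝ ∞ h ∧ (∃ c, Tendsto h (cocompact ℝ) (𝓝 c)) ∧ IsCircleDiff m (circleDeriv h) := by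
  constructor
  · intro hh
    refine ⟨hh.1, hh.2 0 (Nat.zero_le _), contDiff_circleDeriv hh.1, fun j hj => ?_⟩
    exact hh.2 (j + 1) (by lia)
  · rintro ⟨h1, h2, h3⟩
    refine ⟨h1, fun j hj => ?_⟩
    cases j with
    | zero => exact h2
    | succ j => exact h3.2 j (by lia)

theorem zero_iff {h : ℝ → ℂ} : IsCircleDiff 0 h ↔
    ContDiff ℝ ∞ h ∧ ∃ c, Tendsto h (cocompact ℝ) (𝓝 c) := by
  constructor
  · exact fun hh => ⟨hh.1, hh.2 0 le_rfl⟩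
  · rintro ⟨h1, h2⟩
    refine ⟨h1, fun j hj => ?_⟩
    obtain rfl : j = 0 := by lia
    exact h2

theorem add {m : ℕ} {h k : ℝ → ℂ} (hh : IsCircleDiff m h) (hk : IsCircleDiff m k) :
    IsCircleDiff m (h + k) := by
  refine ⟨hh.1.add hk.1, fun j hj => ?_⟩
  obtain ⟨a, ha⟩ := hh.2 j hj
  obtain ⟨b, hb⟩ := hk.2 j hj
  exact ⟨a + b, by rw [circleDeriv_iterate_add hh.1 hk.1]; exact ha.add hb⟩

theorem const_smul {m : ℕ} {h : ℝ → ℂ} (hh : IsCircleDiff m h) (c : ℂ) :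
    IsCircleDiff m (c • h) := by
  refine ⟨hh.1.const_smul c, fun j hj => ?_⟩
  obtain ⟨a, ha⟩ := hh.2 j hj
  exact ⟨c • a, by rw [circleDeriv_iterate_const_smul]; exact ha.const_smul c⟩

theorem const (m : ℕ) (c : ℂ) : IsCircleDiff m (fun _ => c) := by
  induction m generalizing c with
  | zero => exact zero_iff.mpr ⟨contDiff_const, c, tendsto_const_nhds⟩
  | succ m ih =>
    exact succ_iff.mpr ⟨contDiff_const, ⟨c, tendsto_const_nhds⟩, by rw [circleDeriv_const]; exact ih 0⟩

theorem mul {m : ℕ} {h k : ℝ → ℂ} (hh : IsCircleDiff m h) (hk : IsCircleDiff m k) :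
    IsCircleDiff m (h * k) := by
  induction m generalizing h k with
  | zero =>
    rw [zero_iff] at *
    obtain ⟨h1, a, ha⟩ := hh
    obtain ⟨k1, b, hb⟩ := hk
    exact ⟨h1.mul k1, a * b, ha.mul hb⟩
  | succ m ih =>
    have hh' := succ_iff.mp hh
    have hk' := succ_iff.mp hk
    obtain ⟨h1, ⟨a, ha⟩, h2⟩ := hh'
    obtain ⟨k1, ⟨b, hb⟩, k2⟩ := hk'
    refine succ_iff.mpr ⟨h1.mul k1, ⟨a * b, ha.mul hb⟩, ?_⟩
    rw [circleDeriv_mul h1 k1]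
    exact (ih h2 (hk.mono (by lia))).add (ih (hh.mono (by lia)) k2)

end IsCircleDiff

theorem exists_bound_of_tendsto_cocompact {h : ℝ → ℂ} (hc : Continuous h)
    (hl : ∃ c : ℂ, Tendsto h (cocompact ℝ) (𝓝 c)) : ∃ C : ℝ, 0 ≤ C ∧ ∀ x, ‖h x‖ ≤ C := by
  obtain ⟨c, hc'⟩ := hl
  have h1 : ∀ᶠ x in cocompact ℝ, ‖h x‖ ≤ ‖c‖ + 1 := by
    have := hc'.norm.eventually (gt_mem_nhds (show ‖c‖ < ‖c‖ + 1 by linarith))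
    exact this.mono fun x hx => hx.le
  obtain ⟨K, hK, hKs⟩ := mem_cocompact.mp h1
  obtain ⟨C, hC⟩ := hK.exists_bound_of_continuousOn hc.continuousOn
  refine ⟨max (‖c‖ + 1) C, by positivity, fun x => ?_⟩
  by_cases hx : x ∈ K
  · exact (hC x hx).trans (le_max_right _ _)
  · exact (hKs hx).trans (le_max_left _ _)

namespace IsCircleSmooth

theorem contDiff {h : ℝ → ℂ} (hh : IsCircleSmooth h) : ContDiff ℝ ∞ h := (hh 0).1

theorem circleDeriv {h : ℝ → ℂ} (hh : IsCircleSmooth h) : IsCircleSmooth (circleDeriv h) :=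
  fun m => (IsCircleDiff.succ_iff.mp (hh (m + 1))).2.2

theorem add {h k : ℝ → ℂ} (hh : IsCircleSmooth h) (hk : IsCircleSmooth k) :
    IsCircleSmooth (h + k) := fun m => (hh m).add (hk m)

theorem mul {h k : ℝ → ℂ} (hh : IsCircleSmooth h) (hk : IsCircleSmooth k) :
    IsCircleSmooth (h * k) := fun m => (hh m).mul (hk m)

theorem const_smul {h : ℝ → ℂ} (hh : IsCircleSmooth h) (c : ℂ) : IsCircleSmooth (c • h) :=
  fun m => (hh m).const_smul c

theorem const (c : ℂ) : IsCircleSmooth (fun _ => c) := fun m => IsCircleDiff.const m c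

theorem exists_limit {h : ℝ → ℂ} (hh : IsCircleSmooth h) :
    ∃ c : ℂ, Tendsto h (cocompact ℝ) (𝓝 c) := (hh 0).2 0 le_rfl

theorem exists_bound {h : ℝ → ℂ} (hh : IsCircleSmooth h) : ∃ C : ℝ, 0 ≤ C ∧ ∀ x, ‖h x‖ ≤ C :=
  exists_bound_of_tendsto_cocompact hh.contDiff.continuous hh.exists_limit

end IsCircleSmooth

/-! ### Resolvent functions `1 / (ζ - f)` and `1 / (x - w)` -/

theorem contDiff_inv_sub {f : ℝ → ℂ} (hf : ContDiff ℝ ∞ f) {ζ : ℂ} (h : ∀ x, ζ - f x ≠ 0) :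
    ContDiff ℝ ∞ (fun x => (ζ - f x)⁻¹) := (contDiff_const.sub hf).inv h

theorem circleDeriv_inv_sub {f : ℝ → ℂ} (hf : ContDiff ℝ ∞ f) {ζ : ℂ} (h : ∀ x, ζ - f x ≠ 0) :
    circleDeriv (fun x => (ζ - f x)⁻¹) =
      (fun x => (ζ - f x)⁻¹) * (fun x => (ζ - f x)⁻¹) * circleDeriv f := by
  ext x
  have h1 := (hf.differentiable (by simp)).differentiableAt (x := x)
  have h2 : HasDerivAt (fun x => ζ - f x) (-deriv f x) x := by
    simpa using (h1.hasDerivAt.const_sub ζ)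
  have h3 := (h2.fun_inv (h x)).deriv
  simp only [circleDeriv, Pi.mul_apply, h3, neg_neg]
  have := h x
  field_simp

theorem IsCircleSmooth.inv_sub {f : ℝ → ℂ} (hf : IsCircleSmooth f) {ζ : ℂ} {d : ℝ} (hd : 0 < d)
    (h : ∀ x, d ≤ ‖ζ - f x‖) : IsCircleSmooth (fun x => (ζ - f x)⁻¹) := by
  have h0 : ∀ x, ζ - f x ≠ 0 := fun x => norm_pos_iff.mp (hd.trans_le (h x))
  have hlim : ∃ c, Tendsto (fun x => (ζ - f x)⁻¹) (cocompact ℝ) (𝓝 c) := by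
    obtain ⟨a, ha⟩ := hf.exists_limit
    refine ⟨(ζ - a)⁻¹, (ha.const_sub ζ).inv₀ ?_⟩
    rw [← norm_pos_iff]
    exact hd.trans_le (ge_of_tendsto' (ha.const_sub ζ).norm h)
  intro m
  induction m with
  | zero => exact IsCircleDiff.zero_iff.mpr ⟨contDiff_inv_sub hf.contDiff h0, hlim⟩
  | succ m ih =>
    refine IsCircleDiff.succ_iff.mpr ⟨contDiff_inv_sub hf.contDiff h0, hlim, ?_⟩
    rw [circleDeriv_inv_sub hf.contDiff h0]
    exact (ih.mul ih).mul (hf.circleDeriv m)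

/-- Derivatives of `1 / (ζ - f)` are bounded by powers of the reciprocal distance of `ζ` from the
range of `f`, uniformly in `ζ`. -/
theorem exists_circleDeriv_inv_sub_le {f : ℝ → ℂ} (hf : IsCircleSmooth f) (m : ℕ) :
    ∀ (k : ℕ) (ψ : ℝ → ℂ), IsCircleSmooth ψ → ∃ C : ℝ, 0 ≤ C ∧ ∀ (ζ : ℂ) (d : ℝ), 0 < d →
      (∀ x, d ≤ ‖ζ - f x‖) → ∀ x,
        ‖circleDeriv^[m] (ψ * (fun x => (ζ - f x)⁻¹) ^ k) x‖ ≤ C * d⁻¹ ^ k * (1 + d⁻¹) ^ m := by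
  induction m with
  | zero =>
    intro k ψ hψ
    obtain ⟨C, hC, h⟩ := hψ.exists_bound
    refine ⟨C, hC, fun ζ d hd hζ x => ?_⟩
    simp only [Function.iterate_zero, id_eq, Pi.mul_apply, Pi.pow_apply, pow_zero, mul_one, norm_mul,
      norm_pow, norm_inv]
    gcongr
    · exact h x
    · exact hζ x
  | succ m ih =>
    intro k ψ hψ
    obtain ⟨C₁, hC₁, h₁⟩ := ih k _ hψ.circleDeriv
    obtain ⟨C₂, hC₂, h₂⟩ := ih (k + 1) ((k : ℂ) • (ψ * circleDeriv f))
      ((hψ.mul hf.circleDeriv).const_smul _)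
    refine ⟨C₁ + C₂, by positivity, fun ζ d hd hζ x => ?_⟩
    have h0 : ∀ x, ζ - f x ≠ 0 := fun x => norm_pos_iff.mp (hd.trans_le (hζ x))
    have hs := contDiff_inv_sub hf.contDiff h0
    have hsk : ∀ k : ℕ, ContDiff ℝ ∞ ((fun x => (ζ - f x)⁻¹) ^ k) := fun k => hs.pow k
    have key : circleDeriv (ψ * (fun x => (ζ - f x)⁻¹) ^ k) =
        circleDeriv ψ * (fun x => (ζ - f x)⁻¹) ^ k +
        ((k : ℂ) • (ψ * circleDeriv f)) * (fun x => (ζ - f x)⁻¹) ^ (k + 1) := by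
      have hpow : circleDeriv ((fun x => (ζ - f x)⁻¹) ^ k) =
          (k : ℂ) • (circleDeriv f * (fun x => (ζ - f x)⁻¹) ^ (k + 1)) := by
        clear h₁ h₂ ih
        induction k with
        | zero =>
          rw [pow_zero, Nat.cast_zero, zero_smul]; exact circleDeriv_const 1
        | succ k ihk =>
          rw [pow_succ, circleDeriv_mul (hsk k) hs, ihk, circleDeriv_inv_sub hf.contDiff h0]
          ext x
          simp only [Pi.add_apply, Pi.mul_apply, Pi.smul_apply, Pi.pow_apply, smul_eq_mul]
          push_cast; ring
      rw [circleDeriv_mul hψ.contDiff (hsk k), hpow]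
      ext x
      simp only [Pi.add_apply, Pi.mul_apply, Pi.smul_apply, Pi.pow_apply, smul_eq_mul]
      ring
    have e1 : ContDiff ℝ ∞ (circleDeriv ψ * (fun x => (ζ - f x)⁻¹) ^ k) :=
      hψ.circleDeriv.contDiff.mul (hsk k)
    have e2 : ContDiff ℝ ∞ (((k : ℂ) • (ψ * circleDeriv f)) * (fun x => (ζ - f x)⁻¹) ^ (k + 1)) :=
      (((hψ.mul hf.circleDeriv).const_smul _).contDiff).mul (hsk (k + 1))
    rw [Function.iterate_succ_apply, key, circleDeriv_iterate_add e1 e2, Pi.add_apply]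
    have hd' : 0 < d⁻¹ := inv_pos.mpr hd
    calc _ ≤ C₁ * d⁻¹ ^ k * (1 + d⁻¹) ^ m + C₂ * d⁻¹ ^ (k + 1) * (1 + d⁻¹) ^ m :=
          (norm_add_le _ _).trans (add_le_add (h₁ ζ d hd hζ x) (h₂ ζ d hd hζ x))
      _ = d⁻¹ ^ k * (1 + d⁻¹) ^ m * (C₁ + C₂ * d⁻¹) := by ring
      _ ≤ d⁻¹ ^ k * (1 + d⁻¹) ^ m * ((C₁ + C₂) * (1 + d⁻¹)) := by
          gcongr
          nlinarith
      _ = _ := by ring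

theorem ofReal_sub_ne_zero {w : ℂ} (hw : w.im ≠ 0) (x : ℝ) : (x : ℂ) - w ≠ 0 := by
  intro h
  apply hw
  have := congrArg Complex.im h
  simpa using this

theorem norm_inv_ofReal_sub_le {w : ℂ} (hw : w.im ≠ 0) (x : ℝ) : ‖((x : ℂ) - w)⁻¹‖ ≤ |w.im|⁻¹ := by
  rw [norm_inv]
  apply inv_anti₀ (abs_pos.mpr hw)
  have := Complex.abs_im_le_norm ((x : ℂ) - w)
  simpa using this

theorem contDiff_inv_ofReal_sub {w : ℂ} (hw : w.im ≠ 0) :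
    ContDiff ℝ ∞ (fun x : ℝ => ((x : ℂ) - w)⁻¹) :=
  (Complex.ofRealCLM.contDiff.sub contDiff_const).inv (ofReal_sub_ne_zero hw)

theorem hasDerivAt_inv_ofReal_sub {w : ℂ} (hw : w.im ≠ 0) (x : ℝ) :
    HasDerivAt (fun x : ℝ => ((x : ℂ) - w)⁻¹) (-(((x : ℂ) - w)⁻¹) ^ 2) x := by
  have h1 : HasDerivAt (fun x : ℝ => (x : ℂ) - w) 1 x := by
    simpa using (HasDerivAt.ofReal_comp (hasDerivAt_id x)).sub_const w
  convert! h1.fun_inv (ofReal_sub_ne_zero hw x) using 1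
  rw [inv_pow]; ring

/-- The circle derivative of `(x - w)^{-k-1}`, from
`1 + x² = (x - w)² + 2w(x - w) + 1 + w²`. -/
theorem circleDeriv_inv_ofReal_sub_pow {w : ℂ} (hw : w.im ≠ 0) (k : ℕ) :
    circleDeriv ((fun x : ℝ => ((x : ℂ) - w)⁻¹) ^ (k + 1)) =
      (-((k : ℂ) + 1) / 2) • ((fun x : ℝ => ((x : ℂ) - w)⁻¹) ^ k) +
      ((-((k : ℂ) + 1) * w) • ((fun x : ℝ => ((x : ℂ) - w)⁻¹) ^ (k + 1)) +
      (-((k : ℂ) + 1) / 2 * (1 + w ^ 2)) • ((fun x : ℝ => ((x : ℂ) - w)⁻¹) ^ (k + 2))) := by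
  ext x
  have h1 := (hasDerivAt_inv_ofReal_sub hw x).pow (k + 1)
  simp only [circleDeriv, h1.deriv, Pi.add_apply, Pi.smul_apply, Pi.pow_apply, smul_eq_mul]
  have h0 := ofReal_sub_ne_zero hw x
  generalize hy : (x : ℂ) - w = y at h0 ⊢
  have hx : (x : ℂ) = y + w := by rw [← hy]; ring
  push_cast
  rw [hx]
  simp only [inv_pow]
  field_simp
  ring

theorem isCircleSmooth_inv_ofReal_sub_pow {w : ℂ} (hw : w.im ≠ 0) (k : ℕ) :
    IsCircleSmooth ((fun x : ℝ => ((x : ℂ) - w)⁻¹) ^ k) := by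
  have hlim : ∀ k : ℕ, ∃ c, Tendsto ((fun x : ℝ => ((x : ℂ) - w)⁻¹) ^ k) (cocompact ℝ) (𝓝 c) := by
    intro k
    refine ⟨0 ^ k, Tendsto.pow ?_ k⟩
    apply tendsto_inv₀_cobounded.comp
    rw [← tendsto_norm_atTop_iff_cobounded]
    have h1 : Tendsto (fun x : ℝ => ‖x‖ - ‖w‖) (cocompact ℝ) atTop :=
      tendsto_atTop_add_const_right _ _ (tendsto_norm_cocompact_atTop)
    refine tendsto_atTop_mono (fun x => ?_) h1
    have := norm_sub_norm_le (x : ℂ) w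
    simpa using this
  intro m
  induction m generalizing k with
  | zero => exact IsCircleDiff.zero_iff.mpr ⟨(contDiff_inv_ofReal_sub hw).pow k, hlim k⟩
  | succ m ih =>
    cases k with
    | zero => rw [pow_zero]; exact IsCircleDiff.const (m + 1) 1
    | succ k =>
      refine IsCircleDiff.succ_iff.mpr ⟨(contDiff_inv_ofReal_sub hw).pow _, hlim _, ?_⟩
      rw [circleDeriv_inv_ofReal_sub_pow hw]
      exact ((ih _).const_smul _).add (((ih _).const_smul _).add ((ih _).const_smul _))

theorem isCircleSmooth_inv_ofReal_sub {w : ℂ} (hw : w.im ≠ 0) :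
    IsCircleSmooth (fun x : ℝ => ((x : ℂ) - w)⁻¹) := by
  simpa using isCircleSmooth_inv_ofReal_sub_pow hw 1

theorem exists_circleDeriv_inv_ofReal_sub_pow_le (m : ℕ) : ∀ k : ℕ, ∃ C : ℝ, 0 ≤ C ∧
    ∀ w : ℂ, w.im ≠ 0 → ∀ x, ‖circleDeriv^[m] ((fun x : ℝ => ((x : ℂ) - w)⁻¹) ^ k) x‖ ≤
      C * axisWeight w ^ (k + 3 * m) := by
  induction m with
  | zero =>
    intro k
    refine ⟨1, zero_le_one, fun w hw x => ?_⟩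
    simp only [Function.iterate_zero, id_eq, Pi.pow_apply, norm_pow, one_mul, mul_zero, add_zero]
    gcongr
    exact (norm_inv_ofReal_sub_le hw x).trans (inv_abs_im_le_axisWeight w)
  | succ m ih =>
    intro k
    cases k with
    | zero =>
      refine ⟨0, le_rfl, fun w hw x => ?_⟩
      have e : circleDeriv^[m] (0 : ℝ → ℂ) = 0 := by
        have := circleDeriv_iterate_const_smul 0 (0 : ℝ → ℂ) m
        simpa using this
      have : circleDeriv ((fun x : ℝ => ((x : ℂ) - w)⁻¹) ^ 0) = 0 := by
        rw [pow_zero]; exact circleDeriv_const 1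
      rw [Function.iterate_succ_apply, this, e]; simp
    | succ k =>
      obtain ⟨C₀, hC₀, h₀⟩ := ih k
      obtain ⟨C₁, hC₁, h₁⟩ := ih (k + 1)
      obtain ⟨C₂, hC₂, h₂⟩ := ih (k + 2)
      refine ⟨((k : ℝ) + 1) * (C₀ + C₁ + C₂), by positivity, fun w hw x => ?_⟩
      have hs : ∀ (c : ℂ) (k : ℕ), ContDiff ℝ ∞ (c • (fun x : ℝ => ((x : ℂ) - w)⁻¹) ^ k) :=
        fun c k => ((contDiff_inv_ofReal_sub hw).pow k).const_smul c
      have hs2 : ∀ (a b : ℂ) (k l : ℕ), ContDiff ℝ ∞ (a • (fun x : ℝ => ((x : ℂ) - w)⁻¹) ^ k +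
        b • (fun x : ℝ => ((x : ℂ) - w)⁻¹) ^ l) := fun a b k l => (hs a k).add (hs b l)
      rw [Function.iterate_succ_apply, circleDeriv_inv_ofReal_sub_pow hw,
        circleDeriv_iterate_add (hs _ _) (hs2 _ _ _ _),
        circleDeriv_iterate_add (hs _ _) (hs _ _),
        circleDeriv_iterate_const_smul, circleDeriv_iterate_const_smul,
        circleDeriv_iterate_const_smul]
      simp only [Pi.add_apply, Pi.smul_apply, smul_eq_mul]
      have hq := one_le_axisWeight w
      have hk : ‖-((k : ℂ) + 1)‖ = (k : ℝ) + 1 := by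
        rw [norm_neg]; exact_mod_cast Complex.norm_natCast (k + 1)
      have hwn : ‖w‖ ≤ axisWeight w := (norm_le_bracket w).trans (bracket_le_axisWeight w)
      have hw2 : ‖1 + w ^ 2‖ ≤ axisWeight w ^ 2 := by
        have h3 : ‖1 + w ^ 2‖ ≤ bracket w ^ 2 := by
          rw [bracket_sq]
          refine (norm_add_le _ _).trans ?_
          simp
        have := bracket_le_axisWeight w
        have := bracket_pos w
        exact h3.trans (by gcongr)
      have hmono : ∀ a b : ℕ, a ≤ b → axisWeight w ^ a ≤ axisWeight w ^ b :=
        fun a b hab => pow_le_pow_right₀ hq hab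
      have hq0 := axisWeight_pos w
      have t0 : ‖-((k : ℂ) + 1) / 2 * circleDeriv^[m] ((fun x : ℝ => ((x : ℂ) - w)⁻¹) ^ k) x‖ ≤
          ((k : ℝ) + 1) * C₀ * axisWeight w ^ (k + 1 + 3 * (m + 1)) := by
        rw [norm_mul, norm_div, hk, Complex.norm_ofNat]
        calc ((k : ℝ) + 1) / 2 * _ ≤ ((k : ℝ) + 1) * (C₀ * axisWeight w ^ (k + 3 * m)) :=
              mul_le_mul (by linarith [(Nat.cast_nonneg k : (0 : ℝ) ≤ k)]) (h₀ w hw x)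
                (norm_nonneg _) (by positivity)
          _ ≤ ((k : ℝ) + 1) * (C₀ * axisWeight w ^ (k + 1 + 3 * (m + 1))) := by
              gcongr 2; exact hmono _ _ (by lia)
          _ = _ := by ring
      have t1 : ‖-((k : ℂ) + 1) * w * circleDeriv^[m] ((fun x : ℝ => ((x : ℂ) - w)⁻¹) ^ (k + 1)) x‖ ≤
          ((k : ℝ) + 1) * C₁ * axisWeight w ^ (k + 1 + 3 * (m + 1)) := by
        rw [norm_mul, norm_mul, hk]
        calc ((k : ℝ) + 1) * ‖w‖ * _
            ≤ ((k : ℝ) + 1) * axisWeight w * (C₁ * axisWeight w ^ (k + 1 + 3 * m)) := by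
              gcongr; exact h₁ w hw x
          _ = ((k : ℝ) + 1) * C₁ * axisWeight w ^ (k + 1 + 3 * m + 1) := by ring
          _ ≤ _ := mul_le_mul_of_nonneg_left (hmono _ _ (by lia)) (by positivity)
      have t2 : ‖-((k : ℂ) + 1) / 2 * (1 + w ^ 2) *
          circleDeriv^[m] ((fun x : ℝ => ((x : ℂ) - w)⁻¹) ^ (k + 2)) x‖ ≤
          ((k : ℝ) + 1) * C₂ * axisWeight w ^ (k + 1 + 3 * (m + 1)) := by
        rw [norm_mul, norm_mul, norm_div, hk, Complex.norm_ofNat]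
        calc ((k : ℝ) + 1) / 2 * ‖1 + w ^ 2‖ * _
            ≤ ((k : ℝ) + 1) * axisWeight w ^ 2 * (C₂ * axisWeight w ^ (k + 2 + 3 * m)) := by
              gcongr
              · linarith [(Nat.cast_nonneg k : (0 : ℝ) ≤ k)]
              · exact h₂ w hw x
          _ = ((k : ℝ) + 1) * C₂ * axisWeight w ^ (k + 2 + 3 * m + 2) := by ring
          _ ≤ _ := mul_le_mul_of_nonneg_left (hmono _ _ (by lia)) (by positivity)
      calc _ ≤ _ := (norm_add_le _ _).trans (add_le_add t0 ((norm_add_le _ _).trans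
            (add_le_add t1 t2)))
        _ = _ := by ring

/-! ### Fourier series on the projective line -/

/-- The Cayley transform `e(x) = (1 + ix) / (1 - ix)`, which is `exp(iθ)` for `x = tan (θ / 2)`. -/
def circleChar (x : ℝ) : ℂ := (1 + x * Complex.I) / (1 - x * Complex.I)

/-- The `n`-th Fourier coefficient of `θ ↦ h (tan (θ / 2))` on `(-π, π)`. -/
def circleCoeff (h : ℝ → ℂ) (n : ℤ) : ℂ :=
  ((1 / (2 * Real.pi) : ℝ) : ℂ) * ∫ θ in (-Real.pi)..Real.pi,
    Complex.exp (-(n * θ * Complex.I)) * h (Real.tan (θ / 2))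

theorem cos_half_pos {θ : ℝ} (h : θ ∈ Set.Ioo (-Real.pi) Real.pi) : 0 < Real.cos (θ / 2) :=
  Real.cos_pos_of_mem_Ioo ⟨by linarith [h.1], by linarith [h.2]⟩

theorem circleChar_tan {θ : ℝ} (h : Real.cos (θ / 2) ≠ 0) :
    circleChar (Real.tan (θ / 2)) = Complex.exp (θ * Complex.I) := by
  have h' : (Complex.cos ((θ / 2 : ℝ) : ℂ)) ≠ 0 := by rw [← Complex.ofReal_cos]; exact_mod_cast h
  have e1 : Complex.exp (((θ / 2 : ℝ) : ℂ) * Complex.I) =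
      Complex.cos ((θ / 2 : ℝ) : ℂ) + Complex.sin ((θ / 2 : ℝ) : ℂ) * Complex.I := Complex.exp_mul_I _
  have e2 : Complex.exp (-(((θ / 2 : ℝ) : ℂ)) * Complex.I) =
      Complex.cos ((θ / 2 : ℝ) : ℂ) - Complex.sin ((θ / 2 : ℝ) : ℂ) * Complex.I := by
    rw [Complex.exp_mul_I, Complex.cos_neg, Complex.sin_neg]; ring
  have e3 : Complex.exp (θ * Complex.I) =
      Complex.exp (((θ / 2 : ℝ) : ℂ) * Complex.I) / Complex.exp (-(((θ / 2 : ℝ) : ℂ)) * Complex.I) := by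
    rw [← Complex.exp_sub]; congr 1; push_cast; ring
  have hne := Complex.exp_ne_zero (-(((θ / 2 : ℝ) : ℂ)) * Complex.I)
  rw [e3]
  unfold circleChar
  rw [Complex.ofReal_tan, Complex.tan_eq_sin_div_cos, e1]
  rw [e2] at hne ⊢
  have hne2 : 1 - Complex.sin ((θ / 2 : ℝ) : ℂ) / Complex.cos ((θ / 2 : ℝ) : ℂ) * Complex.I ≠ 0 := by
    intro h0
    apply hne
    field_simp at h0
    linear_combination h0
  rw [div_eq_div_iff hne2 hne]
  field_simp

theorem tan_half_two_arctan (x : ℝ) : Real.tan (2 * Real.arctan x / 2) = x := by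
  rw [mul_div_cancel_left₀ _ two_ne_zero, Real.tan_arctan]

theorem two_arctan_mem (x : ℝ) : 2 * Real.arctan x ∈ Set.Ioo (-Real.pi) Real.pi :=
  ⟨by linarith [Real.neg_pi_div_two_lt_arctan x], by linarith [Real.arctan_lt_pi_div_two x]⟩

theorem circleChar_eq_exp (x : ℝ) :
    circleChar x = Complex.exp ((2 * Real.arctan x : ℝ) * Complex.I) := by
  rw [← circleChar_tan (cos_half_pos (two_arctan_mem x)).ne', tan_half_two_arctan]

theorem norm_circleChar (x : ℝ) : ‖circleChar x‖ = 1 := by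
  rw [circleChar_eq_exp, Complex.norm_exp_ofReal_mul_I]

theorem circleChar_ne_zero (x : ℝ) : circleChar x ≠ 0 := by
  rw [← norm_pos_iff, norm_circleChar]; exact one_pos

theorem norm_circleChar_zpow (x : ℝ) (n : ℤ) : ‖circleChar x ^ n‖ = 1 := by
  rw [norm_zpow, norm_circleChar, one_zpow]

/-- The function `θ ↦ h (tan (θ / 2))`, extended by `c` outside `(-π, π)`. -/
def circleLift (h : ℝ → ℂ) (c : ℂ) (θ : ℝ) : ℂ :=
  if θ ∈ Set.Ioo (-Real.pi) Real.pi then h (Real.tan (θ / 2)) else c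

theorem circleLift_of_mem {h : ℝ → ℂ} {c : ℂ} {θ : ℝ} (hθ : θ ∈ Set.Ioo (-Real.pi) Real.pi) :
    circleLift h c θ = h (Real.tan (θ / 2)) := if_pos hθ

theorem continuousOn_circleLift {h : ℝ → ℂ} {c : ℂ} (hc : Continuous h)
    (hl : Tendsto h (cocompact ℝ) (𝓝 c)) :
    ContinuousOn (circleLift h c) (Set.Icc (-Real.pi) Real.pi) := by
  have hpi := Real.pi_pos
  intro θ hθ
  by_cases hi : θ ∈ Set.Ioo (-Real.pi) Real.pi
  · apply ContinuousAt.continuousWithinAt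
    have h1 : ContinuousAt (fun θ => h (Real.tan (θ / 2))) θ := by
      apply hc.continuousAt.comp
      exact (Real.continuousAt_tan.mpr (cos_half_pos hi).ne').comp
        (f := fun θ : ℝ => θ / 2) (continuousAt_id.div_const 2)
    refine h1.congr ?_
    filter_upwards [isOpen_Ioo.mem_nhds hi] with t ht
    exact (circleLift_of_mem ht).symm
  · have hval : circleLift h c θ = c := if_neg hi
    have hend : θ = -Real.pi ∨ θ = Real.pi := by
      rcases hθ.1.eq_or_lt with h1 | h1
      · exact Or.inl h1.symm
      · rcases hθ.2.eq_or_lt with h2 | h2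
        · exact Or.inr h2
        · exact absurd ⟨h1, h2⟩ hi
    have key : Tendsto (circleLift h c) (𝓝[Set.Ioo (-Real.pi) Real.pi] θ) (𝓝 c) := by
      have h1 : Tendsto (fun θ : ℝ => Real.tan (θ / 2)) (𝓝[Set.Ioo (-Real.pi) Real.pi] θ)
          (cocompact ℝ) := by
        rw [cocompact_eq_atBot_atTop]
        rcases hend with rfl | rfl
        · refine (Tendsto.comp Real.tendsto_tan_neg_pi_div_two ?_).mono_right le_sup_left
          refine tendsto_nhdsWithin_iff.mpr ⟨?_, ?_⟩
          · have : Tendsto (fun θ : ℝ => θ / 2) (𝓝 (-Real.pi)) (𝓝 (-(Real.pi / 2))) := by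
              rw [← neg_div]; exact (continuous_id.div_const 2).tendsto _
            exact this.mono_left nhdsWithin_le_nhds
          · filter_upwards [self_mem_nhdsWithin] with t ht
            have := ht.1
            simp only [Set.mem_Ioi]; linarith
        · refine (Tendsto.comp Real.tendsto_tan_pi_div_two ?_).mono_right le_sup_right
          refine tendsto_nhdsWithin_iff.mpr ⟨?_, ?_⟩
          · have : Tendsto (fun θ : ℝ => θ / 2) (𝓝 (Real.pi)) (𝓝 (Real.pi / 2)) :=
              (continuous_id.div_const 2).tendsto _
            exact this.mono_left nhdsWithin_le_nhds
          · filter_upwards [self_mem_nhdsWithin] with t ht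
            have := ht.2
            simp only [Set.mem_Iio]; linarith
      refine (hl.comp h1).congr' ?_
      filter_upwards [self_mem_nhdsWithin] with t ht
      exact (circleLift_of_mem ht).symm
    unfold ContinuousWithinAt
    rw [hval]
    rw [tendsto_nhds]
    intro s hs hcs
    have h2 := key.eventually (hs.mem_nhds hcs)
    rw [eventually_nhdsWithin_iff] at h2
    rw [mem_nhdsWithin_iff_eventually]
    filter_upwards [h2] with t ht htI
    by_cases hti : t ∈ Set.Ioo (-Real.pi) Real.pi
    · exact ht hti
    · have : circleLift h c t = c := if_neg hti
      simpa [this] using hcs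

theorem hasDerivAt_circleLift {h : ℝ → ℂ} (c : ℂ) (hh : Differentiable ℝ h) {θ : ℝ}
    (hθ : θ ∈ Set.Ioo (-Real.pi) Real.pi) :
    HasDerivAt (circleLift h c) (circleDeriv h (Real.tan (θ / 2))) θ := by
  have hcos := (cos_half_pos hθ).ne'
  have h1 : HasDerivAt (fun θ : ℝ => Real.tan (θ / 2)) ((1 + Real.tan (θ / 2) ^ 2) / 2) θ := by
    have h2 := (Real.hasDerivAt_tan hcos).comp θ ((hasDerivAt_id θ).div_const 2)
    convert! h2 using 1
    rw [Real.tan_eq_sin_div_cos]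
    have := Real.sin_sq_add_cos_sq (θ / 2)
    field_simp
    linarith
  have h3 : HasDerivAt (fun θ => h (Real.tan (θ / 2))) (circleDeriv h (Real.tan (θ / 2))) θ := by
    have := (hh (Real.tan (θ / 2))).hasDerivAt.scomp θ h1
    convert! this using 1
  refine h3.congr_of_eventuallyEq ?_
  filter_upwards [isOpen_Ioo.mem_nhds hθ] with t ht
  exact circleLift_of_mem ht

theorem intervalIntegral_congr_Ioo {f g : ℝ → ℂ}
    (h : ∀ θ ∈ Set.Ioo (-Real.pi) Real.pi, f θ = g θ) :
    ∫ θ in (-Real.pi)..Real.pi, f θ = ∫ θ in (-Real.pi)..Real.pi, g θ := by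
  have hpi := Real.pi_pos
  rw [intervalIntegral.integral_of_le (by linarith), intervalIntegral.integral_of_le (by linarith),
    integral_Ioc_eq_integral_Ioo, integral_Ioc_eq_integral_Ioo]
  exact setIntegral_congr_fun measurableSet_Ioo h

theorem circleCoeff_eq_fourierCoeffOn (h : ℝ → ℂ) (n : ℤ) (u : ℝ → ℂ)
    (hu : ∀ θ ∈ Set.Ioo (-Real.pi) Real.pi, u θ = h (Real.tan (θ / 2)))
    (hab : -Real.pi < Real.pi) : circleCoeff h n = fourierCoeffOn hab u n := by
  rw [fourierCoeffOn_eq_integral]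
  unfold circleCoeff
  rw [Complex.real_smul, show Real.pi - -Real.pi = 2 * Real.pi by ring]
  congr 1
  refine intervalIntegral_congr_Ioo fun θ hθ => ?_
  rw [hu θ hθ, smul_eq_mul, fourier_coe_apply]
  congr 2
  have : (Real.pi : ℂ) ≠ 0 := by exact_mod_cast Real.pi_ne_zero
  push_cast
  field_simp

/-- Integration by parts on the circle. -/
theorem circleCoeff_circleDeriv {h : ℝ → ℂ} (hh : IsCircleDiff 1 h) {n : ℤ} (hn : n ≠ 0) :
    circleCoeff (circleDeriv h) n = Complex.I * n * circleCoeff h n := by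
  have hpi := Real.pi_pos
  have hab : -Real.pi < Real.pi := by linarith
  obtain ⟨h0, ⟨c, hc⟩, h1⟩ := IsCircleDiff.succ_iff.mp hh
  obtain ⟨_, c', hc'⟩ := IsCircleDiff.zero_iff.mp h1
  have hu := continuousOn_circleLift h0.continuous hc
  have hu' := continuousOn_circleLift h1.contDiff.continuous hc'
  have key := fourierCoeffOn_of_hasDerivAt_Ioo hab (f := circleLift h c)
    (f' := circleLift (circleDeriv h) c') hn (by rwa [Set.uIcc_of_le hab.le]) (fun θ hθ => ?_)
    (ContinuousOn.intervalIntegrable (by rwa [Set.uIcc_of_le hab.le]))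
  · rw [← circleCoeff_eq_fourierCoeffOn h n _ (fun θ hθ => circleLift_of_mem hθ),
      ← circleCoeff_eq_fourierCoeffOn (circleDeriv h) n _ (fun θ hθ => circleLift_of_mem hθ)] at key
    have e1 : circleLift h c Real.pi = c := if_neg (by simp)
    have e2 : circleLift h c (-Real.pi) = c := if_neg (by simp)
    rw [e1, e2, sub_self, mul_zero] at key
    rw [key]
    have : (Real.pi : ℂ) ≠ 0 := by exact_mod_cast Real.pi_ne_zero
    have hn' : (n : ℂ) ≠ 0 := by exact_mod_cast hn
    have hI := Complex.I_ne_zero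
    push_cast
    field_simp
    ring
  · rw [min_eq_left hab.le, max_eq_right hab.le] at hθ
    rw [circleLift_of_mem hθ]
    exact hasDerivAt_circleLift c (h0.differentiable (by simp)) hθ

theorem norm_circleCoeff_le {h : ℝ → ℂ} {C : ℝ} (hC : ∀ x, ‖h x‖ ≤ C) (n : ℤ) :
    ‖circleCoeff h n‖ ≤ C := by
  have hpi := Real.pi_pos
  unfold circleCoeff
  have h1 := intervalIntegral.norm_integral_le_of_norm_le_const (a := -Real.pi) (b := Real.pi)
    (f := fun θ => Complex.exp (-(n * θ * Complex.I)) * h (Real.tan (θ / 2))) (C := C) (fun θ _ => by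
      have : ‖Complex.exp (-(n * θ * Complex.I))‖ = 1 := by
        rw [show -((n : ℂ) * θ * Complex.I) = ((-(n * θ) : ℝ) : ℂ) * Complex.I by push_cast; ring]
        exact Complex.norm_exp_ofReal_mul_I _
      rw [norm_mul, this, one_mul]; exact hC _)
  rw [norm_mul, Complex.norm_real, Real.norm_of_nonneg (by positivity)]
  rw [abs_of_pos (by linarith)] at h1
  calc 1 / (2 * Real.pi) * _ ≤ 1 / (2 * Real.pi) * (C * (Real.pi - -Real.pi)) := by gcongr
    _ = C := by field_simp; ring

theorem norm_circleCoeff_mul_pow_le {m : ℕ} {h : ℝ → ℂ} (hh : IsCircleDiff m h) {C : ℝ}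
    (h0 : ∀ x, ‖h x‖ ≤ C) (hm : ∀ x, ‖circleDeriv^[m] h x‖ ≤ C) (n : ℤ) :
    ‖circleCoeff h n‖ * (1 + |(n : ℝ)|) ^ m ≤ 2 ^ m * C := by
  have hC : 0 ≤ C := (norm_nonneg _).trans (h0 0)
  by_cases hn : n = 0
  · subst hn
    simp only [Int.cast_zero, abs_zero, add_zero, one_pow, mul_one]
    exact (norm_circleCoeff_le h0 0).trans (le_mul_of_one_le_left hC (one_le_pow₀ one_le_two))
  · have key : ∀ j ≤ m, circleCoeff (circleDeriv^[j] h) n = (Complex.I * n) ^ j * circleCoeff h n := by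
      intro j
      induction j with
      | zero => intro _; simp
      | succ j ih =>
        intro hj
        have hd : IsCircleDiff 1 (circleDeriv^[j] h) := by
          refine ⟨contDiff_circleDeriv_iterate hh.1 j, fun i hi => ?_⟩
          rw [← Function.iterate_add_apply]
          exact hh.2 (i + j) (by lia)
        rw [Function.iterate_succ_apply', circleCoeff_circleDeriv hd hn, ih (by lia), pow_succ]
        ring
    have h1 := norm_circleCoeff_le hm n
    rw [key m le_rfl, norm_mul, norm_pow, norm_mul, Complex.norm_I, one_mul, Complex.norm_intCast]
      at h1
    have hn1 : 1 ≤ |(n : ℝ)| := by exact_mod_cast Int.one_le_abs hn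
    calc ‖circleCoeff h n‖ * (1 + |(n : ℝ)|) ^ m
        ≤ ‖circleCoeff h n‖ * (2 * |(n : ℝ)|) ^ m := by gcongr; linarith
      _ = 2 ^ m * (|(n : ℝ)| ^ m * ‖circleCoeff h n‖) := by rw [mul_pow]; ring
      _ ≤ _ := by gcongr

theorem summable_inv_one_add_abs_sq : Summable fun n : ℤ => (((1 : ℝ) + |(n : ℝ)|) ^ 2)⁻¹ := by
  apply Summable.of_nat_of_neg_add_one
  · have := (summable_nat_add_iff 1).mpr (Real.summable_nat_pow_inv.mpr one_lt_two)
    refine this.congr fun n => ?_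
    push_cast
    rw [Nat.abs_cast, add_comm]
  · have := (summable_nat_add_iff 2).mpr (Real.summable_nat_pow_inv.mpr one_lt_two)
    refine this.congr fun n => ?_
    push_cast
    rw [← abs_neg, abs_of_nonneg (by linarith [(Nat.cast_nonneg n : (0 : ℝ) ≤ n)])]
    congr 2; ring

theorem summable_norm_circleCoeff_mul_pow {m : ℕ} {h : ℝ → ℂ} (hh : IsCircleDiff (m + 2) h) :
    Summable fun n : ℤ => ‖circleCoeff h n‖ * (1 + |(n : ℝ)|) ^ m := by
  obtain ⟨C₁, _, h₁⟩ := exists_bound_of_tendsto_cocompact hh.1.continuous (hh.2 0 (Nat.zero_le _))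
  obtain ⟨C₂, _, h₂⟩ := exists_bound_of_tendsto_cocompact
    (contDiff_circleDeriv_iterate hh.1 (m + 2)).continuous (hh.2 (m + 2) le_rfl)
  refine Summable.of_nonneg_of_le (fun n => by positivity) (fun n => ?_)
    (summable_inv_one_add_abs_sq.mul_left (2 ^ (m + 2) * max C₁ C₂))
  rw [← div_eq_mul_inv, le_div_iff₀ (by positivity), mul_assoc, ← pow_add]
  exact norm_circleCoeff_mul_pow_le hh (fun x => (h₁ x).trans (le_max_left _ _))
    (fun x => (h₂ x).trans (le_max_right _ _)) n

theorem circleChar_zpow_eq_fourier (x : ℝ) (n : ℤ) :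
    circleChar x ^ n = fourier n ((2 * Real.arctan x : ℝ) : AddCircle (2 * Real.pi)) := by
  rw [fourier_coe_apply, circleChar_eq_exp, ← Complex.exp_int_mul]
  congr 1
  have : (Real.pi : ℂ) ≠ 0 := by exact_mod_cast Real.pi_ne_zero
  push_cast
  field_simp

theorem hasSum_circleCoeff {h : ℝ → ℂ} (hh : IsCircleDiff 2 h) (x : ℝ) :
    HasSum (fun n : ℤ => circleCoeff h n * circleChar x ^ n) (h x) := by
  have hpi := Real.pi_pos
  have : Fact (0 < 2 * Real.pi) := ⟨by positivity⟩
  have hend : -Real.pi + 2 * Real.pi = Real.pi := by ring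
  obtain ⟨c, hc⟩ := hh.2 0 (Nat.zero_le _)
  have hu := continuousOn_circleLift hh.1.continuous hc
  have e1 : circleLift h c Real.pi = c := if_neg (by simp)
  have e2 : circleLift h c (-Real.pi) = c := if_neg (by simp)
  let F : C(AddCircle (2 * Real.pi), ℂ) := ⟨AddCircle.liftIco (2 * Real.pi) (-Real.pi) (circleLift h c),
    AddCircle.liftIco_continuous (by rw [hend, e1, e2]) (by rwa [hend])⟩
  have hF : ∀ θ ∈ Set.Ioo (-Real.pi) Real.pi, F (θ : AddCircle (2 * Real.pi)) = h (Real.tan (θ / 2)) := by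
    intro θ hθ
    have : F (θ : AddCircle (2 * Real.pi)) = circleLift h c θ := by
      change AddCircle.liftIco (2 * Real.pi) (-Real.pi) (circleLift h c) θ = _
      exact AddCircle.liftIco_coe_apply ⟨hθ.1.le, by rw [hend]; exact hθ.2⟩
    rw [this, circleLift_of_mem hθ]
  have hcoeff : ∀ n, fourierCoeff F n = circleCoeff h n := by
    intro n
    rw [fourierCoeff_eq_intervalIntegral _ _ (-Real.pi), hend, Complex.real_smul]
    unfold circleCoeff
    congr 1
    refine intervalIntegral_congr_Ioo fun θ hθ => ?_
    rw [smul_eq_mul, hF θ hθ, fourier_coe_apply]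
    congr 2
    have : (Real.pi : ℂ) ≠ 0 := by exact_mod_cast Real.pi_ne_zero
    push_cast
    field_simp
  have hsum : Summable (fourierCoeff F) := by
    rw [funext hcoeff]
    have := summable_norm_circleCoeff_mul_pow (m := 0) hh
    exact Summable.of_norm (by simpa using this)
  have := has_pointwise_sum_fourier_series_of_summable hsum
    ((2 * Real.arctan x : ℝ) : AddCircle (2 * Real.pi))
  rw [hF _ (two_arctan_mem x), tan_half_two_arctan] at this
  simpa only [hcoeff, smul_eq_mul, circleChar_zpow_eq_fourier] using this

/-- An absolutely convergent expansion in powers of `e(x)` is the Fourier expansion. -/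
theorem circleCoeff_eq_of_hasSum {h : ℝ → ℂ} {c : ℤ → ℂ} (hc : Summable fun n => ‖c n‖)
    (hs : ∀ x, HasSum (fun n : ℤ => c n * circleChar x ^ n) (h x)) (n : ℤ) :
    circleCoeff h n = c n := by
  have hpi := Real.pi_pos
  have hnorm : ∀ t : ℝ, ‖Complex.exp (t * Complex.I)‖ = 1 := Complex.norm_exp_ofReal_mul_I
  have h1 : HasSum (fun m : ℤ => ∫ θ in (-Real.pi)..Real.pi,
      Complex.exp (-(n * θ * Complex.I)) * (c m * Complex.exp (m * θ * Complex.I)))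
      (∫ θ in (-Real.pi)..Real.pi, Complex.exp (-(n * θ * Complex.I)) * h (Real.tan (θ / 2))) := by
    refine intervalIntegral.hasSum_integral_of_dominated_convergence (fun m _ => ‖c m‖) ?_ ?_ ?_ ?_ ?_
    · intro m
      exact (by fun_prop : Continuous _).aestronglyMeasurable
    · intro m
      refine Eventually.of_forall fun θ _ => ?_
      rw [norm_mul, norm_mul]
      have e1 := hnorm (-(n * θ))
      have e2 := hnorm (m * θ)
      push_cast at e1 e2
      rw [← neg_mul, e1, e2]; simp
    · exact Eventually.of_forall fun _ _ => hc
    · exact intervalIntegrable_const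
    · have hne : ∀ᵐ θ : ℝ, θ ≠ Real.pi := by
        rw [ae_iff]; simp
      filter_upwards [hne] with θ hθ hθ'
      rw [Set.uIoc_of_le (by linarith)] at hθ'
      have hmem : θ ∈ Set.Ioo (-Real.pi) Real.pi := ⟨hθ'.1, lt_of_le_of_ne hθ'.2 hθ⟩
      have := (hs (Real.tan (θ / 2))).mul_left (Complex.exp (-(n * θ * Complex.I)))
      rw [circleChar_tan (cos_half_pos hmem).ne'] at this
      convert! this using 3 with m
      rw [← Complex.exp_int_mul, mul_assoc]
  have h2 : ∀ m : ℤ, m ≠ n → ∫ θ in (-Real.pi)..Real.pi,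
      Complex.exp (-(n * θ * Complex.I)) * (c m * Complex.exp (m * θ * Complex.I)) = 0 := by
    intro m hm
    have hmn : ((m : ℂ) - n) * Complex.I ≠ 0 :=
      mul_ne_zero (by exact_mod_cast sub_ne_zero.mpr hm) Complex.I_ne_zero
    have e : ∀ θ : ℝ, Complex.exp (-(n * θ * Complex.I)) * (c m * Complex.exp (m * θ * Complex.I)) =
        c m * Complex.exp (((m : ℂ) - n) * Complex.I * θ) := by
      intro θ
      rw [mul_left_comm, ← Complex.exp_add]; congr 2; ring
    simp_rw [e]
    rw [intervalIntegral.integral_const_mul, integral_exp_mul_complex hmn]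
    have : Complex.exp (((m : ℂ) - n) * Complex.I * Real.pi) =
        Complex.exp (((m : ℂ) - n) * Complex.I * (-Real.pi : ℝ)) := by
      rw [Complex.exp_eq_exp_iff_exists_int]
      refine ⟨m - n, ?_⟩
      push_cast; ring
    rw [this]; simp
  have h3 := h1.unique (hasSum_single n h2)
  unfold circleCoeff
  rw [h3]
  have e : ∀ θ : ℝ, Complex.exp (-(n * θ * Complex.I)) * (c n * Complex.exp (n * θ * Complex.I)) =
        c n := by
    intro θ
    rw [mul_left_comm, ← Complex.exp_add]; simp
  simp_rw [e]
  rw [intervalIntegral.integral_const, Complex.real_smul]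
  have : (Real.pi : ℂ) ≠ 0 := by exact_mod_cast Real.pi_ne_zero
  push_cast
  field_simp
  ring

theorem measurable_circleCoeff {S : Type*} [MeasurableSpace S] {h : S → ℝ → ℂ}
    (hm : Measurable (Function.uncurry h)) (n : ℤ) : Measurable fun s => circleCoeff (h s) n := by
  have hpi := Real.pi_pos
  have h1 : Measurable (Function.uncurry fun (s : S) (θ : ℝ) =>
      Complex.exp (-(n * θ * Complex.I)) * h s (Real.tan (θ / 2))) := by
    have e1 : Measurable fun p : S × ℝ => Complex.exp (-(n * (p.2 : ℂ) * Complex.I)) := by fun_prop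
    have e2 : Measurable fun p : S × ℝ => h p.1 (Real.tan (p.2 / 2)) := by
      have ht : Measurable Real.tan := by
        have : Real.tan = fun x => Real.sin x / Real.cos x := funext Real.tan_eq_sin_div_cos
        rw [this]; fun_prop
      exact hm.comp (measurable_fst.prodMk (ht.comp (measurable_snd.div_const 2)))
    exact e1.mul e2
  have h2 : StronglyMeasurable fun s => ∫ θ in Set.Ioc (-Real.pi) Real.pi,
      Complex.exp (-(n * θ * Complex.I)) * h s (Real.tan (θ / 2)) :=
    h1.stronglyMeasurable.integral_prod_right
  unfold circleCoeff
  simp_rw [intervalIntegral.integral_of_le (show -Real.pi ≤ Real.pi by linarith)]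
  exact h2.measurable.const_mul _

/-! ### The functional calculus of an operator with polynomially bounded powers -/

section CircleCalculus

variable {A : Type*} [NormedRing A] [NormedAlgebra ℂ A]

/-- The functional calculus `h ↦ ∑ ĥ(n) Uⁿ`, where `ĥ(n)` are the Fourier coefficients of `h` as a
function on the circle. -/
def circleCalc (U : Aˣ) (h : ℝ → ℂ) : A := ∑' n : ℤ, circleCoeff h n • ((U ^ n : Aˣ) : A)

/-- The powers of `U` are of polynomial growth of order `M`. -/
def HasPolyGrowth (U : Aˣ) (C : ℝ) (M : ℕ) : Prop :=
  0 ≤ C ∧ ∀ n : ℤ, ‖((U ^ n : Aˣ) : A)‖ ≤ C * (1 + |(n : ℝ)|) ^ M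

variable {U : Aˣ} {C : ℝ} {M : ℕ}

theorem HasPolyGrowth.summable_norm (hU : HasPolyGrowth U C M) {c : ℤ → ℂ}
    (hc : Summable fun n : ℤ => ‖c n‖ * (1 + |(n : ℝ)|) ^ M) :
    Summable fun n : ℤ => ‖c n • ((U ^ n : Aˣ) : A)‖ := by
  refine Summable.of_nonneg_of_le (fun n => norm_nonneg _) (fun n => ?_) (hc.mul_left C)
  rw [norm_smul]
  calc ‖c n‖ * ‖((U ^ n : Aˣ) : A)‖ ≤ ‖c n‖ * (C * (1 + |(n : ℝ)|) ^ M) := by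
        gcongr; exact hU.2 n
    _ = _ := by ring

theorem IsCircleSmooth.summable_norm_smul {h : ℝ → ℂ} (hh : IsCircleSmooth h)
    (hU : HasPolyGrowth U C M) :
    Summable fun n : ℤ => ‖circleCoeff h n • ((U ^ n : Aˣ) : A)‖ :=
  hU.summable_norm (summable_norm_circleCoeff_mul_pow (hh (M + 2)))

theorem IsCircleSmooth.summable_norm_coeff {h : ℝ → ℂ} (hh : IsCircleSmooth h) :
    Summable fun n : ℤ => ‖circleCoeff h n‖ := by
  simpa using summable_norm_circleCoeff_mul_pow (m := 0) (hh 2)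

theorem IsCircleSmooth.summable_norm_term {h : ℝ → ℂ} (hh : IsCircleSmooth h) (x : ℝ) :
    Summable fun n : ℤ => ‖circleCoeff h n * circleChar x ^ n‖ := by
  simpa only [norm_mul, norm_circleChar_zpow, mul_one] using hh.summable_norm_coeff

theorem circleCoeff_monomial (c : ℂ) (m n : ℤ) :
    circleCoeff (fun x => c * circleChar x ^ m) n = if n = m then c else 0 := by
  refine circleCoeff_eq_of_hasSum (c := fun n => if n = m then c else 0)
    (summable_of_ne_finset_zero (s := {m}) fun b hb => ?_) (fun x => ?_) n
  · have : b ≠ m := by simpa using hb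
    simp [this]
  · convert! hasSum_single (f := fun n : ℤ => (if n = m then c else 0) * circleChar x ^ n) m ?_ using 1
    · simp
    · intro b hb; simp [hb]

theorem circleCalc_monomial (c : ℂ) (m : ℤ) :
    circleCalc U (fun x => c * circleChar x ^ m) = c • ((U ^ m : Aˣ) : A) := by
  unfold circleCalc
  simp_rw [circleCoeff_monomial]
  rw [tsum_eq_single m (fun b hb => by simp [hb])]
  simp

theorem circleCalc_const (c : ℂ) : circleCalc U (fun _ => c) = c • (1 : A) := by
  simpa using circleCalc_monomial (U := U) c 0

theorem circleCoeff_add {h k : ℝ → ℂ} (hh : IsCircleSmooth h) (hk : IsCircleSmooth k) (n : ℤ) :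
    circleCoeff (h + k) n = circleCoeff h n + circleCoeff k n := by
  refine circleCoeff_eq_of_hasSum (c := fun n => circleCoeff h n + circleCoeff k n)
    (Summable.of_nonneg_of_le (fun n => norm_nonneg _) (fun n => norm_add_le _ _)
      (hh.summable_norm_coeff.add hk.summable_norm_coeff)) (fun x => ?_) n
  simp_rw [add_mul]
  exact (hasSum_circleCoeff (hh 2) x).add (hasSum_circleCoeff (hk 2) x)

theorem circleCoeff_const_smul (c : ℂ) (h : ℝ → ℂ) (n : ℤ) :
    circleCoeff (c • h) n = c * circleCoeff h n := by
  unfold circleCoeff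
  simp only [Pi.smul_apply, smul_eq_mul]
  simp_rw [mul_left_comm _ c]
  rw [intervalIntegral.integral_const_mul]; ring

theorem circleCalc_const_smul (c : ℂ) (h : ℝ → ℂ) : circleCalc U (c • h) = c • circleCalc U h := by
  unfold circleCalc
  simp_rw [circleCoeff_const_smul, mul_smul]
  rw [tsum_const_smul'']

variable [CompleteSpace A]

theorem IsCircleSmooth.hasSum_circleCalc {h : ℝ → ℂ} (hh : IsCircleSmooth h)
    (hU : HasPolyGrowth U C M) :
    HasSum (fun n : ℤ => circleCoeff h n • ((U ^ n : Aˣ) : A)) (circleCalc U h) :=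
  (hh.summable_norm_smul hU).of_norm.hasSum

theorem circleCalc_add (hU : HasPolyGrowth U C M) {h k : ℝ → ℂ} (hh : IsCircleSmooth h)
    (hk : IsCircleSmooth k) : circleCalc U (h + k) = circleCalc U h + circleCalc U k := by
  refine HasSum.tsum_eq ?_
  simp_rw [circleCoeff_add hh hk, add_smul]
  exact (hh.hasSum_circleCalc hU).add (hk.hasSum_circleCalc hU)

/-- The reindexing `(k, n) ↦ (n, k - n)` of `ℤ × ℤ` that groups a double series by total degree. -/
def convEquiv : ℤ × ℤ ≃ ℤ × ℤ where
  toFun p := (p.2, p.1 - p.2)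
  invFun p := (p.1 + p.2, p.1)
  left_inv p := by ext <;> simp
  right_inv p := by ext <;> simp

theorem hasSum_mul_group {E : Type*} [NormedRing E] [NormedAlgebra ℂ E] [CompleteSpace E] (V : Eˣ)
    {c d : ℤ → ℂ} {a b : E}
    (hc : Summable fun n => ‖c n • ((V ^ n : Eˣ) : E)‖) (hd : Summable fun n => ‖d n • ((V ^ n : Eˣ) : E)‖)
    (hc' : Summable fun n => ‖c n‖) (hd' : Summable fun n => ‖d n‖)
    (ha : HasSum (fun n => c n • ((V ^ n : Eˣ) : E)) a) (hb : HasSum (fun n => d n • ((V ^ n : Eˣ) : E)) b) :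
    HasSum (fun k : ℤ => (∑' n, c n * d (k - n)) • ((V ^ k : Eˣ) : E)) (a * b) := by
  have h0 := summable_mul_of_summable_norm (f := fun n => c n • ((V ^ n : Eˣ) : E))
    (g := fun n => d n • ((V ^ n : Eˣ) : E)) hc hd
  have h1 := HasSum.mul ha hb h0
  rw [← convEquiv.hasSum_iff] at h1
  have h2 : Summable fun p : ℤ × ℤ => c p.2 * d (p.1 - p.2) := by
    have := summable_mul_of_summable_norm hc' hd'
    rw [← convEquiv.summable_iff] at this
    exact this
  refine h1.prod_fiberwise fun k => ?_
  have h3 := (h2.prod_factor k).hasSum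
  have h4 := h3.smul_const ((V ^ k : Eˣ) : E)
  convert! h4 using 2 with n
  simp only [convEquiv, Equiv.coe_fn_mk, Function.comp_apply]
  rw [smul_mul_smul_comm, ← Units.val_mul, ← zpow_add]
  congr 3; ring

theorem circleCoeff_mul {h k : ℝ → ℂ} (hh : IsCircleSmooth h) (hk : IsCircleSmooth k) (m : ℤ) :
    circleCoeff (h * k) m = ∑' n, circleCoeff h n * circleCoeff k (m - n) := by
  refine circleCoeff_eq_of_hasSum (c := fun m => ∑' n, circleCoeff h n * circleCoeff k (m - n))
    ?_ (fun x => ?_) m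
  · have h1 : Summable fun p : ℤ × ℤ => ‖circleCoeff h p.2 * circleCoeff k (p.1 - p.2)‖ := by
      have := hh.summable_norm_coeff.mul_norm hk.summable_norm_coeff
      rw [← convEquiv.summable_iff] at this
      exact this
    exact Summable.of_nonneg_of_le (fun n => norm_nonneg _)
      (fun n => norm_tsum_le_tsum_norm (h1.prod_factor n)) h1.prod
  · have hz : ∀ n : ℤ, (((Units.mk0 (circleChar x) (circleChar_ne_zero x)) ^ n : ℂˣ) : ℂ) =
        circleChar x ^ n := by intro n; simp
    have := hasSum_mul_group (Units.mk0 (circleChar x) (circleChar_ne_zero x))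
      (c := circleCoeff h) (d := circleCoeff k) (a := h x) (b := k x)
      (by simpa only [hz, smul_eq_mul] using hh.summable_norm_term x)
      (by simpa only [hz, smul_eq_mul] using hk.summable_norm_term x)
      hh.summable_norm_coeff hk.summable_norm_coeff
      (by simpa only [hz, smul_eq_mul] using hasSum_circleCoeff (hh 2) x)
      (by simpa only [hz, smul_eq_mul] using hasSum_circleCoeff (hk 2) x)
    simp only [hz, smul_eq_mul] at this
    exact this

theorem circleCalc_mul (hU : HasPolyGrowth U C M) {h k : ℝ → ℂ} (hh : IsCircleSmooth h)
    (hk : IsCircleSmooth k) : circleCalc U (h * k) = circleCalc U h * circleCalc U k := by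
  refine HasSum.tsum_eq ?_
  simp_rw [circleCoeff_mul hh hk]
  exact hasSum_mul_group U (hh.summable_norm_smul hU) (hk.summable_norm_smul hU)
    hh.summable_norm_coeff hk.summable_norm_coeff (hh.hasSum_circleCalc hU) (hk.hasSum_circleCalc hU)

/-- The calculus commutes with absolutely convergent integrals of families of functions. -/
theorem circleCalc_integral (hU : HasPolyGrowth U C M) {S : Type*} [MeasurableSpace S]
    {μ : Measure S} {κ : S → ℂ} (hκ : AEStronglyMeasurable κ μ) {h : S → ℝ → ℂ}
    (hm : Measurable (Function.uncurry h)) {b : S → ℝ} (hb : Integrable b μ)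
    (hbound : ∀ᵐ s ∂μ, κ s = 0 ∨ (IsCircleSmooth (h s) ∧
      ∀ n : ℤ, ‖κ s‖ * (‖circleCoeff (h s) n‖ * (1 + |(n : ℝ)|) ^ (M + 2)) ≤ b s))
    {F : ℝ → ℂ} {c : ℂ} (hF : ∀ x, F x = c + ∫ s, κ s * h s x ∂μ) :
    Integrable (fun s => κ s • circleCalc U (h s)) μ ∧
      circleCalc U F = c • 1 + ∫ s, κ s • circleCalc U (h s) ∂μ := by
  have hmeas : ∀ n : ℤ, AEStronglyMeasurable (fun s => κ s * circleCoeff (h s) n) μ := fun n =>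
    hκ.mul (measurable_circleCoeff hm n).aestronglyMeasurable
  have hw : ∀ n : ℤ, 0 < 1 + |(n : ℝ)| := fun n => by positivity
  have hle : ∀ᵐ s ∂μ, ∀ n : ℤ,
      ‖κ s * circleCoeff (h s) n‖ ≤ |b s| * (((1 + |(n : ℝ)|) ^ M)⁻¹ * ((1 + |(n : ℝ)|) ^ 2)⁻¹) := by
    filter_upwards [hbound] with s hs n
    rcases hs with h0 | ⟨-, h1⟩
    · rw [h0]; simp; positivity
    · rw [← mul_inv, ← pow_add, ← div_eq_mul_inv, le_div_iff₀ (pow_pos (hw n) _), norm_mul, mul_assoc]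
      exact (h1 n).trans (le_abs_self _)
  have hint : ∀ n : ℤ, Integrable (fun s => κ s * circleCoeff (h s) n) μ := fun n =>
    (hb.abs.mul_const _).mono' (hmeas n) (hle.mono fun s hs => hs n)
  have hnint : ∀ n : ℤ, ∫ s, ‖κ s * circleCoeff (h s) n‖ ∂μ ≤
      (∫ s, |b s| ∂μ) * (((1 + |(n : ℝ)|) ^ M)⁻¹ * ((1 + |(n : ℝ)|) ^ 2)⁻¹) := by
    intro n
    rw [← integral_mul_const]
    exact integral_mono_ae (hint n).norm (hb.abs.mul_const _) (hle.mono fun s hs => hs n)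
  have hI0 : 0 ≤ ∫ s, |b s| ∂μ := integral_nonneg fun _ => abs_nonneg _
  have hsumw : Summable fun n : ℤ =>
      (∫ s, ‖κ s * circleCoeff (h s) n‖ ∂μ) * (1 + |(n : ℝ)|) ^ M := by
    refine Summable.of_nonneg_of_le
      (fun n => mul_nonneg (integral_nonneg fun _ => norm_nonneg _) (pow_pos (hw n) _).le)
      (fun n => ?_) (summable_inv_one_add_abs_sq.mul_left (∫ s, |b s| ∂μ))
    calc _ ≤ ((∫ s, |b s| ∂μ) * (((1 + |(n : ℝ)|) ^ M)⁻¹ * ((1 + |(n : ℝ)|) ^ 2)⁻¹)) *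
          (1 + |(n : ℝ)|) ^ M := by gcongr; exact hnint n
      _ = _ := by have := (hw n).ne'; field_simp
  have hsum1 : Summable fun n : ℤ => ∫ s, ‖κ s * circleCoeff (h s) n‖ ∂μ := by
    refine Summable.of_nonneg_of_le (fun n => integral_nonneg fun _ => norm_nonneg _) (fun n => ?_)
      hsumw
    exact le_mul_of_one_le_right (integral_nonneg fun _ => norm_nonneg _)
      (one_le_pow₀ (by linarith [abs_nonneg (n : ℝ)]))
  have hcoeff : ∀ n : ℤ, circleCoeff F n =
      (if n = 0 then c else 0) + ∫ s, κ s * circleCoeff (h s) n ∂μ := by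
    have hs0 : HasSum (fun n : ℤ => if n = 0 then c else 0) c := by
      simpa using hasSum_ite_eq (0 : ℤ) c
    refine circleCoeff_eq_of_hasSum ?_ fun x => ?_
    · refine Summable.of_nonneg_of_le (fun n => norm_nonneg _) (fun n => (norm_add_le _ _).trans
        (add_le_add le_rfl (norm_integral_le_integral_norm _))) (Summable.add ?_ hsum1)
      refine summable_of_ne_finset_zero (s := {0}) fun n hn => ?_
      have : n ≠ 0 := by simpa using hn
      simp [this]
    · simp_rw [add_mul]
      rw [hF x]
      refine HasSum.add ?_ ?_
      · convert! hs0 using 2 with n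
        split_ifs with hn
        · simp [hn]
        · simp
      · have h1 : HasSum (fun n : ℤ => ∫ s, κ s * circleCoeff (h s) n * circleChar x ^ n ∂μ)
            (∫ s, ∑' n : ℤ, κ s * circleCoeff (h s) n * circleChar x ^ n ∂μ) := by
          refine hasSum_integral_of_summable_integral_norm (fun n => (hint n).mul_const _) ?_
          simpa only [norm_mul, norm_circleChar_zpow, mul_one] using hsum1
        simp_rw [integral_mul_const] at h1
        convert! h1 using 1
        refine integral_congr_ae ?_
        filter_upwards [hbound] with s hs
        rcases hs with h0 | ⟨h1, -⟩
        · simp [h0]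
        · simp_rw [mul_assoc, tsum_mul_left]
          rw [(hasSum_circleCoeff (h1 2) x).tsum_eq]
  have hop : HasSum (fun n : ℤ => ∫ s, (κ s * circleCoeff (h s) n) • ((U ^ n : Aˣ) : A) ∂μ)
      (∫ s, ∑' n : ℤ, (κ s * circleCoeff (h s) n) • ((U ^ n : Aˣ) : A) ∂μ) := by
    refine hasSum_integral_of_summable_integral_norm (fun n => (hint n).smul_const _) ?_
    simp_rw [norm_smul, integral_mul_const]
    refine Summable.of_nonneg_of_le (fun n => mul_nonneg (integral_nonneg fun _ => norm_nonneg _)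
      (norm_nonneg _)) (fun n => ?_) (hsumw.mul_left C)
    calc _ ≤ (∫ s, ‖κ s * circleCoeff (h s) n‖ ∂μ) * (C * (1 + |(n : ℝ)|) ^ M) :=
          mul_le_mul_of_nonneg_left (hU.2 n) (integral_nonneg fun _ => norm_nonneg _)
      _ = _ := by simp only [norm_mul]; ring
  have hts : ∀ s, ∑' n : ℤ, (κ s * circleCoeff (h s) n) • ((U ^ n : Aˣ) : A) =
      κ s • circleCalc U (h s) := by
    intro s
    unfold circleCalc
    simp_rw [mul_smul]
    rw [tsum_const_smul'']
  simp_rw [hts] at hop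
  have hterm : ∀ᵐ s ∂μ, ∀ n : ℤ, ‖(κ s * circleCoeff (h s) n) • ((U ^ n : Aˣ) : A)‖ ≤
      |b s| * C * ((1 + |(n : ℝ)|) ^ 2)⁻¹ := by
    filter_upwards [hle] with s hs n
    rw [norm_smul]
    calc _ ≤ (|b s| * (((1 + |(n : ℝ)|) ^ M)⁻¹ * ((1 + |(n : ℝ)|) ^ 2)⁻¹)) *
          (C * (1 + |(n : ℝ)|) ^ M) := mul_le_mul (hs n) (hU.2 n) (norm_nonneg _) (by positivity)
      _ = _ := by have := (hw n).ne'; field_simp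
  have hsummable : ∀ᵐ s ∂μ, Summable fun n : ℤ =>
      ‖(κ s * circleCoeff (h s) n) • ((U ^ n : Aˣ) : A)‖ := by
    filter_upwards [hterm] with s hs
    exact Summable.of_nonneg_of_le (fun n => norm_nonneg _) hs
      (summable_inv_one_add_abs_sq.mul_left _)
  refine ⟨?_, ?_⟩
  · refine (hb.abs.mul_const (C * ∑' n : ℤ, ((1 + |(n : ℝ)|) ^ 2)⁻¹)).mono' ?_ ?_
    · refine aestronglyMeasurable_of_tendsto_ae (atTop : Filter (Finset ℤ))
        (f := fun t s => ∑ n ∈ t, (κ s * circleCoeff (h s) n) • ((U ^ n : Aˣ) : A)) (fun t => ?_) ?_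
      · exact Finset.aestronglyMeasurable_fun_sum t fun n _ => (hmeas n).smul_const _
      · filter_upwards [hsummable] with s hs
        rw [← hts s]
        exact hs.of_norm.hasSum
    · filter_upwards [hterm, hsummable] with s hs hs'
      rw [← hts s]
      refine (norm_tsum_le_tsum_norm hs').trans ?_
      refine (hs'.tsum_le_tsum hs (summable_inv_one_add_abs_sq.mul_left _)).trans_eq ?_
      rw [tsum_mul_left, mul_assoc]
  · refine HasSum.tsum_eq ?_
    simp_rw [hcoeff, add_smul]
    refine HasSum.add ?_ ?_
    · convert! hasSum_single (f := fun n : ℤ => (if n = 0 then c else 0) • ((U ^ n : Aˣ) : A)) 0 ?_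
        using 1
      · simp
      · intro n hn; simp [hn]
    · simpa only [integral_smul_const] using hop

/-- `ζ - Φ(f)` is invertible with inverse `Φ(1 / (ζ - f))` when `ζ` is at positive distance from the
range of `f`. -/
theorem circleCalc_inv_sub (hU : HasPolyGrowth U C M) {f : ℝ → ℂ} (hf : IsCircleSmooth f) {ζ : ℂ}
    {d : ℝ} (hd : 0 < d) (h : ∀ x, d ≤ ‖ζ - f x‖) :
    IsUnit (algebraMap ℂ A ζ - circleCalc U f) ∧
      resolvent (circleCalc U f) ζ = circleCalc U fun x => (ζ - f x)⁻¹ := by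
  have h0 : ∀ x, ζ - f x ≠ 0 := fun x => norm_pos_iff.mp (hd.trans_le (h x))
  have hs := hf.inv_sub hd h
  have hζ : IsCircleSmooth ((fun _ => ζ) + (-1 : ℂ) • f) := (IsCircleSmooth.const ζ).add (hf.const_smul _)
  have e1 : circleCalc U ((fun _ => ζ) + (-1 : ℂ) • f) = algebraMap ℂ A ζ - circleCalc U f := by
    rw [circleCalc_add hU (IsCircleSmooth.const ζ) (hf.const_smul _), circleCalc_const,
      circleCalc_const_smul, Algebra.algebraMap_eq_smul_one, neg_one_smul, sub_eq_add_neg]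
  have e2 : ((fun _ => ζ) + (-1 : ℂ) • f) * (fun x => (ζ - f x)⁻¹) = fun _ => 1 := by
    ext x
    simp only [Pi.mul_apply, neg_one_smul, ← sub_eq_add_neg]
    exact mul_inv_cancel₀ (h0 x)
  have m1 : (algebraMap ℂ A ζ - circleCalc U f) * circleCalc U (fun x => (ζ - f x)⁻¹) = 1 := by
    rw [← e1, ← circleCalc_mul hU hζ hs, e2, circleCalc_const, one_smul]
  have m2 : circleCalc U (fun x => (ζ - f x)⁻¹) * (algebraMap ℂ A ζ - circleCalc U f) = 1 := by
    rw [← e1, ← circleCalc_mul hU hs hζ, mul_comm, e2, circleCalc_const, one_smul]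
  let u : Aˣ := ⟨_, _, m1, m2⟩
  exact ⟨⟨u, rfl⟩, Ring.inverse_unit u⟩

end CircleCalculus

section Operator

variable {B : Type*} [NormedAddCommGroup B] [NormedSpace ℂ B] [CompleteSpace B]
  {P : B →ₗ.[ℂ] B}

theorem IsTemperate.exists_hasPolyGrowth (hP : IsTemperate P) :
    ∃ C M, HasPolyGrowth hP.cayley C M := by
  obtain ⟨C, M, hC, h⟩ := hP.exists_norm_cayley_zpow_le
  exact ⟨C, M, hC, h⟩

/-- The calculus of the Cayley transform of `P` maps `1 / (x - w)` to `(P - w)⁻¹`. -/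
theorem IsTemperate.circleCalc_inv_ofReal_sub (hP : IsTemperate P) {w : ℂ} (hw : w.im ≠ 0) :
    circleCalc hP.cayley (fun x : ℝ => ((x : ℂ) - w)⁻¹) = -opResolvent P w := by
  obtain ⟨C, M, hU⟩ := hP.exists_hasPolyGrowth
  have hi : (-Complex.I).im ≠ 0 := by simp
  have hρ := isCircleSmooth_inv_ofReal_sub hi
  have hr := isCircleSmooth_inv_ofReal_sub hw
  have hid := hP.resolvent_identity hi hw
  have e0 : circleCalc hP.cayley (fun x : ℝ => ((x : ℂ) - -Complex.I)⁻¹) =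
      -opResolvent P (-Complex.I) := by
    have e1 : ((fun _ => -1) + (2 * Complex.I) • fun x : ℝ => ((x : ℂ) - -Complex.I)⁻¹) =
        fun x : ℝ => 1 * circleChar x ^ (1 : ℤ) := by
      ext x
      have h0 := ofReal_sub_ne_zero hi x
      have h1 : 1 - (x : ℂ) * Complex.I ≠ 0 := by
        have : 1 - (x : ℂ) * Complex.I = -Complex.I * (x - -Complex.I) := by
          linear_combination Complex.I_sq
        rw [this]; exact mul_ne_zero (by simp) h0
      simp only [Pi.add_apply, Pi.smul_apply, smul_eq_mul, zpow_one, one_mul, circleChar]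
      rw [eq_div_iff h1]
      field_simp
      ring_nf
      simp only [Complex.I_sq]
      ring
    have e2 := congrArg (circleCalc hP.cayley) e1
    rw [circleCalc_add hU (IsCircleSmooth.const _) (hρ.const_smul _), circleCalc_const,
      circleCalc_const_smul, circleCalc_monomial, one_smul, zpow_one] at e2
    have e3 : ((hP.cayley : (B →L[ℂ] B)ˣ) : B →L[ℂ] B) =
        -1 - (2 * Complex.I) • opResolvent P (-Complex.I) := rfl
    rw [e3, neg_one_smul, sub_eq_add_neg, add_right_inj, ← smul_neg] at e2
    exact smul_right_injective _ (by simp : (2 * Complex.I) ≠ 0) e2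
  have e4 : (fun x : ℝ => ((x : ℂ) - w)⁻¹) = (fun x : ℝ => ((x : ℂ) - -Complex.I)⁻¹) +
      (w + Complex.I) • ((fun x : ℝ => ((x : ℂ) - w)⁻¹) * fun x : ℝ => ((x : ℂ) - -Complex.I)⁻¹) := by
    ext x
    have h0 := ofReal_sub_ne_zero hi x
    have h1 := ofReal_sub_ne_zero hw x
    simp only [Pi.add_apply, Pi.smul_apply, Pi.mul_apply, smul_eq_mul]
    field_simp
    ring
  have e5 := congrArg (circleCalc hP.cayley) e4
  rw [circleCalc_add hU hρ ((hr.mul hρ).const_smul _), circleCalc_const_smul,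
    circleCalc_mul hU hr hρ, e0] at e5
  generalize circleCalc hP.cayley (fun x : ℝ => ((x : ℂ) - w)⁻¹) = X at e5 ⊢
  generalize opResolvent P w = S at hid ⊢
  generalize opResolvent P (-Complex.I) = R at hid e5
  have hc : w - -Complex.I = w + Complex.I := by ring
  rw [hc, ← mul_smul_comm] at hid
  rw [mul_neg, smul_neg, ← mul_smul_comm, ← sub_eq_add_neg] at e5
  have e5' : X + X * ((w + Complex.I) • R) = -R := by rw [eq_sub_iff_add_eq] at e5; exact e5
  have hid' : (w + Complex.I) • R - (w + Complex.I) • S = ((w + Complex.I) • R) * ((w + Complex.I) • S) := by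
    rw [← smul_sub, hid, smul_mul_assoc]
  have hX : X = (X + X * ((w + Complex.I) • R)) * (1 - (w + Complex.I) • S) := by
    have : (X + X * ((w + Complex.I) • R)) * (1 - (w + Complex.I) • S) =
        X + X * (((w + Complex.I) • R - (w + Complex.I) • S) -
          ((w + Complex.I) • R) * ((w + Complex.I) • S)) := by
      generalize (w + Complex.I) • R = Y
      generalize (w + Complex.I) • S = Z
      noncomm_ring
    rw [this, hid', sub_self, mul_zero, add_zero]
  rw [hX, e5', mul_sub, mul_one, neg_mul, ← hid]; abel

end Operator

/-! ### The Cauchy–Pompeiu formula -/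

/-- The conjugate-linear coefficient `q` of a real-linear map `v ↦ p v + q v̄` of `ℂ`. -/
def antiPart (D : ℂ →L[ℝ] ℂ) : ℂ := (1 / 2) * (D 1 + Complex.I * D Complex.I)

/-- The complex-linear coefficient `p` of a real-linear map `v ↦ p v + q v̄` of `ℂ`. -/
def linPart (D : ℂ →L[ℝ] ℂ) : ℂ := (1 / 2) * (D 1 - Complex.I * D Complex.I)

theorem dbar_eq_antiPart (F : ℂ → ℂ) (z : ℂ) : dbar F z = antiPart (fderiv ℝ F z) := rfl

theorem apply_eq_linPart_add_antiPart (D : ℂ →L[ℝ] ℂ) (v : ℂ) :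
    D v = linPart D * v + antiPart D * (starRingEnd ℂ) v := by
  have h : D v = v.re * D 1 + v.im * D Complex.I := by
    conv_lhs => rw [show v = v.re • (1 : ℂ) + v.im • Complex.I by
      rw [Complex.real_smul, Complex.real_smul, mul_one, Complex.re_add_im]]
    rw [map_add, map_smul, map_smul, Complex.real_smul, Complex.real_smul]
  rw [h]
  unfold linPart antiPart
  conv_rhs => rw [← Complex.re_add_im v]
  simp only [map_add, map_mul, Complex.conj_ofReal, Complex.conj_I]
  linear_combination ((v.im : ℂ) * D Complex.I) * Complex.I_sq

theorem norm_antiPart_le (D : ℂ →L[ℝ] ℂ) : ‖antiPart D‖ ≤ ‖D‖ := by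
  have h1 : ‖D 1‖ ≤ ‖D‖ := by simpa using D.le_opNorm 1
  have h2 : ‖D Complex.I‖ ≤ ‖D‖ := by simpa using D.le_opNorm Complex.I
  unfold antiPart
  rw [norm_mul]
  have h3 := norm_add_le (D 1) (Complex.I * D Complex.I)
  rw [norm_mul, Complex.norm_I, one_mul] at h3
  have : ‖(1 / 2 : ℂ)‖ = 1 / 2 := by simp
  rw [this]; linarith

theorem exists_radius_of_hasCompactSupport {ψ : ℂ → ℂ} (h : HasCompactSupport ψ) :
    ∃ R : ℝ, 0 < R ∧ ∀ z, R ≤ ‖z‖ → ψ z = 0 := by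
  obtain ⟨R, hR⟩ := h.isCompact.isBounded.subset_ball 0
  refine ⟨max R 1, by positivity, fun z hz => image_eq_zero_of_notMem_tsupport fun hz' => ?_⟩
  have := hR hz'
  rw [mem_ball_zero_iff] at this
  linarith [le_max_left R 1]

theorem integral_Ioi_fderiv_ray {ψ : ℂ → ℂ} (hψ : ContDiff ℝ 1 ψ) (hs : HasCompactSupport ψ) (e : ℂ)
    (he : ‖e‖ = 1) : ∫ r in Set.Ioi (0 : ℝ), fderiv ℝ ψ (r * e) e = -ψ 0 := by
  have hd : ∀ r : ℝ, HasDerivAt (fun r : ℝ => ψ (r * e)) (fderiv ℝ ψ (r * e) e) r := by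
    intro r
    have h1 : HasDerivAt (fun r : ℝ => (r : ℂ) * e) e r := by
      simpa using (HasDerivAt.ofReal_comp (hasDerivAt_id r)).mul_const e
    exact ((hψ.differentiable one_ne_zero _).hasFDerivAt).comp_hasDerivAt r h1
  have hc : ContDiff ℝ 1 (fun r : ℝ => ψ (r * e)) :=
    hψ.comp (Complex.ofRealCLM.contDiff.mul contDiff_const)
  obtain ⟨R, hR0, hR⟩ := exists_radius_of_hasCompactSupport hs
  have hcs : HasCompactSupport (fun r : ℝ => ψ (r * e)) := by
    refine HasCompactSupport.intro (isCompact_Icc (a := -R) (b := R)) fun r hr => hR _ ?_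
    rw [norm_mul, he, mul_one, Complex.norm_real, Real.norm_eq_abs]
    by_contra hlt
    rw [not_le, abs_lt] at hlt
    exact hr ⟨hlt.1.le, hlt.2.le⟩
  have := hcs.integral_Ioi_deriv_eq hc 0
  simpa [(hd _).deriv] using this

theorem integral_Ioo_fderiv_circle {ψ : ℂ → ℂ} (hψ : ContDiff ℝ 1 ψ) {r : ℝ} (hr : r ≠ 0) :
    ∫ θ in Set.Ioo (-Real.pi) Real.pi, fderiv ℝ ψ (r * Complex.exp (θ * Complex.I))
      (Complex.I * Complex.exp (θ * Complex.I)) = 0 := by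
  have hpi := Real.pi_pos
  have he : ∀ θ : ℝ, HasDerivAt (fun θ : ℝ => (r : ℂ) * Complex.exp (θ * Complex.I))
      ((r : ℂ) * (Complex.I * Complex.exp (θ * Complex.I))) θ := by
    intro θ
    have h1 : HasDerivAt (fun θ : ℝ => (θ : ℂ) * Complex.I) Complex.I θ := by
      simpa using (HasDerivAt.ofReal_comp (hasDerivAt_id θ)).mul_const Complex.I
    have := (h1.cexp).const_mul (r : ℂ)
    convert! this using 1
    ring
  have hd : ∀ θ : ℝ, HasDerivAt (fun θ : ℝ => ψ (r * Complex.exp (θ * Complex.I)))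
      ((r : ℂ) * fderiv ℝ ψ (r * Complex.exp (θ * Complex.I))
        (Complex.I * Complex.exp (θ * Complex.I))) θ := by
    intro θ
    have := ((hψ.differentiable one_ne_zero _).hasFDerivAt).comp_hasDerivAt θ (he θ)
    convert! this using 1
    have hD : ∀ (D : ℂ →L[ℝ] ℂ) (v : ℂ), (r : ℂ) * D v = D (r * v) := fun D v => by
      rw [← Complex.real_smul, ← Complex.real_smul, map_smul]
    exact hD _ _
  have hcont : Continuous fun θ : ℝ => (r : ℂ) * fderiv ℝ ψ (r * Complex.exp (θ * Complex.I))
        (Complex.I * Complex.exp (θ * Complex.I)) := by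
    have := hψ.continuous_fderiv one_ne_zero
    fun_prop
  have key := intervalIntegral.integral_eq_sub_of_hasDerivAt (a := -Real.pi) (b := Real.pi)
    (fun θ _ => hd θ) (hcont.intervalIntegrable _ _)
  have e1 : Complex.exp ((-Real.pi : ℝ) * Complex.I) = Complex.exp ((Real.pi : ℝ) * Complex.I) := by
    rw [Complex.exp_eq_exp_iff_exists_int]
    exact ⟨-1, by push_cast; ring⟩
  rw [e1, sub_self, intervalIntegral.integral_const_mul, mul_eq_zero] at key
  rw [← integral_Ioc_eq_integral_Ioo, ← intervalIntegral.integral_of_le (by linarith)]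
  exact key.resolve_left (by exact_mod_cast hr)

/-- The Cauchy–Pompeiu formula for test functions, by integration in polar coordinates, where
`∂ψ/∂z̄ = (e^{iθ} / 2) (∂_r + (i / r) ∂_θ) ψ`. -/
theorem integral_dbar_mul_inv {ψ : ℂ → ℂ} (hψ : ContDiff ℝ 1 ψ) (hs : HasCompactSupport ψ) :
    ∫ z, dbar ψ z * z⁻¹ = -(Real.pi * ψ 0) := by
  have hpi := Real.pi_pos
  have hcd := hψ.continuous_fderiv one_ne_zero
  obtain ⟨R, hR0, hR⟩ := exists_radius_of_hasCompactSupport (hs.fderiv (𝕜 := ℝ) |>.norm.comp_left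
    (g := fun t : ℝ => (t : ℂ)) (by simp))
  have hR' : ∀ z, R ≤ ‖z‖ → fderiv ℝ ψ z = 0 := fun z hz => by
    simpa using hR z hz
  have hint : ∀ u : ℂ, IntegrableOn (fun p : ℝ × ℝ => fderiv ℝ ψ (p.1 * Complex.exp (p.2 * Complex.I))
      (u * Complex.exp (p.2 * Complex.I))) (Set.Ioi 0 ×ˢ Set.Ioo (-Real.pi) Real.pi) := by
    intro u
    have hc : Continuous (fun p : ℝ × ℝ => fderiv ℝ ψ (p.1 * Complex.exp (p.2 * Complex.I))
      (u * Complex.exp (p.2 * Complex.I))) := by fun_prop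
    refine IntegrableOn.of_forall_sdiff_eq_zero
      (hc.continuousOn.integrableOn_compact
        ((isCompact_Icc (a := (0 : ℝ)) (b := R)).prod (isCompact_Icc (a := -Real.pi) (b := Real.pi))))
      (measurableSet_Ioi.prod measurableSet_Ioo) ?_
    rintro ⟨r, θ⟩ ⟨⟨h1, h2⟩, h3⟩
    simp only [Set.mem_Ioi] at h1
    have h4 : R ≤ ‖(r : ℂ) * Complex.exp (θ * Complex.I)‖ := by
      rw [norm_mul, Complex.norm_exp_ofReal_mul_I, mul_one, Complex.norm_real,
        Real.norm_of_nonneg h1.le]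
      by_contra hlt
      exact h3 ⟨⟨h1.le, (not_le.mp hlt).le⟩, ⟨h2.1.le, h2.2.le⟩⟩
    simp only [hR' _ h4, zero_apply]
  rw [← Complex.integral_comp_polarCoord_symm, polarCoord_target]
  have hpt : ∀ p ∈ Set.Ioi (0 : ℝ) ×ˢ Set.Ioo (-Real.pi) Real.pi,
      p.1 • (dbar ψ (Complex.polarCoord.symm p) * (Complex.polarCoord.symm p)⁻¹) =
      (1 / 2) * fderiv ℝ ψ (p.1 * Complex.exp (p.2 * Complex.I)) (1 * Complex.exp (p.2 * Complex.I)) +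
      (Complex.I / 2) * fderiv ℝ ψ (p.1 * Complex.exp (p.2 * Complex.I))
        (Complex.I * Complex.exp (p.2 * Complex.I)) := by
    rintro ⟨r, θ⟩ ⟨hr, -⟩
    simp only [Set.mem_Ioi] at hr
    have hsym : Complex.polarCoord.symm (r, θ) = r * Complex.exp (θ * Complex.I) := by
      rw [Complex.polarCoord_symm_apply, Complex.exp_mul_I]; push_cast; ring
    have hr' : (r : ℂ) ≠ 0 := by exact_mod_cast hr.ne'
    have hne := Complex.exp_ne_zero (θ * Complex.I)
    have hconj : (starRingEnd ℂ) (Complex.exp (θ * Complex.I)) = (Complex.exp (θ * Complex.I))⁻¹ := by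
      rw [← Complex.exp_conj, ← Complex.exp_neg]; simp
    simp only [hsym, dbar_eq_antiPart, Complex.real_smul, one_mul]
    generalize fderiv ℝ ψ (r * Complex.exp (θ * Complex.I)) = D
    rw [apply_eq_linPart_add_antiPart D (Complex.exp (θ * Complex.I)),
      apply_eq_linPart_add_antiPart D (Complex.I * Complex.exp (θ * Complex.I)), map_mul, hconj,
      Complex.conj_I]
    field_simp
    linear_combination (antiPart D - linPart D * (Complex.exp (θ * Complex.I)) ^ 2) * Complex.I_sq
  rw [setIntegral_congr_fun (measurableSet_Ioi.prod measurableSet_Ioo) hpt,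
    integral_add ((hint 1).const_mul _) ((hint Complex.I).const_mul _), integral_const_mul,
    integral_const_mul]
  have i1 : ∫ p in Set.Ioi (0 : ℝ) ×ˢ Set.Ioo (-Real.pi) Real.pi,
      fderiv ℝ ψ (p.1 * Complex.exp (p.2 * Complex.I)) (1 * Complex.exp (p.2 * Complex.I)) =
      -(2 * Real.pi * ψ 0) := by
    rw [Measure.volume_eq_prod, setIntegral_prod _ (hint 1), integral_integral_swap]
    · have : ∀ θ : ℝ, ∫ r in Set.Ioi (0 : ℝ), fderiv ℝ ψ (r * Complex.exp (θ * Complex.I))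
          (1 * Complex.exp (θ * Complex.I)) = -ψ 0 := fun θ => by
        rw [one_mul]
        exact integral_Ioi_fderiv_ray hψ hs _ (Complex.norm_exp_ofReal_mul_I θ)
      simp_rw [this]
      rw [setIntegral_const, Real.volume_real_Ioo_of_le (by linarith), Complex.real_smul]
      push_cast; ring
    · rw [Measure.prod_restrict]; exact hint 1
  have i2 : ∫ p in Set.Ioi (0 : ℝ) ×ˢ Set.Ioo (-Real.pi) Real.pi,
      fderiv ℝ ψ (p.1 * Complex.exp (p.2 * Complex.I)) (Complex.I * Complex.exp (p.2 * Complex.I)) =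
      0 := by
    rw [Measure.volume_eq_prod, setIntegral_prod _ (hint Complex.I)]
    refine setIntegral_eq_zero_of_forall_eq_zero fun r hr => ?_
    exact integral_Ioo_fderiv_circle hψ (ne_of_gt hr)
  rw [i1, i2]; ring

theorem integral_dbar_mul_inv_sub {ψ : ℂ → ℂ} (hψ : ContDiff ℝ 1 ψ) (hs : HasCompactSupport ψ)
    (w : ℂ) : ∫ z, dbar ψ z * (z - w)⁻¹ = -(Real.pi * ψ w) := by
  have h1 := integral_dbar_mul_inv (ψ := fun z => ψ (z + w)) (hψ.comp (contDiff_id.add contDiff_const))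
    (hs.comp_homeomorph (Homeomorph.addRight w))
  have h2 : ∀ z, dbar (fun z => ψ (z + w)) z = dbar ψ (z + w) := fun z => by
    unfold dbar; rw [fderiv_comp_add_right]
  rw [zero_add] at h1
  rw [← h1, ← integral_add_right_eq_self _ w]
  simp only [h2, add_sub_cancel_right]

/-! ### The Cauchy transform of a decaying function -/

theorem integrable_bracket_rpow {s : ℝ} (hs : 0 < s) :
    Integrable (fun z : ℂ => bracket z ^ (-2 - s)) := by
  have h := integrable_rpow_neg_one_add_norm_sq (E := ℂ) (μ := volume) (r := 2 + s)
    (by rw [Complex.finrank_real_complex]; push_cast; linarith)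
  refine h.congr (Eventually.of_forall fun z => ?_)
  simp only [bracket, Real.sqrt_eq_rpow]
  rw [← Real.rpow_mul (by positivity)]
  congr 1; ring

/-- An integrable majorant of the Cauchy kernel `1 / u` near `0`, with a little decay at infinity. -/
def kernelBound (s : ℝ) (u : ℂ) : ℝ := ‖u‖⁻¹ * bracket u ^ (-1 - s)

theorem kernelBound_nonneg (s : ℝ) (u : ℂ) : 0 ≤ kernelBound s u := by
  have := bracket_pos u
  unfold kernelBound; positivity

theorem integrable_kernelBound {s : ℝ} (hs : 0 < s) : Integrable (kernelBound s) := by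
  have h := integrable_rpow_neg_one_add_norm_sq (E := ℝ) (μ := volume) (r := 1 + s)
    (by rw [Module.finrank_self]; push_cast; linarith)
  have h1 : Integrable (fun z : ℂ => (fun y : ℝ => y⁻¹ * (1 + ‖y‖ ^ 2) ^ (-(1 + s) / 2)) ‖z‖) := by
    rw [integrable_fun_norm_addHaar (volume : Measure ℂ)
      (f := fun y : ℝ => y⁻¹ * (1 + ‖y‖ ^ 2) ^ (-(1 + s) / 2))]
    refine h.integrableOn.congr_fun (fun y hy => ?_) measurableSet_Ioi
    have hy' : y ≠ 0 := ne_of_gt hy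
    rw [Complex.finrank_real_complex]
    simp only [smul_eq_mul]
    field_simp
    norm_num
  refine h1.congr (Eventually.of_forall fun z => ?_)
  simp only [kernelBound, bracket, Real.sqrt_eq_rpow, norm_norm]
  rw [← Real.rpow_mul (by positivity)]
  congr 2; ring

/-- Splitting according to whether `|z - w|` or `⟨w⟩` is larger bounds `⟨w⟩^{-1-2s} / |z - w|` by
integrable functions of `w` and of `z - w`, with a gain that decays as `z → ∞`. -/
theorem bracket_rpow_mul_inv_le {s : ℝ} (hs : 0 < s) (hs1 : s ≤ 1) (z w : ℂ) :
    bracket w ^ (-1 - 2 * s) * ‖z - w‖⁻¹ ≤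
      max (bracket w) ‖z - w‖ ^ (-s) * (4 * (bracket w ^ (-2 - s) + kernelBound s (z - w))) := by
  have hb := one_le_bracket w
  have hb0 := bracket_pos w
  have hk := kernelBound_nonneg s (z - w)
  have hbr : 0 < bracket w ^ (-2 - s) := by positivity
  rcases le_or_gt (bracket w) ‖z - w‖ with h | h
  · rw [max_eq_right h]
    have hu : 0 < ‖z - w‖ := hb0.trans_le h
    have h1 : ‖z - w‖⁻¹ = ‖z - w‖ ^ (-s) * ‖z - w‖ ^ (-(1 - s)) := by
      rw [← Real.rpow_add hu, ← Real.rpow_neg_one]; congr 1; ring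
    have h2 : ‖z - w‖ ^ (-(1 - s)) ≤ bracket w ^ (-(1 - s)) :=
      Real.rpow_le_rpow_of_nonpos hb0 h (by linarith)
    have h3 : bracket w ^ (-1 - 2 * s) * bracket w ^ (-(1 - s)) = bracket w ^ (-2 - s) := by
      rw [← Real.rpow_add hb0]; congr 1; ring
    have h4 : 0 < ‖z - w‖ ^ (-s) := by positivity
    calc _ = ‖z - w‖ ^ (-s) * (bracket w ^ (-1 - 2 * s) * ‖z - w‖ ^ (-(1 - s))) := by rw [h1]; ring
      _ ≤ ‖z - w‖ ^ (-s) * (bracket w ^ (-1 - 2 * s) * bracket w ^ (-(1 - s))) := by gcongr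
      _ ≤ _ := by rw [h3]; gcongr; linarith
  · rw [max_eq_left h.le]
    have h1 : bracket w ^ (-1 - 2 * s) = bracket w ^ (-s) * bracket w ^ (-1 - s) := by
      rw [← Real.rpow_add hb0]; congr 1; ring
    have h2 : bracket (z - w) ≤ 2 * bracket w := by
      refine (bracket_le_one_add_norm _).trans ?_; linarith
    have h3 : bracket w ^ (-1 - s) ≤ 4 * bracket (z - w) ^ (-1 - s) := by
      have h5 : (2 * bracket w) ^ (-1 - s) ≤ bracket (z - w) ^ (-1 - s) :=
        Real.rpow_le_rpow_of_nonpos (bracket_pos _) h2 (by linarith)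
      rw [Real.mul_rpow (by norm_num) hb0.le] at h5
      have h6 : (1 / 4 : ℝ) ≤ 2 ^ (-1 - s) := by
        have : (2 : ℝ) ^ (-2 : ℝ) ≤ 2 ^ (-1 - s) :=
          Real.rpow_le_rpow_of_exponent_le (by norm_num) (by linarith)
        refine le_trans (le_of_eq ?_) this
        rw [Real.rpow_neg (by norm_num)]; norm_num
      have h7 : 0 < bracket w ^ (-1 - s) := by positivity
      nlinarith
    have h4 : 0 < bracket w ^ (-s) := by positivity
    calc _ = bracket w ^ (-s) * (bracket w ^ (-1 - s) * ‖z - w‖⁻¹) := by rw [h1]; ring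
      _ ≤ bracket w ^ (-s) * ((4 * bracket (z - w) ^ (-1 - s)) * ‖z - w‖⁻¹) := by gcongr
      _ = bracket w ^ (-s) * (4 * kernelBound s (z - w)) := by unfold kernelBound; ring
      _ ≤ _ := by gcongr; linarith

theorem max_rpow_le_one {s : ℝ} (hs : 0 < s) (z w : ℂ) :
    max (bracket w) ‖z - w‖ ^ (-s) ≤ 1 :=
  Real.rpow_le_one_of_one_le_of_nonpos ((one_le_bracket w).trans (le_max_left _ _)) (by linarith)

theorem bracket_rpow_mul_inv_le' {s : ℝ} (hs : 0 < s) (hs1 : s ≤ 1) (z w : ℂ) :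
    bracket w ^ (-1 - 2 * s) * ‖z - w‖⁻¹ ≤
      4 * (bracket w ^ (-2 - s) + kernelBound s (z - w)) := by
  have := bracket_pos w
  have hk := kernelBound_nonneg s (z - w)
  refine (bracket_rpow_mul_inv_le hs hs1 z w).trans (mul_le_of_le_one_left (by positivity)
    (max_rpow_le_one hs z w))

/-- The Cauchy transform `z ↦ π⁻¹ ∫ γ(w) / (z - w) L(dw)`. -/
def cauchyTransform (γ : ℂ → ℂ) (z : ℂ) : ℂ := (Real.pi : ℂ)⁻¹ * ∫ w, γ w * (z - w)⁻¹

section Transform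

variable {γ : ℂ → ℂ} {s C : ℝ}

theorem norm_mul_inv_le (hs : 0 < s) (hs1 : s ≤ 1)
    (hγ : ∀ᵐ w, ‖γ w‖ ≤ C * bracket w ^ (-1 - 2 * s)) :
    ∀ᵐ w, ∀ z, ‖γ w * (z - w)⁻¹‖ ≤ |C| * (4 * (bracket w ^ (-2 - s) + kernelBound s (z - w))) := by
  filter_upwards [hγ] with w hw z
  have := bracket_pos w
  rw [norm_mul, norm_inv]
  calc ‖γ w‖ * ‖z - w‖⁻¹ ≤ (|C| * bracket w ^ (-1 - 2 * s)) * ‖z - w‖⁻¹ := by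
        gcongr; exact hw.trans (by gcongr; exact le_abs_self C)
    _ = |C| * (bracket w ^ (-1 - 2 * s) * ‖z - w‖⁻¹) := by ring
    _ ≤ _ := mul_le_mul_of_nonneg_left (bracket_rpow_mul_inv_le' hs hs1 z w) (abs_nonneg C)

theorem integrable_majorant (hs : 0 < s) (z : ℂ) :
    Integrable fun w => bracket w ^ (-2 - s) + kernelBound s (z - w) :=
  (integrable_bracket_rpow hs).add ((integrable_kernelBound hs).comp_sub_left z)

theorem integral_majorant (hs : 0 < s) (z : ℂ) :
    ∫ w, (bracket w ^ (-2 - s) + kernelBound s (z - w)) =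
      (∫ w, bracket w ^ (-2 - s)) + ∫ w, kernelBound s w := by
  rw [integral_add (integrable_bracket_rpow hs) ((integrable_kernelBound hs).comp_sub_left z),
    integral_sub_left_eq_self]

theorem aestronglyMeasurable_mul_inv (hm : AEStronglyMeasurable γ) (z : ℂ) :
    AEStronglyMeasurable fun w => γ w * (z - w)⁻¹ :=
  hm.mul (by fun_prop : Measurable fun w : ℂ => (z - w)⁻¹).aestronglyMeasurable

theorem integrable_mul_inv (hs : 0 < s) (hs1 : s ≤ 1) (hm : AEStronglyMeasurable γ)
    (hγ : ∀ᵐ w, ‖γ w‖ ≤ C * bracket w ^ (-1 - 2 * s)) (z : ℂ) :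
    Integrable fun w => γ w * (z - w)⁻¹ :=
  (((integrable_majorant hs z).const_mul 4).const_mul |C|).mono'
    (aestronglyMeasurable_mul_inv hm z) ((norm_mul_inv_le hs hs1 hγ).mono fun _ h => h z)

theorem tendsto_cauchyTransform (hs : 0 < s) (hs1 : s ≤ 1)
    (hγ : ∀ᵐ w, ‖γ w‖ ≤ C * bracket w ^ (-1 - 2 * s)) :
    Tendsto (cauchyTransform γ) (cocompact ℂ) (𝓝 0) := by
  set I := (∫ w, bracket w ^ (-2 - s)) + ∫ w, kernelBound s w with hI
  have hbound : ∀ᶠ z in cocompact ℂ, ‖cauchyTransform γ z‖ ≤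
      Real.pi⁻¹ * (|C| * 4 * I) * (‖z‖ / 2) ^ (-s) := by
    have hz : ∀ᶠ z : ℂ in cocompact ℂ, 0 < ‖z‖ :=
      (tendsto_norm_cocompact_atTop).eventually_gt_atTop 0
    filter_upwards [hz] with z hz
    unfold cauchyTransform
    rw [norm_mul, norm_inv, Complex.norm_real, Real.norm_of_nonneg Real.pi_pos.le, mul_assoc]
    refine mul_le_mul_of_nonneg_left ?_ (inv_nonneg.mpr Real.pi_pos.le)
    refine (norm_integral_le_of_norm_le (((integrable_majorant hs z).const_mul 4).const_mul
      (|C| * (‖z‖ / 2) ^ (-s))) ?_).trans_eq ?_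
    · filter_upwards [hγ] with w hw
      have hb := bracket_pos w
      have hk := kernelBound_nonneg s (z - w)
      have hmax : ‖z‖ / 2 ≤ max (bracket w) ‖z - w‖ := by
        have h1 : ‖z‖ ≤ ‖z - w‖ + ‖w‖ := by simpa using norm_add_le (z - w) w
        have h2 := norm_le_bracket w
        have h3 := le_max_left (bracket w) ‖z - w‖
        have h4 := le_max_right (bracket w) ‖z - w‖
        linarith
      have hpow : max (bracket w) ‖z - w‖ ^ (-s) ≤ (‖z‖ / 2) ^ (-s) :=
        Real.rpow_le_rpow_of_nonpos (by positivity) hmax (by linarith)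
      rw [norm_mul, norm_inv]
      calc ‖γ w‖ * ‖z - w‖⁻¹ ≤ (|C| * bracket w ^ (-1 - 2 * s)) * ‖z - w‖⁻¹ := by
            gcongr; exact hw.trans (by gcongr; exact le_abs_self C)
        _ = |C| * (bracket w ^ (-1 - 2 * s) * ‖z - w‖⁻¹) := by ring
        _ ≤ |C| * (max (bracket w) ‖z - w‖ ^ (-s) *
            (4 * (bracket w ^ (-2 - s) + kernelBound s (z - w)))) :=
            mul_le_mul_of_nonneg_left (bracket_rpow_mul_inv_le hs hs1 z w) (abs_nonneg C)
        _ ≤ |C| * ((‖z‖ / 2) ^ (-s) *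
            (4 * (bracket w ^ (-2 - s) + kernelBound s (z - w)))) := by gcongr
        _ = _ := by ring
    · rw [integral_const_mul, integral_const_mul, integral_majorant hs]; ring
  refine squeeze_zero_norm' hbound ?_
  have h1 : Tendsto (fun z : ℂ => ‖z‖ / 2) (cocompact ℂ) atTop :=
    tendsto_norm_cocompact_atTop.atTop_div_const two_pos
  have h2 := (tendsto_rpow_neg_atTop hs).comp h1
  simpa using h2.const_mul (Real.pi⁻¹ * (|C| * 4 * I))

/-- A continuous truncation of the Cauchy kernel, equal to `1 / u` for `|u| ≥ δ`. -/
def truncKernel (δ : ℝ) (u : ℂ) : ℂ := (starRingEnd ℂ) u / ((max (‖u‖ ^ 2) (δ ^ 2) : ℝ) : ℂ)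

theorem continuous_truncKernel {δ : ℝ} (hδ : 0 < δ) : Continuous (truncKernel δ) := by
  unfold truncKernel
  refine Continuous.div (by fun_prop) (Complex.continuous_ofReal.comp (by fun_prop)) fun u => ?_
  have : 0 < max (‖u‖ ^ 2) (δ ^ 2) := lt_max_of_lt_right (by positivity)
  exact_mod_cast this.ne'

theorem truncKernel_of_le {δ : ℝ} (hδ : 0 < δ) {u : ℂ} (h : δ ≤ ‖u‖) : truncKernel δ u = u⁻¹ := by
  unfold truncKernel
  rw [max_eq_left (by gcongr), Complex.inv_def, Complex.normSq_eq_norm_sq, div_eq_mul_inv]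
  push_cast; rfl

theorem norm_truncKernel (δ : ℝ) (u : ℂ) : ‖truncKernel δ u‖ = ‖u‖ / max (‖u‖ ^ 2) (δ ^ 2) := by
  unfold truncKernel
  rw [norm_div, RCLike.norm_conj, Complex.norm_real, Real.norm_of_nonneg
    ((sq_nonneg ‖u‖).trans (le_max_left _ _))]

theorem norm_truncKernel_le {δ : ℝ} (hδ : 0 < δ) (u : ℂ) : ‖truncKernel δ u‖ ≤ (max ‖u‖ δ)⁻¹ := by
  rw [norm_truncKernel]
  have hm : 0 < max ‖u‖ δ := lt_max_of_lt_right hδ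
  have h2 : max (‖u‖ ^ 2) (δ ^ 2) = (max ‖u‖ δ) ^ 2 := by
    rcases le_total ‖u‖ δ with h | h
    · rw [max_eq_right h, max_eq_right (by gcongr)]
    · rw [max_eq_left h, max_eq_left (by gcongr)]
  rw [h2, div_le_iff₀ (by positivity), sq, inv_mul_cancel_left₀ hm.ne']
  exact le_max_left _ _

theorem norm_truncKernel_le_inv {δ : ℝ} (hδ : 0 < δ) (u : ℂ) : ‖truncKernel δ u‖ ≤ ‖u‖⁻¹ := by
  rcases eq_or_ne u 0 with rfl | hu
  · simp [truncKernel]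
  · exact (norm_truncKernel_le hδ u).trans
      (inv_anti₀ (norm_pos_iff.mpr hu) (le_max_left _ _))

theorem norm_inv_sub_truncKernel_le (hs1 : s ≤ 1) {δ : ℝ} (hδ : 0 < δ) (hδ1 : δ ≤ 1)
    (u : ℂ) : ‖u⁻¹ - truncKernel δ u‖ ≤ 8 * kernelBound s u := by
  rcases le_or_gt δ ‖u‖ with h | h
  · rw [truncKernel_of_le hδ h, sub_self, norm_zero]
    exact mul_nonneg (by norm_num) (kernelBound_nonneg _ _)
  · have h1 : ‖u⁻¹ - truncKernel δ u‖ ≤ 2 * ‖u‖⁻¹ := by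
      refine (norm_sub_le _ _).trans ?_
      have := norm_truncKernel_le_inv hδ u
      rw [norm_inv]; linarith
    have h2 : bracket u ≤ 2 := (bracket_le_one_add_norm u).trans (by linarith)
    have h3 : (1 / 4 : ℝ) ≤ bracket u ^ (-1 - s) := by
      have h4 : (2 : ℝ) ^ (-2 : ℝ) ≤ bracket u ^ (-2 : ℝ) :=
        Real.rpow_le_rpow_of_nonpos (bracket_pos u) h2 (by norm_num)
      have h5 : bracket u ^ (-2 : ℝ) ≤ bracket u ^ (-1 - s) :=
        Real.rpow_le_rpow_of_exponent_le (one_le_bracket u) (by linarith)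
      refine le_trans (le_of_eq ?_) (h4.trans h5)
      rw [Real.rpow_neg (by norm_num)]; norm_num
    refine h1.trans ?_
    unfold kernelBound
    have : 0 ≤ ‖u‖⁻¹ := by positivity
    nlinarith

theorem tendsto_integral_inv_sub_truncKernel :
    Tendsto (fun n : ℕ => ∫ u : ℂ, ‖u⁻¹ - truncKernel (1 / ((n : ℝ) + 1)) u‖) atTop (𝓝 0) := by
  have hδ : ∀ n : ℕ, (0 : ℝ) < 1 / ((n : ℝ) + 1) := fun n => by positivity
  have hδ1 : ∀ n : ℕ, 1 / ((n : ℝ) + 1) ≤ (1 : ℝ) := fun n => by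
    rw [div_le_one (by positivity)]; linarith [(Nat.cast_nonneg n : (0 : ℝ) ≤ n)]
  have h := tendsto_integral_of_dominated_convergence (μ := (volume : Measure ℂ))
    (F := fun (n : ℕ) (u : ℂ) => ‖u⁻¹ - truncKernel (1 / ((n : ℝ) + 1)) u‖) (f := fun _ => (0 : ℝ))
    (fun u => 8 * kernelBound 1 u) (fun n => ?_) ((integrable_kernelBound one_pos).const_mul 8)
    (fun n => Eventually.of_forall fun u => ?_) ?_
  · simpa using h
  · have := (continuous_truncKernel (hδ n)).measurable
    exact (by fun_prop : Measurable fun u : ℂ =>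
      ‖u⁻¹ - truncKernel (1 / ((n : ℝ) + 1)) u‖).aestronglyMeasurable
  · rw [norm_norm]
    exact norm_inv_sub_truncKernel_le le_rfl (hδ n) (hδ1 n) u
  · have hne : ∀ᵐ u : ℂ, u ≠ 0 := by rw [ae_iff]; simp
    filter_upwards [hne] with u hu
    refine tendsto_const_nhds.congr' ?_
    have h0 : Tendsto (fun n : ℕ => 1 / ((n : ℝ) + 1)) atTop (𝓝 0) :=
      tendsto_one_div_add_atTop_nhds_zero_nat
    filter_upwards [h0.eventually (gt_mem_nhds (norm_pos_iff.mpr hu))] with n hn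
    rw [truncKernel_of_le (hδ n) hn.le, sub_self, norm_zero]

theorem continuous_integral_truncKernel (hs : 0 < s) (hs1 : s ≤ 1) (hm : AEStronglyMeasurable γ)
    (hγ : ∀ᵐ w, ‖γ w‖ ≤ C * bracket w ^ (-1 - 2 * s)) {δ : ℝ} (hδ : 0 < δ) :
    Continuous fun z => ∫ w, γ w * truncKernel δ (z - w) := by
  rw [continuous_iff_continuousAt]
  intro z₀
  have hk := continuous_truncKernel hδ
  refine continuousAt_of_dominated
    (bound := fun w => (1 + 1 / δ) * (|C| * (4 * (bracket w ^ (-2 - s) + kernelBound s (z₀ - w)))))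
    (Eventually.of_forall fun z => hm.mul (by fun_prop : Continuous _).aestronglyMeasurable) ?_
    ((((integrable_majorant hs z₀).const_mul 4).const_mul |C|).const_mul _)
    (Eventually.of_forall fun w => (by fun_prop : Continuous _).continuousAt)
  filter_upwards [Metric.ball_mem_nhds z₀ one_pos] with z hz
  have hne : ∀ᵐ w : ℂ, w ≠ z₀ := by rw [ae_iff]; simp
  filter_upwards [norm_mul_inv_le hs hs1 hγ, hne] with w hw hwz
  have hz' : ‖z₀ - z‖ < 1 := by rwa [← dist_eq_norm, dist_comm]
  refine le_trans ?_ (mul_le_mul_of_nonneg_left (hw z₀) (by positivity))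
  rw [norm_mul, norm_mul, norm_inv]
  have h0 : 0 < ‖z₀ - w‖ := norm_pos_iff.mpr (sub_ne_zero.mpr hwz.symm)
  have hmx : 0 < max ‖z - w‖ δ := lt_max_of_lt_right hδ
  have h1 : ‖z₀ - w‖ ≤ (1 + 1 / δ) * max ‖z - w‖ δ := by
    have h2 : ‖z₀ - w‖ ≤ ‖z₀ - z‖ + ‖z - w‖ := by simpa using norm_add_le (z₀ - z) (z - w)
    have h3 : 1 ≤ 1 / δ * max ‖z - w‖ δ := by
      rw [div_mul_eq_mul_div, one_mul, le_div_iff₀ hδ, one_mul]; exact le_max_right _ _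
    have := le_max_left ‖z - w‖ δ
    linarith
  have h4 : ‖truncKernel δ (z - w)‖ ≤ (1 + 1 / δ) * ‖z₀ - w‖⁻¹ := by
    refine (norm_truncKernel_le hδ _).trans ?_
    rw [← div_eq_mul_inv, le_div_iff₀ h0, inv_mul_le_iff₀ hmx, mul_comm]
    exact h1
  calc ‖γ w‖ * ‖truncKernel δ (z - w)‖ ≤ ‖γ w‖ * ((1 + 1 / δ) * ‖z₀ - w‖⁻¹) := by gcongr
    _ = _ := by ring

theorem continuous_cauchyTransform (hs : 0 < s) (hs1 : s ≤ 1) (hm : AEStronglyMeasurable γ)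
    (hγ : ∀ᵐ w, ‖γ w‖ ≤ C * bracket w ^ (-1 - 2 * s)) : Continuous (cauchyTransform γ) := by
  unfold cauchyTransform
  refine continuous_const.mul ?_
  refine continuous_of_uniform_approx_of_continuous ?_
  rw [Metric.uniformity_basis_dist_le.forall_iff fun s t hst ⟨F, hF, h⟩ => ⟨F, hF, fun y => hst (h y)⟩]
  intro ε hε
  have hC : ∀ᵐ w, ‖γ w‖ ≤ |C| := by
    filter_upwards [hγ] with w hw
    have h1 : bracket w ^ (-1 - 2 * s) ≤ 1 :=
      Real.rpow_le_one_of_one_le_of_nonpos (one_le_bracket w) (by linarith)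
    have h2 : 0 < bracket w ^ (-1 - 2 * s) := Real.rpow_pos_of_pos (bracket_pos w) _
    refine hw.trans ((mul_le_mul_of_nonneg_right (le_abs_self C) h2.le).trans ?_)
    exact mul_le_of_le_one_right (abs_nonneg C) h1
  have h0 := (tendsto_integral_inv_sub_truncKernel.const_mul |C|)
  rw [mul_zero] at h0
  obtain ⟨n, hn⟩ := (h0.eventually (gt_mem_nhds hε)).exists
  have hδ : (0 : ℝ) < 1 / ((n : ℝ) + 1) := by positivity
  have hδ1 : 1 / ((n : ℝ) + 1) ≤ (1 : ℝ) := by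
    rw [div_le_one (by positivity)]; linarith [(Nat.cast_nonneg n : (0 : ℝ) ≤ n)]
  refine ⟨_, continuous_integral_truncKernel hs hs1 hm hγ hδ, fun z => ?_⟩
  have hk := continuous_truncKernel hδ
  have hgi : Integrable fun u : ℂ => ‖u⁻¹ - truncKernel (1 / ((n : ℝ) + 1)) u‖ := by
    refine ((integrable_kernelBound one_pos).const_mul 8).mono' ?_ (Eventually.of_forall fun u => ?_)
    · have := hk.measurable
      exact (by fun_prop : Measurable fun u : ℂ =>
        ‖u⁻¹ - truncKernel (1 / ((n : ℝ) + 1)) u‖).aestronglyMeasurable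
    · rw [norm_norm]
      exact norm_inv_sub_truncKernel_le le_rfl hδ hδ1 u
  have hi1 := integrable_mul_inv hs hs1 hm hγ z
  have hi2 : Integrable fun w => γ w * truncKernel (1 / ((n : ℝ) + 1)) (z - w) := by
    refine hi1.mono (hm.mul (by fun_prop : Continuous _).aestronglyMeasurable)
      (Eventually.of_forall fun w => ?_)
    rw [norm_mul, norm_mul, norm_inv]
    gcongr
    exact norm_truncKernel_le_inv hδ _
  simp only [Set.mem_ofPred_eq, dist_eq_norm]
  rw [← integral_sub hi1 hi2]
  simp_rw [← mul_sub]
  refine le_trans ?_ hn.le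
  refine (norm_integral_le_of_norm_le ((hgi.comp_sub_left z).const_mul |C|) ?_).trans_eq ?_
  · filter_upwards [hC] with w hw
    rw [norm_mul]; gcongr
  · rw [integral_const_mul, integral_sub_left_eq_self
      (fun u : ℂ => ‖u⁻¹ - truncKernel (1 / ((n : ℝ) + 1)) u‖)]

theorem continuous_dbar {ψ : ℂ → ℂ} (hψ : ContDiff ℝ 1 ψ) : Continuous (dbar ψ) := by
  have := hψ.continuous_fderiv one_ne_zero
  unfold dbar; fun_prop

theorem hasCompactSupport_dbar {ψ : ℂ → ℂ} (hs : HasCompactSupport ψ) :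
    HasCompactSupport (dbar ψ) :=
  (hs.fderiv (𝕜 := ℝ)).comp_left (g := antiPart) (by simp [antiPart])

/-- The Cauchy transform is a fundamental solution: `∂/∂z̄` of the Cauchy transform of `γ` is `γ`. -/
theorem integral_cauchyTransform_mul_dbar (hs : 0 < s) (hs1 : s ≤ 1) (hm : AEStronglyMeasurable γ)
    (hγ : ∀ᵐ w, ‖γ w‖ ≤ C * bracket w ^ (-1 - 2 * s)) {ψ : ℂ → ℂ} (hψ : ContDiff ℝ 1 ψ)
    (hψs : HasCompactSupport ψ) :
    ∫ z, cauchyTransform γ z * dbar ψ z = -∫ z, γ z * ψ z := by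
  have hdc := continuous_dbar hψ
  have hds := hasCompactSupport_dbar hψs
  have hdi : Integrable (dbar ψ) := hdc.integrable_of_hasCompactSupport hds
  have hswap : Integrable (Function.uncurry fun z w => dbar ψ z * (γ w * (z - w)⁻¹))
      (volume.prod volume) := by
    obtain ⟨D, hD⟩ := hdc.bounded_above_of_compact_support hds
    have hb := integrable_bracket_rpow hs
    have hk := integrable_kernelBound hs
    -- The double integrand is dominated by a product of integrable functions plus a convolution
    -- integrand.
    have h1 : Integrable (fun p : ℂ × ℂ => ‖dbar ψ p.1‖ * bracket p.2 ^ (-2 - s))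
        (volume.prod volume) := hdi.norm.mul_prod hb
    have h2 : Integrable (fun p : ℂ × ℂ => ‖dbar ψ p.1‖ * kernelBound s (p.1 - p.2))
        (volume.prod volume) := by
      have h3 := Integrable.convolution_integrand (ContinuousLinearMap.mul ℝ ℝ) (μ := (volume : Measure ℂ))
        (ν := (volume : Measure ℂ)) hdi.norm hk
      have h4 := h3.swap
      have h5 : ∀ u, kernelBound s (-u) = kernelBound s u := fun u => by
        simp [kernelBound, bracket]
      refine h4.congr (Eventually.of_forall fun p => ?_)
      simp only [Function.comp_apply, Prod.swap, ContinuousLinearMap.mul_apply']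
      rw [← h5, neg_sub]
    refine ((h1.add h2).const_mul (|C| * 4)).mono' ?_ ?_
    · have e1 : AEStronglyMeasurable (fun p : ℂ × ℂ => dbar ψ p.1) (volume.prod volume) :=
        (hdc.comp continuous_fst).aestronglyMeasurable
      have e2 : AEStronglyMeasurable (fun p : ℂ × ℂ => γ p.2) (volume.prod volume) := hm.comp_snd
      have e3 : AEStronglyMeasurable (fun p : ℂ × ℂ => (p.1 - p.2)⁻¹) (volume.prod volume) :=
        (by fun_prop : Measurable fun p : ℂ × ℂ => (p.1 - p.2)⁻¹).aestronglyMeasurable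
      exact e1.mul (e2.mul e3)
    · have hae : ∀ᵐ p : ℂ × ℂ ∂(volume.prod volume), ∀ z,
          ‖γ p.2 * (z - p.2)⁻¹‖ ≤ |C| * (4 * (bracket p.2 ^ (-2 - s) + kernelBound s (z - p.2))) :=
        (Measure.quasiMeasurePreserving_snd (μ := (volume : Measure ℂ)) (ν := (volume : Measure ℂ))).ae
          (norm_mul_inv_le hs hs1 hγ)
      filter_upwards [hae] with p hp
      simp only [Function.uncurry, Pi.add_apply]
      rw [norm_mul]
      calc ‖dbar ψ p.1‖ * ‖γ p.2 * (p.1 - p.2)⁻¹‖ ≤ ‖dbar ψ p.1‖ *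
            (|C| * (4 * (bracket p.2 ^ (-2 - s) + kernelBound s (p.1 - p.2)))) := by
            gcongr; exact hp p.1
        _ = _ := by ring
  have e1 : ∀ z, cauchyTransform γ z * dbar ψ z =
      (Real.pi : ℂ)⁻¹ * ∫ w, dbar ψ z * (γ w * (z - w)⁻¹) := fun z => by
    rw [integral_const_mul]; unfold cauchyTransform; ring
  simp_rw [e1]
  rw [integral_const_mul, integral_integral_swap hswap]
  have e2 : ∀ w, ∫ z, dbar ψ z * (γ w * (z - w)⁻¹) = -(Real.pi * (γ w * ψ w)) := fun w => by
    have : ∀ z, dbar ψ z * (γ w * (z - w)⁻¹) = γ w * (dbar ψ z * (z - w)⁻¹) := fun z => by ring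
    simp_rw [this]
    rw [integral_const_mul, integral_dbar_mul_inv_sub hψ hψs]; ring
  simp_rw [e2]
  rw [integral_neg, integral_const_mul]
  have : (Real.pi : ℂ) ≠ 0 := by exact_mod_cast Real.pi_ne_zero
  field_simp

end Transform

/-! ### Bounded weakly holomorphic functions are constant -/

/-- Weyl's lemma with Liouville's theorem: regularisations of `H` are holomorphic and bounded. -/
theorem eq_of_integral_mul_dbar_eq_zero {H : ℂ → ℂ} (hc : Continuous H) {C : ℝ}
    (hb : ∀ z, ‖H z‖ ≤ C)
    (h : ∀ ψ : ℂ → ℂ, ContDiff ℝ ∞ ψ → HasCompactSupport ψ → ∫ z, H z * dbar ψ z = 0) (z w : ℂ) :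
    H z = H w := by
  have hloc : LocallyIntegrable H volume := hc.locallyIntegrable
  let φ : ℕ → ContDiffBump (0 : ℂ) := fun n =>
    { rIn := 1 / (2 * ((n : ℝ) + 1)), rOut := 1 / ((n : ℝ) + 1), rIn_pos := by positivity,
      rIn_lt_rOut := by
        apply one_div_lt_one_div_of_lt (by positivity)
        linarith [(Nat.cast_nonneg n : (0 : ℝ) ≤ n)] }
  have hφ : Tendsto (fun n => (φ n).rOut) atTop (𝓝 0) := tendsto_one_div_add_atTop_nhds_zero_nat
  have hlim := fun x₀ => ContDiffBump.convolution_tendsto_right_of_continuous (μ := (volume : Measure ℂ))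
    hφ hc x₀
  refine tendsto_nhds_unique ((hlim z).congr fun n => ?_) (hlim w)
  set f : ℂ → ℝ := (φ n).normed volume with hf
  have hfc : ContDiff ℝ 1 f := (φ n).contDiff_normed (n := 1)
  have hfi : ContDiff ℝ ∞ f := (φ n).contDiff_normed (n := ⊤)
  have hfs : HasCompactSupport f := (φ n).hasCompactSupport_normed
  set L := ContinuousLinearMap.lsmul ℝ ℝ (E := ℂ)
  have hd := fun x₀ => hfs.hasFDerivAt_convolution_left L hfc hloc x₀
  have hcr : ∀ x₀, fderiv ℝ (convolution f H L volume) x₀ Complex.I =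
      Complex.I • fderiv ℝ (convolution f H L volume) x₀ 1 := by
    intro x₀
    have happ : ∀ v : ℂ, fderiv ℝ (convolution f H L volume) x₀ v =
        ∫ t, ((fderiv ℝ f t v : ℝ) : ℂ) * H (x₀ - t) := by
      intro v
      rw [(hd x₀).fderiv, convolution_def]
      have hex := (hfs.fderiv (𝕜 := ℝ)).convolutionExists_left (L.precompL ℂ)
        (hfc.continuous_fderiv one_ne_zero) hloc x₀
      rw [ContinuousLinearMap.integral_apply hex.integrable]
      simp only [ContinuousLinearMap.precompL_apply, L, ContinuousLinearMap.lsmul_apply,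
        Complex.real_smul]
    have hint : ∀ v : ℂ, Integrable fun t => ((fderiv ℝ f t v : ℝ) : ℂ) * H (x₀ - t) := by
      intro v
      have hfd := hfc.continuous_fderiv one_ne_zero
      refine Continuous.integrable_of_hasCompactSupport (by fun_prop) ?_
      refine HasCompactSupport.mul_right ?_
      exact (hfs.fderiv (𝕜 := ℝ)).comp_left (g := fun D : ℂ →L[ℝ] ℝ => ((D v : ℝ) : ℂ)) (by simp)
    let ψ : ℂ → ℂ := fun u => ((f (x₀ - u) : ℝ) : ℂ)
    have hψ : ContDiff ℝ ∞ ψ :=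
      Complex.ofRealCLM.contDiff.comp (hfi.comp (contDiff_const.sub contDiff_id))
    have hψs : HasCompactSupport ψ :=
      (hfs.comp_homeomorph (Homeomorph.subLeft x₀)).comp_left (g := fun t : ℝ => (t : ℂ)) (by simp)
    have hψd : ∀ u, dbar ψ u = -((1 / 2) * (((fderiv ℝ f (x₀ - u) 1 : ℝ) : ℂ) +
        Complex.I * ((fderiv ℝ f (x₀ - u) Complex.I : ℝ) : ℂ))) := by
      intro u
      have h1 : HasFDerivAt (fun u => x₀ - u) (-ContinuousLinearMap.id ℝ ℂ) u := by
        simpa using (hasFDerivAt_id (𝕜 := ℝ) u).const_sub x₀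
      have h2 := (hfc.differentiable one_ne_zero (x₀ - u)).hasFDerivAt.comp u h1
      have h3 := (Complex.ofRealCLM.hasFDerivAt (x := f (x₀ - u))).comp u h2
      have h4 : fderiv ℝ ψ u = _ := h3.fderiv
      unfold dbar
      rw [h4]
      simp
      ring
    have h0 := h ψ hψ hψs
    rw [← integral_sub_left_eq_self _ volume x₀] at h0
    simp only [hψd, sub_sub_cancel] at h0
    have h5 : ∫ t, ((fderiv ℝ f t 1 : ℝ) : ℂ) * H (x₀ - t) +
        Complex.I * (((fderiv ℝ f t Complex.I : ℝ) : ℂ) * H (x₀ - t)) = 0 := by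
      have : ∀ t, ((fderiv ℝ f t 1 : ℝ) : ℂ) * H (x₀ - t) +
          Complex.I * (((fderiv ℝ f t Complex.I : ℝ) : ℂ) * H (x₀ - t)) = -2 * (H (x₀ - t) *
          -((1 / 2) * (((fderiv ℝ f t 1 : ℝ) : ℂ) + Complex.I * ((fderiv ℝ f t Complex.I : ℝ) : ℂ)))) :=
        fun t => by ring
      simp_rw [this]
      rw [integral_const_mul, h0, mul_zero]
    rw [integral_add (hint 1) ((hint Complex.I).const_mul _), integral_const_mul, ← happ, ← happ] at h5
    rw [smul_eq_mul]
    linear_combination (-Complex.I) * h5 + (fderiv ℝ (convolution f H L volume) x₀ Complex.I) * Complex.I_sq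
  have hol : Differentiable ℂ (convolution f H L volume) := fun x₀ =>
    differentiableAt_complex_iff_differentiableAt_real.mpr ⟨(hd x₀).differentiableAt, hcr x₀⟩
  refine hol.apply_eq_apply_of_bounded ?_ z w
  refine isBounded_iff_forall_norm_le.mpr ⟨C, ?_⟩
  rintro _ ⟨x, rfl⟩
  rw [convolution_def]
  have hfint : Integrable f := hfc.continuous.integrable_of_hasCompactSupport hfs
  refine (norm_integral_le_of_norm_le (hfint.mul_const C) (Eventually.of_forall fun t => ?_)).trans_eq ?_
  · simp only [L, ContinuousLinearMap.lsmul_apply, norm_smul]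
    rw [Real.norm_of_nonneg ((φ n).nonneg_normed t)]
    exact mul_le_mul_of_nonneg_left (hb _) ((φ n).nonneg_normed t)
  · rw [integral_mul_const, (φ n).integral_normed, one_mul]

/-- A bounded continuous function with decaying `∂/∂z̄`-derivative is the sum of its limit at infinity
and of the Cauchy transform of that derivative. -/
theorem HasWeakDbar.exists_eq_cauchyTransform {F γ : ℂ → ℂ} (h : HasWeakDbar F γ) (hc : Continuous F)
    (hb : ∃ C : ℝ, ∀ z, ‖F z‖ ≤ C) {ε C : ℝ} (hε : 0 < ε)
    (hγ : ∀ᵐ w, ‖γ w‖ ≤ C * bracket w ^ (-1 - ε)) :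
    ∃ c : ℂ, Tendsto F (cocompact ℂ) (𝓝 c) ∧ ∀ z, F z = c + cauchyTransform γ z := by
  set s := min (ε / 2) 1
  have hs : 0 < s := lt_min (by linarith) one_pos
  have hs1 : s ≤ 1 := min_le_right _ _
  have hγ' : ∀ᵐ w, ‖γ w‖ ≤ |C| * bracket w ^ (-1 - 2 * s) := by
    filter_upwards [hγ] with w hw
    have h1 : bracket w ^ (-1 - ε) ≤ bracket w ^ (-1 - 2 * s) :=
      Real.rpow_le_rpow_of_exponent_le (one_le_bracket w) (by
        have : s ≤ ε / 2 := min_le_left _ _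
        linarith)
    have h2 : 0 < bracket w ^ (-1 - ε) := Real.rpow_pos_of_pos (bracket_pos w) _
    calc ‖γ w‖ ≤ C * bracket w ^ (-1 - ε) := hw
      _ ≤ |C| * bracket w ^ (-1 - ε) := by gcongr; exact le_abs_self C
      _ ≤ _ := by gcongr
  have hm := h.locallyIntegrable_dbar.aestronglyMeasurable
  have hTc := continuous_cauchyTransform hs hs1 hm hγ'
  have hTl := tendsto_cauchyTransform hs hs1 hγ'
  obtain ⟨C₁, hC₁⟩ := hb
  obtain ⟨C₂, hC₂⟩ : ∃ C₂ : ℝ, ∀ z, ‖cauchyTransform γ z‖ ≤ C₂ := by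
    have h1 : ∀ᶠ z in cocompact ℂ, ‖cauchyTransform γ z‖ ≤ 1 :=
      (hTl.norm.eventually (gt_mem_nhds (by simp : ‖(0 : ℂ)‖ < 1))).mono fun _ h => h.le
    obtain ⟨K, hK, hKs⟩ := mem_cocompact.mp h1
    obtain ⟨D, hD⟩ := hK.exists_bound_of_continuousOn hTc.continuousOn
    refine ⟨max 1 D, fun z => ?_⟩
    by_cases hz : z ∈ K
    · exact (hD z hz).trans (le_max_right _ _)
    · exact (hKs hz).trans (le_max_left _ _)
  have key := eq_of_integral_mul_dbar_eq_zero (H := fun z => F z - cauchyTransform γ z)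
    (hc.sub hTc) (C := C₁ + C₂) (fun z => (norm_sub_le _ _).trans (add_le_add (hC₁ z) (hC₂ z)))
    (fun ψ hψ hψs => by
      have hψ1 : ContDiff ℝ 1 ψ := hψ.of_le (by exact_mod_cast le_top)
      have hdc := continuous_dbar hψ1
      have hds := hasCompactSupport_dbar hψs
      simp_rw [sub_mul]
      rw [integral_sub, h.integral_eq ψ hψ hψs, integral_cauchyTransform_mul_dbar hs hs1 hm hγ' hψ1 hψs,
        sub_self]
      · exact (hc.mul hdc).integrable_of_hasCompactSupport hds.mul_left
      · exact (hTc.mul hdc).integrable_of_hasCompactSupport hds.mul_left)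
  have heq : ∀ z, F z = (F 0 - cauchyTransform γ 0) + cauchyTransform γ z := fun z => by
    rw [← key z 0]; ring
  refine ⟨F 0 - cauchyTransform γ 0, ?_, heq⟩
  have := hTl.const_add (F 0 - cauchyTransform γ 0)
  rw [add_zero] at this
  exact this.congr fun z => (heq z).symm

/-! ### Asymptotic expansions at infinity -/

/-- The neighbourhood `{1 < |x|}` of infinity in the real line. -/
def outside : Set ℝ := {x | 1 < |x|}

theorem isOpen_outside : IsOpen outside := isOpen_lt continuous_const continuous_abs

theorem ne_zero_of_mem_outside {x : ℝ} (hx : x ∈ outside) : x ≠ 0 := by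
  rintro rfl
  have : (1 : ℝ) < |0| := hx
  norm_num at this

theorem one_le_abs_of_mem_outside {x : ℝ} (hx : x ∈ outside) : 1 ≤ |x| := le_of_lt hx

/-- `h` is smooth on `{1 < |x|}` and is there `O(x^{-M})` together with all its derivatives. -/
def DecaysOutside (M : ℤ) (h : ℝ → ℂ) : Prop :=
  (∀ x ∈ outside, ContDiffAt ℝ ∞ h x) ∧
    ∀ i : ℕ, ∃ C : ℝ, ∀ x ∈ outside, |x| ^ M * ‖iteratedDeriv i h x‖ ≤ C

namespace DecaysOutside

variable {M M' : ℤ} {h k : ℝ → ℂ}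

theorem congr (hh : DecaysOutside M h) (hk : ∀ x ∈ outside, k x = h x) : DecaysOutside M k := by
  have he : ∀ x ∈ outside, k =ᶠ[𝓝 x] h := fun x hx =>
    (isOpen_outside.eventually_mem hx).mono hk
  refine ⟨fun x hx => (hh.1 x hx).congr_of_eventuallyEq (he x hx), fun i => ?_⟩
  obtain ⟨C, hC⟩ := hh.2 i
  exact ⟨C, fun x hx => by rw [(he x hx).iteratedDeriv_eq]; exact hC x hx⟩

theorem mono (hh : DecaysOutside M h) (hM : M' ≤ M) : DecaysOutside M' h := by
  refine ⟨hh.1, fun i => ?_⟩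
  obtain ⟨C, hC⟩ := hh.2 i
  refine ⟨C, fun x hx => le_trans ?_ (hC x hx)⟩
  have := zpow_le_zpow_right₀ (one_le_abs_of_mem_outside hx) hM
  gcongr

theorem deriv (hh : DecaysOutside M h) : DecaysOutside M (deriv h) := by
  refine ⟨fun x hx => ?_, fun i => ?_⟩
  · have h1 : ContDiffOn ℝ ∞ h outside := fun y hy => (hh.1 y hy).contDiffWithinAt
    exact ((contDiffOn_infty_iff_deriv_of_isOpen isOpen_outside).mp h1).2.contDiffAt
      (isOpen_outside.mem_nhds hx)
  · obtain ⟨C, hC⟩ := hh.2 (i + 1)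
    exact ⟨C, fun x hx => by rw [← iteratedDeriv_succ']; exact hC x hx⟩

theorem add (hh : DecaysOutside M h) (hk : DecaysOutside M k) : DecaysOutside M (h + k) := by
  refine ⟨fun x hx => (hh.1 x hx).add (hk.1 x hx), fun i => ?_⟩
  obtain ⟨C, hC⟩ := hh.2 i
  obtain ⟨C', hC'⟩ := hk.2 i
  refine ⟨C + C', fun x hx => ?_⟩
  have h1 : ContDiffAt ℝ i h x := (hh.1 x hx).of_le (by exact_mod_cast le_top)
  have h2 : ContDiffAt ℝ i k x := (hk.1 x hx).of_le (by exact_mod_cast le_top)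
  have h3 := one_le_abs_of_mem_outside hx
  rw [iteratedDeriv_add h1 h2]
  calc |x| ^ M * ‖iteratedDeriv i h x + iteratedDeriv i k x‖
      ≤ |x| ^ M * (‖iteratedDeriv i h x‖ + ‖iteratedDeriv i k x‖) := by
        gcongr; exact norm_add_le _ _
    _ ≤ _ := by rw [mul_add]; exact add_le_add (hC x hx) (hC' x hx)

theorem const_mul (hh : DecaysOutside M h) (c : ℂ) : DecaysOutside M fun x => c * h x := by
  refine ⟨fun x hx => contDiffAt_const.mul (hh.1 x hx), fun i => ?_⟩
  obtain ⟨C, hC⟩ := hh.2 i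
  refine ⟨‖c‖ * C, fun x hx => ?_⟩
  rw [iteratedDeriv_const_mul_field, norm_mul, mul_left_comm]
  exact mul_le_mul_of_nonneg_left (hC x hx) (norm_nonneg c)

theorem mul (hh : DecaysOutside M h) (hk : DecaysOutside M' k) :
    DecaysOutside (M + M') (h * k) := by
  refine ⟨fun x hx => (hh.1 x hx).mul (hk.1 x hx), fun i => ?_⟩
  choose C hC using hh.2
  choose C' hC' using hk.2
  refine ⟨∑ j ∈ Finset.range (i + 1), (i.choose j : ℝ) * (C j * C' (i - j)), fun x hx => ?_⟩
  have h1 : ContDiffAt ℝ i h x := (hh.1 x hx).of_le (by exact_mod_cast le_top)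
  have h2 : ContDiffAt ℝ i k x := (hk.1 x hx).of_le (by exact_mod_cast le_top)
  have h3 : 0 < |x| := abs_pos.mpr (ne_zero_of_mem_outside hx)
  rw [iteratedDeriv_mul h1 h2]
  calc _ ≤ |x| ^ (M + M') * ∑ j ∈ Finset.range (i + 1),
        (i.choose j : ℝ) * (‖iteratedDeriv j h x‖ * ‖iteratedDeriv (i - j) k x‖) := by
        gcongr
        refine (norm_sum_le _ _).trans (le_of_eq (Finset.sum_congr rfl fun j _ => ?_))
        rw [norm_mul, norm_mul, RCLike.norm_natCast, mul_assoc]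
    _ = ∑ j ∈ Finset.range (i + 1), (i.choose j : ℝ) * ((|x| ^ M * ‖iteratedDeriv j h x‖) *
        (|x| ^ M' * ‖iteratedDeriv (i - j) k x‖)) := by
        rw [Finset.mul_sum, zpow_add₀ h3.ne']
        exact Finset.sum_congr rfl fun j _ => by ring
    _ ≤ _ := by
        refine Finset.sum_le_sum fun j _ => mul_le_mul_of_nonneg_left ?_ (Nat.cast_nonneg _)
        exact mul_le_mul (hC j x hx) (hC' _ x hx) (by positivity)
          (le_trans (by positivity) (hC j x hx))

end DecaysOutside

theorem hasDerivAt_ofReal_zpow (k : ℤ) {x : ℝ} (hx : x ≠ 0) :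
    HasDerivAt (fun x : ℝ => (x : ℂ) ^ k) (k * (x : ℂ) ^ (k - 1)) x :=
  (hasDerivAt_zpow k (x : ℂ) (Or.inl (by exact_mod_cast hx))).comp_ofReal

theorem decaysOutside_zpow (k : ℤ) : DecaysOutside (-k) fun x : ℝ => (x : ℂ) ^ k := by
  have hs : ∀ x ∈ outside, ∀ k : ℤ, ContDiffAt ℝ ∞ (fun x : ℝ => (x : ℂ) ^ k) x := by
    intro x hx k
    have h0 : (x : ℂ) ≠ 0 := by exact_mod_cast ne_zero_of_mem_outside hx
    have h1 : ContDiffAt ℝ ∞ (fun x : ℝ => (x : ℂ)) x := Complex.ofRealCLM.contDiff.contDiffAt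
    cases k with
    | ofNat n => simpa using h1.pow n
    | negSucc n => simp only [zpow_negSucc]; exact (h1.pow (n + 1)).inv (pow_ne_zero _ h0)
  refine ⟨fun x hx => hs x hx k, fun i => ?_⟩
  induction i generalizing k with
  | zero =>
    refine ⟨1, fun x hx => ?_⟩
    have h0 : |x| ≠ 0 := abs_ne_zero.mpr (ne_zero_of_mem_outside hx)
    rw [iteratedDeriv_zero, norm_zpow, Complex.norm_real, Real.norm_eq_abs, ← zpow_add₀ h0]
    simp
  | succ i ih =>
    obtain ⟨C, hC⟩ := ih (k - 1)
    refine ⟨|(k : ℝ)| * C, fun x hx => ?_⟩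
    have he : deriv (fun x : ℝ => (x : ℂ) ^ k) =ᶠ[𝓝 x]
        fun x : ℝ => (k : ℂ) * (x : ℂ) ^ (k - 1) :=
      (isOpen_outside.eventually_mem hx).mono fun y hy =>
        (hasDerivAt_ofReal_zpow k (ne_zero_of_mem_outside hy)).deriv
    have h1 : 1 ≤ |x| := one_le_abs_of_mem_outside hx
    have h2 : |x| ^ (-k) ≤ |x| ^ (-(k - 1)) := zpow_le_zpow_right₀ h1 (by lia)
    rw [iteratedDeriv_succ', he.iteratedDeriv_eq, iteratedDeriv_const_mul_field, norm_mul,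
      Complex.norm_intCast]
    calc _ = |(k : ℝ)| * (|x| ^ (-k) *
          ‖iteratedDeriv i (fun x : ℝ => (x : ℂ) ^ (k - 1)) x‖) := by ring
      _ ≤ |(k : ℝ)| * (|x| ^ (-(k - 1)) *
          ‖iteratedDeriv i (fun x : ℝ => (x : ℂ) ^ (k - 1)) x‖) := by gcongr
      _ ≤ _ := by gcongr; exact hC x hx

theorem DecaysOutside.circleDeriv {M : ℤ} {h : ℝ → ℂ} (hh : DecaysOutside M h) :
    DecaysOutside (M - 2) (circleDeriv h) := by
  have h1 : DecaysOutside (-2) fun x : ℝ => (2⁻¹ : ℂ) * (x : ℂ) ^ (0 : ℤ) + 2⁻¹ * (x : ℂ) ^ (2 : ℤ) :=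
    (((decaysOutside_zpow 0).mono (by lia)).const_mul 2⁻¹).add ((decaysOutside_zpow 2).const_mul 2⁻¹)
  refine ((hh.deriv.mul h1).mono (M' := M - 2) (by lia)).congr fun x _ => ?_
  simp only [SmoothCalculus.circleDeriv, Pi.mul_apply, zpow_ofNat]
  push_cast; ring

/-- `h` has an asymptotic expansion in powers of `1 / x` that may be differentiated term by term. -/
def HasExpansion (h : ℝ → ℂ) : Prop :=
  ContDiff ℝ ∞ h ∧ ∀ M : ℤ, ∃ p : Polynomial ℂ,
    DecaysOutside M fun x => h x - p.eval (x : ℂ)⁻¹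

theorem MemE.hasExpansion {f : ℝ → ℂ} (hf : MemE f) : HasExpansion f := by
  obtain ⟨hs, a, ha⟩ := hf
  refine ⟨hs, fun M => ?_⟩
  set N := M.toNat
  set r : ℝ → ℂ := fun t : ℝ => (t : ℂ) ^ (N + 1) *
        (f t - ∑ k ∈ Finset.range (N + 1), a k * ((t : ℂ) ^ k)⁻¹) with hr
  have hinv : ∀ x ∈ outside, ∀ k : ℕ, ContDiffAt ℝ ∞ (fun t : ℝ => ((t : ℂ) ^ k)⁻¹) x := by
    intro x hx k
    have h0 : (x : ℂ) ≠ 0 := by exact_mod_cast ne_zero_of_mem_outside hx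
    have h1 : ContDiffAt ℝ ∞ (fun x : ℝ => (x : ℂ)) x := Complex.ofRealCLM.contDiff.contDiffAt
    exact (h1.pow k).inv (pow_ne_zero _ h0)
  have hD : DecaysOutside 0 r := by
    refine ⟨fun x hx => ?_, fun i => ?_⟩
    · have h1 : ContDiffAt ℝ ∞ (fun x : ℝ => (x : ℂ)) x := Complex.ofRealCLM.contDiff.contDiffAt
      exact (h1.pow _).mul (hs.contDiffAt.sub
        (ContDiffAt.sum fun k _ => contDiffAt_const.mul (hinv x hx k)))
    · obtain ⟨C, hC⟩ := ha N i
      exact ⟨C, fun x hx => by rw [zpow_zero, one_mul]; exact hC x hx⟩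
  refine ⟨∑ k ∈ Finset.range (N + 1), Polynomial.C (a k) * Polynomial.X ^ k,
    (((decaysOutside_zpow (-(N + 1 : ℤ))).mul hD).congr fun x hx => ?_).mono
      (M' := M) (by have := Int.self_le_toNat M; lia)⟩
  have h0 : (x : ℂ) ≠ 0 := by exact_mod_cast ne_zero_of_mem_outside hx
  simp only [Polynomial.eval_finsetSum, Polynomial.eval_mul, Polynomial.eval_C,
    Polynomial.eval_pow, Polynomial.eval_X, Pi.mul_apply, hr, inv_pow]
  rw [← mul_assoc, zpow_neg, show ((N : ℤ) + 1) = ((N + 1 : ℕ) : ℤ) by push_cast; rfl,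
    zpow_natCast, inv_mul_cancel₀ (pow_ne_zero _ h0), one_mul]

theorem HasExpansion.circleDeriv {h : ℝ → ℂ} (hh : HasExpansion h) :
    HasExpansion (circleDeriv h) := by
  refine ⟨contDiff_circleDeriv hh.1, fun M => ?_⟩
  obtain ⟨p, hp⟩ := hh.2 (M + 2)
  have hp' := hp.circleDeriv
  rw [add_sub_cancel_right] at hp'
  refine ⟨-(Polynomial.C (1 / 2) * (1 + Polynomial.X ^ 2)) * p.derivative,
    hp'.congr fun x hx => ?_⟩
  have hx0 := ne_zero_of_mem_outside hx
  have h0 : (x : ℂ) ≠ 0 := by exact_mod_cast hx0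
  have h1 : HasDerivAt h (deriv h x) x :=
    ((hh.1.differentiable (by simp)).differentiableAt).hasDerivAt
  have h2 : HasDerivAt (fun x : ℝ => p.eval (x : ℂ)⁻¹)
      (p.derivative.eval (x : ℂ)⁻¹ * -((x : ℂ) ^ 2)⁻¹) x :=
    ((p.hasDerivAt _).comp (x : ℂ) (hasDerivAt_inv h0)).comp_ofReal
  simp only [SmoothCalculus.circleDeriv, (h1.fun_sub h2).deriv, Polynomial.eval_mul,
    Polynomial.eval_neg, Polynomial.eval_C, Polynomial.eval_add, Polynomial.eval_pow,
    Polynomial.eval_X, Polynomial.eval_one]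
  push_cast
  field_simp
  ring

theorem HasExpansion.exists_limit {h : ℝ → ℂ} (hh : HasExpansion h) :
    ∃ c, Tendsto h (cocompact ℝ) (𝓝 c) := by
  obtain ⟨p, -, hp⟩ := hh.2 1
  obtain ⟨C, hC⟩ := hp 0
  refine ⟨p.eval 0, ?_⟩
  have hinv : Tendsto (fun x : ℝ => (x : ℂ)⁻¹) (cocompact ℝ) (𝓝 0) := by
    have h1 : Tendsto (fun x : ℝ => ‖x‖⁻¹) (cocompact ℝ) (𝓝 0) :=
      tendsto_norm_cocompact_atTop.inv_tendsto_atTop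
    refine squeeze_zero_norm (fun x => le_of_eq ?_) h1
    rw [norm_inv, Complex.norm_real]
  have h1 : Tendsto (fun x : ℝ => p.eval (x : ℂ)⁻¹) (cocompact ℝ) (𝓝 (p.eval 0)) :=
    (p.continuous.tendsto 0).comp hinv
  have h2 : Tendsto (fun x : ℝ => h x - p.eval (x : ℂ)⁻¹) (cocompact ℝ) (𝓝 0) := by
    have h3 : Tendsto (fun x : ℝ => C * ‖(x : ℂ)⁻¹‖) (cocompact ℝ) (𝓝 0) := by
      have := hinv.norm.const_mul C
      rwa [norm_zero, mul_zero] at this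
    refine squeeze_zero_norm' ?_ h3
    have h4 : ∀ᶠ x : ℝ in cocompact ℝ, 1 < |x| :=
      (tendsto_norm_cocompact_atTop (E := ℝ)).eventually_gt_atTop 1
    filter_upwards [h4] with x hx
    have h5 := hC x hx
    rw [zpow_one, iteratedDeriv_zero] at h5
    have h6 : 0 < |x| := by linarith
    rw [norm_inv, Complex.norm_real, Real.norm_eq_abs, ← div_eq_mul_inv, le_div_iff₀ h6]
    linarith
  have h3 := h2.add h1
  simp only [sub_add_cancel, zero_add] at h3
  exact h3

/-- Functions in `𝓔` extend smoothly to the circle `ℝ ∪ {∞}`. -/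
theorem MemE.isCircleSmooth {f : ℝ → ℂ} (hf : MemE f) : IsCircleSmooth f := by
  intro m
  have h : ∀ j, HasExpansion (circleDeriv^[j] f) := by
    intro j
    induction j with
    | zero => exact hf.hasExpansion
    | succ j ih => rw [Function.iterate_succ_apply']; exact ih.circleDeriv
  exact ⟨hf.1, fun j _ => (h j).exists_limit⟩

/-! ### Cauchy transforms of flat densities -/

/-- `φ` is measurable and vanishes to infinite order on the real line and at infinity. -/
structure IsFlatDensity (φ : ℂ → ℂ) : Prop where
  aestronglyMeasurable : AEStronglyMeasurable φ volume
  bound : ∀ N₀ N₁ : ℕ, ∃ C : ℝ, ∀ᵐ z : ℂ, ‖φ z‖ ≤ C * (bracket z ^ N₁)⁻¹ * |z.im| ^ N₀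

namespace IsFlatDensity

variable {φ : ℂ → ℂ}

theorem mul_pow (hφ : IsFlatDensity φ) (n : ℕ) : IsFlatDensity fun w => φ w * w ^ n := by
  refine ⟨hφ.1.mul (by fun_prop), fun N₀ N₁ => ?_⟩
  obtain ⟨C, hC⟩ := hφ.2 N₀ (N₁ + n)
  refine ⟨C, hC.mono fun z hz => ?_⟩
  have h0 := bracket_pos z
  rw [norm_mul, norm_pow]
  calc ‖φ z‖ * ‖z‖ ^ n ≤ (C * (bracket z ^ (N₁ + n))⁻¹ * |z.im| ^ N₀) * bracket z ^ n := by
        have h1 := norm_le_bracket z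
        exact mul_le_mul hz (by gcongr) (by positivity) ((norm_nonneg _).trans hz)
    _ = _ := by rw [pow_add]; field_simp

theorem integrable_mul_axisWeight_pow (hφ : IsFlatDensity φ) (m : ℕ) :
    Integrable fun w => ‖φ w‖ * axisWeight w ^ m := by
  obtain ⟨C, -, hC⟩ := exists_mul_axisWeight_pow_le hφ.2 m 3
  have hi : Integrable fun w : ℂ => C * (bracket w ^ 3)⁻¹ := by
    refine ((integrable_bracket_rpow (s := 1) one_pos).const_mul C).congr
      (Eventually.of_forall fun z => ?_)
    simp only
    rw [show (-2 - 1 : ℝ) = -((3 : ℕ) : ℝ) by norm_num, Real.rpow_neg (bracket_pos z).le,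
      Real.rpow_natCast]
  refine hi.mono' (hφ.1.norm.mul (measurable_axisWeight.pow_const m).aestronglyMeasurable)
    (hC.mono fun z hz => ?_)
  have := axisWeight_pos z
  rwa [Real.norm_of_nonneg (by positivity)]

theorem norm_mul_inv_pow_le (w : ℂ) (x : ℝ) (k : ℕ) (h0 : φ w = 0 ∨ w.im ≠ 0) :
    ‖φ w * ((x : ℂ) - w)⁻¹ ^ k‖ ≤ ‖φ w‖ * axisWeight w ^ k := by
  rcases h0 with h0 | h0
  · simp [h0]
  · rw [norm_mul, norm_pow]
    have := (norm_inv_ofReal_sub_le h0 x).trans (inv_abs_im_le_axisWeight w)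
    gcongr

theorem ae_eq_zero_or (hφ : IsFlatDensity φ) : ∀ᵐ w, φ w = 0 ∨ w.im ≠ 0 := by
  obtain ⟨C, hC⟩ := hφ.2 1 0
  refine hC.mono fun w hw => ?_
  by_cases h : w.im = 0
  · left
    simpa [h] using hw
  · exact Or.inr h

theorem integrable_mul_inv_pow (hφ : IsFlatDensity φ) (k : ℕ) (x : ℝ) :
    Integrable fun w => φ w * ((x : ℂ) - w)⁻¹ ^ k := by
  refine (hφ.integrable_mul_axisWeight_pow k).mono' (hφ.1.mul (by fun_prop)) ?_
  exact hφ.ae_eq_zero_or.mono fun w hw => norm_mul_inv_pow_le w x k hw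

theorem hasDerivAt_integral (hφ : IsFlatDensity φ) (k : ℕ) (x : ℝ) :
    HasDerivAt (fun x : ℝ => ∫ w, φ w * ((x : ℂ) - w)⁻¹ ^ k)
      (-(k : ℂ) * ∫ w, φ w * ((x : ℂ) - w)⁻¹ ^ (k + 1)) x := by
  rw [← integral_const_mul]
  refine (hasDerivAt_integral_of_dominated_loc_of_deriv_le
    (bound := fun w => (k : ℝ) * (‖φ w‖ * axisWeight w ^ (k + 1)))
    (F' := fun x w => -(k : ℂ) * (φ w * ((x : ℂ) - w)⁻¹ ^ (k + 1))) univ_mem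
    (Eventually.of_forall fun y => (hφ.integrable_mul_inv_pow k y).1)
    (hφ.integrable_mul_inv_pow k x)
    (((hφ.integrable_mul_inv_pow (k + 1) x).1).const_mul _) ?_
    ((hφ.integrable_mul_axisWeight_pow (k + 1)).const_mul _) ?_).2
  · filter_upwards [hφ.ae_eq_zero_or] with w hw y _
    rw [norm_mul, norm_neg, RCLike.norm_natCast]
    exact mul_le_mul_of_nonneg_left (norm_mul_inv_pow_le w y (k + 1) hw) (Nat.cast_nonneg k)
  · filter_upwards [hφ.ae_eq_zero_or] with w hw y _
    rcases hw with hw | hw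
    · simpa [hw] using hasDerivAt_const y (0 : ℂ)
    · cases k with
      | zero => simpa using hasDerivAt_const y (φ w)
      | succ k =>
        refine (((hasDerivAt_inv_ofReal_sub hw y).fun_pow (k + 1)).const_mul (φ w)).congr_deriv ?_
        rw [Nat.add_sub_cancel]
        ring

theorem iteratedDeriv_integral (hφ : IsFlatDensity φ) (j : ℕ) :
    iteratedDeriv j (fun x : ℝ => ∫ w, φ w * ((x : ℂ) - w)⁻¹) =
      fun x : ℝ => (-1) ^ j * (j.factorial : ℂ) * ∫ w, φ w * ((x : ℂ) - w)⁻¹ ^ (j + 1) := by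
  induction j with
  | zero => simp
  | succ j ih =>
    rw [iteratedDeriv_succ, ih]
    ext x
    rw [((hφ.hasDerivAt_integral (j + 1) x).const_mul _).deriv, Nat.factorial_succ]
    push_cast; ring

theorem contDiff_integral (hφ : IsFlatDensity φ) :
    ContDiff ℝ ∞ fun x : ℝ => ∫ w, φ w * ((x : ℂ) - w)⁻¹ := by
  refine contDiff_of_differentiable_iteratedDeriv fun m _ => ?_
  rw [hφ.iteratedDeriv_integral]
  exact fun x => ((hφ.hasDerivAt_integral (m + 1) x).const_mul _).differentiableAt

theorem exists_norm_iteratedDeriv_integral_le (hφ : IsFlatDensity φ) (j : ℕ) :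
    ∃ C : ℝ, ∀ x, ‖iteratedDeriv j (fun x : ℝ => ∫ w, φ w * ((x : ℂ) - w)⁻¹) x‖ ≤ C := by
  refine ⟨j.factorial * ∫ w, ‖φ w‖ * axisWeight w ^ (j + 1), fun x => ?_⟩
  rw [hφ.iteratedDeriv_integral]
  simp only [norm_mul, norm_pow, norm_neg, norm_one, one_pow, one_mul, RCLike.norm_natCast]
  refine mul_le_mul_of_nonneg_left ?_ (Nat.cast_nonneg _)
  refine norm_integral_le_of_norm_le (hφ.integrable_mul_axisWeight_pow _) ?_
  exact hφ.ae_eq_zero_or.mono fun w hw => norm_mul_inv_pow_le w x _ hw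

end IsFlatDensity

/-- Expansion of the Cauchy kernel in powers of `1 / x`. -/
theorem IsFlatDensity.pow_mul_integral {φ : ℂ → ℂ} (hφ : IsFlatDensity φ) (N : ℕ) {x : ℝ}
    (hx : x ≠ 0) :
    (x : ℂ) ^ N * ((∫ w, φ w * ((x : ℂ) - w)⁻¹) -
        ∑ k ∈ Finset.range N, (∫ w, φ w * w ^ k) * ((x : ℂ) ^ (k + 1))⁻¹) =
      ∫ w, φ w * w ^ N * ((x : ℂ) - w)⁻¹ := by
  have h0 : (x : ℂ) ≠ 0 := by exact_mod_cast hx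
  induction N with
  | zero => simp
  | succ N ih =>
    have hi : Integrable fun w => φ w * w ^ N := by
      simpa using (hφ.mul_pow N).integrable_mul_inv_pow 0 x
    have hi' : Integrable fun w => φ w * w ^ (N + 1) * ((x : ℂ) - w)⁻¹ := by
      simpa using (hφ.mul_pow (N + 1)).integrable_mul_inv_pow 1 x
    have key : x * ∫ w, φ w * w ^ N * ((x : ℂ) - w)⁻¹ =
        (∫ w, φ w * w ^ N) + ∫ w, φ w * w ^ (N + 1) * ((x : ℂ) - w)⁻¹ := by
      rw [← integral_const_mul, ← integral_add hi hi']
      refine integral_congr_ae (hφ.ae_eq_zero_or.mono fun w hw => ?_)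
      rcases hw with hw | hw
      · simp [hw]
      · have := ofReal_sub_ne_zero hw x
        simp only
        field_simp
        ring
    rw [Finset.sum_range_succ, ← sub_sub, mul_sub, pow_succ', mul_assoc, ih, key]
    field_simp
    ring

/-- The restriction to the real line of the Cauchy transform of a flat density is in `𝓔`: the
geometric expansion of `1 / (x - w)` gives the asymptotic expansion, and its remainder is again
the Cauchy transform of a flat density. -/
theorem IsFlatDensity.memE {φ : ℂ → ℂ} (hφ : IsFlatDensity φ) {h : ℝ → ℂ} {c : ℂ}
    (hh : ∀ x : ℝ, h x = c + cauchyTransform φ x) : MemE h := by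
  obtain rfl : h = fun x : ℝ => c + cauchyTransform φ x := funext hh
  obtain ⟨a, ha0, ha⟩ : ∃ a : ℕ → ℂ, a 0 = c ∧
      ∀ k, a (k + 1) = (Real.pi : ℂ)⁻¹ * ∫ w, φ w * w ^ k :=
    ⟨fun k => Nat.casesOn k c fun k => (Real.pi : ℂ)⁻¹ * ∫ w, φ w * w ^ k, rfl, fun _ => rfl⟩
  refine ⟨contDiff_const.add (contDiff_const.mul hφ.contDiff_integral), a, fun N j => ?_⟩
  set J : ℝ → ℂ := fun x => ∫ w, φ w * w ^ (N + 1) * ((x : ℂ) - w)⁻¹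
  set m : ℂ := ∫ w, φ w * w ^ N with hm
  obtain ⟨C, hC⟩ := (hφ.mul_pow (N + 1)).exists_norm_iteratedDeriv_integral_le j
  refine ⟨‖(Real.pi : ℂ)⁻¹‖ * (‖m‖ + C), fun x hx => ?_⟩
  have he : (fun t : ℝ => (t : ℂ) ^ (N + 1) * (c + cauchyTransform φ t -
      ∑ k ∈ Finset.range (N + 1), a k * ((t : ℂ) ^ k)⁻¹)) =ᶠ[𝓝 x] fun t => (Real.pi : ℂ)⁻¹ * (m + J t) := by
    refine (isOpen_outside.eventually_mem hx).mono fun t ht => ?_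
    have h0 : (t : ℂ) ≠ 0 := by exact_mod_cast ne_zero_of_mem_outside ht
    have h1 := hφ.pow_mul_integral (N + 1) (ne_zero_of_mem_outside ht)
    simp only [J]
    rw [← h1, Finset.sum_range_succ' _ N, Finset.sum_range_succ _ N, ← hm]
    simp only [cauchyTransform, ha0, ha, mul_assoc, ← Finset.mul_sum]
    set S := ∑ k ∈ Finset.range N, (∫ w, φ w * w ^ k) * ((t : ℂ) ^ (k + 1))⁻¹
    rw [pow_zero, inv_one, mul_one, mul_sub _ _ (S + _), mul_add _ S, mul_left_comm _ m,
      mul_inv_cancel₀ (pow_ne_zero _ h0)]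
    ring
  rw [he.iteratedDeriv_eq, iteratedDeriv_const_mul_field, norm_mul]
  refine mul_le_mul_of_nonneg_left ?_ (norm_nonneg _)
  have hJ := hC x
  cases j with
  | zero => exact (norm_add_le _ _).trans (add_le_add le_rfl hJ)
  | succ j =>
    have hd : deriv (fun t => m + J t) = deriv J := funext fun y => deriv_const_add m
    rw [iteratedDeriv_succ', hd, ← iteratedDeriv_succ']
    exact hJ.trans (le_add_of_nonneg_left (norm_nonneg _))

/-! ### Almost holomorphic extensions of smooth functions on the circle -/

/-- The quantity `Im z / (1 + |z|²)`, which measures the distance to the circle `ℝ ∪ {∞}` in the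
Riemann sphere; it lies in `[-1/2, 1/2]`. -/
def sphereHeight (z : ℂ) : ℝ := z.im / (1 + Complex.normSq z)

/-- The meromorphic extension `(1 + i z) / (1 - i z)` of `circleChar`. -/
def circleCharExt (z : ℂ) : ℂ := (1 + Complex.I * z) / (1 - Complex.I * z)

theorem circleCharExt_ofReal (x : ℝ) : circleCharExt x = circleChar x := by
  simp only [circleCharExt, circleChar, mul_comm Complex.I]

theorem one_add_normSq (z : ℂ) : 1 + Complex.normSq z = bracket z ^ 2 := by
  rw [bracket_sq, Complex.normSq_eq_norm_sq]

theorem sphereHeight_eq (z : ℂ) : sphereHeight z = z.im / bracket z ^ 2 := by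
  rw [sphereHeight, one_add_normSq]

theorem abs_sphereHeight (z : ℂ) : |sphereHeight z| = |z.im| / bracket z ^ 2 := by
  rw [sphereHeight_eq, abs_div, abs_of_pos (pow_pos (bracket_pos z) 2)]

theorem sphereHeight_ofReal (x : ℝ) : sphereHeight x = 0 := by simp [sphereHeight]

theorem normSq_one_sub (z : ℂ) :
    Complex.normSq (1 - Complex.I * z) = (1 + 2 * sphereHeight z) * bracket z ^ 2 := by
  have h := one_add_normSq z
  have h0 := bracket_pos z
  rw [sphereHeight_eq]
  have h1 : Complex.normSq (1 - Complex.I * z) = 1 + Complex.normSq z + 2 * z.im := by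
    simp [Complex.normSq_apply]; ring
  rw [h1, h]; field_simp

theorem normSq_one_add (z : ℂ) :
    Complex.normSq (1 + Complex.I * z) = (1 - 2 * sphereHeight z) * bracket z ^ 2 := by
  have h := one_add_normSq z
  have h0 := bracket_pos z
  rw [sphereHeight_eq]
  have h1 : Complex.normSq (1 + Complex.I * z) = 1 + Complex.normSq z - 2 * z.im := by
    simp [Complex.normSq_apply]; ring
  rw [h1, h]; field_simp

theorem one_sub_ne_zero_of_sphereHeight {z : ℂ} (hz : |sphereHeight z| < 1 / 2) :
    1 - Complex.I * z ≠ 0 := by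
  rw [← Complex.normSq_pos, normSq_one_sub]
  have := bracket_pos z
  have := (abs_lt.mp hz).1
  have : 0 < 1 + 2 * sphereHeight z := by linarith
  positivity

theorem one_add_ne_zero_of_sphereHeight {z : ℂ} (hz : |sphereHeight z| < 1 / 2) :
    1 + Complex.I * z ≠ 0 := by
  rw [← Complex.normSq_pos, normSq_one_add]
  have := bracket_pos z
  have := (abs_lt.mp hz).2
  have : 0 < 1 - 2 * sphereHeight z := by linarith
  positivity

theorem one_sub_div_one_add_le_exp {t : ℝ} (ht : |t| ≤ 1 / 4) :
    (1 - 2 * t) / (1 + 2 * t) ≤ Real.exp (8 * |t|) := by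
  have h1 := abs_le.mp ht
  rw [div_le_iff₀ (by linarith)]
  have h2 := Real.add_one_le_exp (8 * |t|)
  have h3 := neg_abs_le t
  have h4 := abs_nonneg t
  nlinarith [mul_nonneg h4 h4]

theorem norm_circleCharExt_le {z : ℂ} (hz : |sphereHeight z| ≤ 1 / 4) :
    ‖circleCharExt z‖ ≤ Real.exp (4 * |sphereHeight z|) ∧
      ‖(circleCharExt z)⁻¹‖ ≤ Real.exp (4 * |sphereHeight z|) := by
  have h0 := bracket_pos z
  have he : Real.exp (8 * |sphereHeight z|) = Real.exp (4 * |sphereHeight z|) ^ 2 := by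
    rw [← Real.exp_nat_mul]; congr 1; push_cast; ring
  have h1 := one_sub_div_one_add_le_exp hz
  have h2 := one_sub_div_one_add_le_exp (t := -sphereHeight z) (by rwa [abs_neg])
  rw [abs_neg, mul_neg, sub_neg_eq_add, ← sub_eq_add_neg] at h2
  constructor
  · refine (sq_le_sq₀ (norm_nonneg _) (Real.exp_pos _).le).mp ?_
    rw [← he, ← Complex.normSq_eq_norm_sq, circleCharExt, Complex.normSq_div, normSq_one_add,
      normSq_one_sub, mul_div_mul_right _ _ (by positivity)]
    exact h1
  · refine (sq_le_sq₀ (norm_nonneg _) (Real.exp_pos _).le).mp ?_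
    rw [← he, ← Complex.normSq_eq_norm_sq, circleCharExt, inv_div, Complex.normSq_div,
      normSq_one_add, normSq_one_sub, mul_div_mul_right _ _ (by positivity)]
    exact h2

/-- At heights at most `1 / (4 |n|)` the `n`-th monomial is bounded independently of `n`. -/
theorem norm_circleCharExt_zpow_le {z : ℂ} {n : ℤ} (hn : n ≠ 0)
    (hz : |(n : ℝ) * sphereHeight z| ≤ 1 / 4) : ‖circleCharExt z ^ n‖ ≤ Real.exp 1 := by
  have hn1 : (1 : ℝ) ≤ |(n : ℝ)| := by exact_mod_cast Int.one_le_abs hn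
  rw [abs_mul] at hz
  have hz' : |sphereHeight z| ≤ 1 / 4 := by nlinarith [abs_nonneg (sphereHeight z)]
  obtain ⟨h1, h2⟩ := norm_circleCharExt_le hz'
  have key : ∀ (m : ℕ) (a : ℂ), ‖a‖ ≤ Real.exp (4 * |sphereHeight z|) → (m : ℝ) = |(n : ℝ)| →
      ‖a ^ m‖ ≤ Real.exp 1 := by
    intro m a ha hm
    rw [norm_pow]
    refine (pow_le_pow_left₀ (norm_nonneg a) ha m).trans ?_
    rw [← Real.exp_nat_mul, hm]
    exact Real.exp_le_exp.mpr (by linarith)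
  obtain ⟨m, rfl | rfl⟩ := n.eq_nat_or_neg
  · rw [zpow_natCast]; exact key m _ h1 (by simp)
  · rw [zpow_neg, zpow_natCast, ← inv_pow]; exact key m _ h2 (by simp)

/-- The derivative of `sphereHeight`. -/
def sphereHeightDeriv (z : ℂ) : ℂ →L[ℝ] ℝ :=
  (bracket z ^ 2)⁻¹ • Complex.imCLM -
    (z.im * 2 * ((bracket z ^ 2)⁻¹) ^ 2) • innerSL ℝ z

theorem hasFDerivAt_sphereHeight (z : ℂ) :
    HasFDerivAt sphereHeight (sphereHeightDeriv z) z := by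
  have h0 := bracket_pos z
  have h1 : HasFDerivAt (fun z : ℂ => 1 + Complex.normSq z) (2 • innerSL ℝ z) z := by
    have : (fun z : ℂ => 1 + Complex.normSq z) = fun z => 1 + ‖z‖ ^ 2 := by
      ext z; rw [Complex.normSq_eq_norm_sq]
    rw [this]
    exact (hasStrictFDerivAt_norm_sq z).hasFDerivAt.const_add 1
  have h2 : HasFDerivAt (fun z : ℂ => z.im) Complex.imCLM z := Complex.imCLM.hasFDerivAt
  have h3 : 1 + Complex.normSq z ≠ 0 := by rw [one_add_normSq]; positivity
  refine ((h2.fun_mul ((hasDerivAt_inv h3).comp_hasFDerivAt z h1)).congr_fderiv ?_)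
  rw [one_add_normSq, sphereHeightDeriv]
  ext v
  simp
  rw [one_add_normSq]
  ring

theorem norm_sphereHeightDeriv_le (z : ℂ) : ‖sphereHeightDeriv z‖ ≤ 3 * (bracket z ^ 2)⁻¹ := by
  have h0 := bracket_pos z
  refine (norm_sub_le _ _).trans ?_
  rw [norm_smul, norm_smul, innerSL_apply_norm, Complex.imCLM_norm, mul_one, norm_mul, norm_mul,
    Real.norm_of_nonneg (r := (bracket z ^ 2)⁻¹) (by positivity), Real.norm_eq_abs z.im,
    Real.norm_of_nonneg (r := ((bracket z ^ 2)⁻¹) ^ 2) (by positivity),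
    Real.norm_of_nonneg two_pos.le]
  have h1 : |z.im| * ‖z‖ ≤ bracket z ^ 2 := by
    rw [sq]
    exact mul_le_mul (abs_im_le_bracket z) (norm_le_bracket z) (norm_nonneg z) h0.le
  have h2 : |z.im| * 2 * ((bracket z ^ 2)⁻¹) ^ 2 * ‖z‖ =
      2 * (bracket z ^ 2)⁻¹ * ((bracket z ^ 2)⁻¹ * (|z.im| * ‖z‖)) := by ring
  have h3 : (bracket z ^ 2)⁻¹ * (|z.im| * ‖z‖) ≤ 1 := by
    rw [inv_mul_le_iff₀ (by positivity)]; linarith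
  rw [h2]
  have h4 : 0 < (bracket z ^ 2)⁻¹ := by positivity
  nlinarith

/-- A smooth cutoff function on the line, equal to `1` near `0`. -/
def cutoff : ContDiffBump (0 : ℝ) := ⟨1 / 8, 1 / 4, by norm_num, by norm_num⟩

/-- The derivative of the cutoff vanishes near `0`, hence to every order. -/
theorem exists_deriv_cutoff_le : ∃ C : ℝ, 0 ≤ C ∧ ∀ (N : ℕ) (t : ℝ),
    |deriv cutoff t| ≤ C * (8 * |t|) ^ N := by
  have hs : ContDiff ℝ ∞ cutoff := cutoff.contDiff
  obtain ⟨C, hC⟩ := (cutoff.hasCompactSupport.deriv).exists_bound_of_continuous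
    (hs.continuous_deriv (by simp))
  refine ⟨C, (norm_nonneg _).trans (hC 0), fun N t => ?_⟩
  have hC0 := (norm_nonneg _).trans (hC 0)
  by_cases ht : |t| < 1 / 8
  · have h1 : cutoff =ᶠ[𝓝 t] fun _ => 1 := by
      filter_upwards [isOpen_lt continuous_abs continuous_const |>.mem_nhds ht] with s hs
      exact cutoff.one_of_mem_closedBall (by
        rw [Metric.mem_closedBall, Real.dist_eq, sub_zero]; exact le_of_lt hs)
    rw [h1.deriv_eq, deriv_const, abs_zero]; positivity
  · push Not at ht
    have h1 : 1 ≤ (8 * |t|) ^ N := one_le_pow₀ (by linarith)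
    have h2 := hC t
    rw [Real.norm_eq_abs] at h2
    nlinarith

/-- The extension of the `n`-th trigonometric monomial from the circle to the Riemann sphere, cut
off at height `1 / |n|`. -/
def monomialExt (n : ℤ) (z : ℂ) : ℂ := circleCharExt z ^ n * (cutoff (n * sphereHeight z) : ℝ)

theorem continuous_sphereHeight : Continuous sphereHeight :=
  continuous_iff_continuousAt.mpr fun z => (hasFDerivAt_sphereHeight z).continuousAt

theorem monomialExt_eventuallyEq_zero {n : ℤ} {z : ℂ} (hz : 1 / 4 < |(n : ℝ) * sphereHeight z|) :
    monomialExt n =ᶠ[𝓝 z] fun _ => 0 := by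
  have hc : Continuous fun z => |(n : ℝ) * sphereHeight z| :=
    (continuous_const.mul continuous_sphereHeight).abs
  filter_upwards [(isOpen_lt continuous_const hc).mem_nhds hz] with w hw
  have h1 : cutoff (n * sphereHeight w) = 0 := cutoff.zero_of_le_dist (by
    rw [Real.dist_eq, sub_zero]; exact le_of_lt hw)
  simp [monomialExt, h1]

theorem monomialExt_zero : monomialExt 0 = fun _ => 1 := by
  ext z
  have h1 : cutoff 0 = 1 := cutoff.one_of_mem_closedBall (by
    rw [Metric.mem_closedBall, dist_self]; exact cutoff.rIn_pos.le)
  simp [monomialExt, h1]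

theorem monomialExt_ofReal (n : ℤ) (x : ℝ) : monomialExt n x = circleChar x ^ n := by
  have h1 : cutoff 0 = 1 := cutoff.one_of_mem_closedBall (by
    rw [Metric.mem_closedBall, dist_self]; exact cutoff.rIn_pos.le)
  simp [monomialExt, circleCharExt_ofReal, sphereHeight_ofReal, h1]

theorem norm_monomialExt_le (n : ℤ) (z : ℂ) : ‖monomialExt n z‖ ≤ Real.exp 1 := by
  have h1 : (1 : ℝ) ≤ Real.exp 1 := Real.one_le_exp zero_le_one
  rcases eq_or_ne n 0 with rfl | hn
  · simp [monomialExt_zero]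
  by_cases hz : |(n : ℝ) * sphereHeight z| ≤ 1 / 4
  · rw [monomialExt, norm_mul, Complex.norm_real, Real.norm_of_nonneg cutoff.nonneg]
    exact (mul_le_of_le_one_right (norm_nonneg _) cutoff.le_one).trans
      (norm_circleCharExt_zpow_le hn hz)
  · push Not at hz
    rw [(monomialExt_eventuallyEq_zero hz).self_of_nhds]
    simp [(Real.exp_pos 1).le]

theorem hasDerivAt_circleCharExt_zpow (n : ℤ) {z : ℂ} (hz : |sphereHeight z| < 1 / 2) :
    HasDerivAt (fun z => circleCharExt z ^ n)
      (n * circleCharExt z ^ n * (2 * Complex.I / ((1 - Complex.I * z) * (1 + Complex.I * z)))) z := by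
  have h1 := one_sub_ne_zero_of_sphereHeight hz
  have h2 := one_add_ne_zero_of_sphereHeight hz
  have h3 : HasDerivAt (fun z : ℂ => Complex.I * z) Complex.I z := by
    simpa using (hasDerivAt_id z).const_mul Complex.I
  have h4 : HasDerivAt circleCharExt _ z := (h3.const_add 1).fun_div (h3.const_sub 1) h1
  have h5 : circleCharExt z ≠ 0 := div_ne_zero h2 h1
  refine ((hasDerivAt_zpow n _ (Or.inl h5)).comp z h4).congr_deriv ?_
  rw [zpow_sub_one₀ h5]
  have h6 : (circleCharExt z)⁻¹ = (1 - Complex.I * z) / (1 + Complex.I * z) := by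
    rw [circleCharExt, inv_div]
  rw [h6]
  field_simp
  ring

theorem hasFDerivAt_cutoff_sphereHeight (n : ℤ) (z : ℂ) :
    HasFDerivAt (fun z => ((cutoff (n * sphereHeight z) : ℝ) : ℂ))
      (((n : ℂ) * (deriv cutoff (n * sphereHeight z) : ℝ)) •
        (Complex.ofRealCLM.comp (sphereHeightDeriv z))) z := by
  have hs : ContDiff ℝ ∞ cutoff := cutoff.contDiff
  have h1 := ((hs.differentiable (by simp)) (n * sphereHeight z)).hasDerivAt
  have h2 := h1.comp_hasFDerivAt z ((hasFDerivAt_sphereHeight z).const_mul (n : ℝ))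
  refine (Complex.ofRealCLM.hasFDerivAt.comp z h2).congr_fderiv ?_
  ext v
  simp
  ring

theorem antiPart_add (D D' : ℂ →L[ℝ] ℂ) : antiPart (D + D') = antiPart D + antiPart D' := by
  simp only [antiPart, add_apply]; ring

theorem antiPart_smul (a : ℂ) (D : ℂ →L[ℝ] ℂ) : antiPart (a • D) = a * antiPart D := by
  simp only [antiPart, smul_apply, smul_eq_mul]; ring

theorem antiPart_one : antiPart (1 : ℂ →L[ℝ] ℂ) = 0 := by
  simp [antiPart]

/-- Where the cutoff does not vanish, the derivative of `monomialExt n` is the sum of a complex-linear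
map and of a term supported at heights comparable to `1 / |n|`. -/
theorem hasFDerivAt_monomialExt (n : ℤ) {z : ℂ} (hz : |sphereHeight z| < 1 / 2) :
    HasFDerivAt (monomialExt n)
      ((circleCharExt z ^ n * ((n : ℂ) * (deriv cutoff (n * sphereHeight z) : ℝ))) •
        (Complex.ofRealCLM.comp (sphereHeightDeriv z)) +
      ((cutoff (n * sphereHeight z) : ℝ) * (n * circleCharExt z ^ n *
        (2 * Complex.I / ((1 - Complex.I * z) * (1 + Complex.I * z))))) • (1 : ℂ →L[ℝ] ℂ)) z := by
  have h1 := (hasDerivAt_circleCharExt_zpow n hz).complexToReal_fderiv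
  refine (h1.fun_mul (hasFDerivAt_cutoff_sphereHeight n z)).congr_fderiv ?_
  rw [smul_smul, smul_smul]

theorem contDiff_sphereHeight : ContDiff ℝ ∞ sphereHeight := by
  have h1 : ContDiff ℝ ∞ (fun z : ℂ => 1 + Complex.normSq z) := by
    have : (fun z : ℂ => 1 + Complex.normSq z) = fun z => 1 + ‖z‖ ^ 2 := by
      ext z; rw [Complex.normSq_eq_norm_sq]
    rw [this]
    exact contDiff_const.add (contDiff_norm_sq ℝ)
  exact Complex.imCLM.contDiff.div h1 fun z => by
    have := Complex.normSq_nonneg z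
    positivity

theorem contDiff_monomialExt (n : ℤ) : ContDiff ℝ 1 (monomialExt n) := by
  refine contDiff_iff_contDiffAt.mpr fun z => ?_
  rcases eq_or_ne n 0 with rfl | hn
  · rw [monomialExt_zero]; exact contDiffAt_const
  have hn1 : (1 : ℝ) ≤ |(n : ℝ)| := by exact_mod_cast Int.one_le_abs hn
  by_cases hz : |sphereHeight z| < 1 / 2
  · have h1 := one_sub_ne_zero_of_sphereHeight hz
    have h2 := one_add_ne_zero_of_sphereHeight hz
    have h3 : ContDiffAt ℝ 1 (fun z : ℂ => Complex.I * z) z := contDiffAt_const.mul contDiffAt_id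
    have h4 : ContDiffAt ℝ 1 circleCharExt z :=
      (contDiffAt_const.add h3).mul ((contDiffAt_const.sub h3).inv h1)
    have h5 : circleCharExt z ≠ 0 := div_ne_zero h2 h1
    have h6 : ContDiffAt ℝ 1 (fun z => circleCharExt z ^ n) z := by
      cases n with
      | ofNat n => simp only [Int.ofNat_eq_natCast, zpow_natCast]; exact h4.pow n
      | negSucc n =>
        simp only [zpow_negSucc]; exact (h4.pow (n + 1)).inv (pow_ne_zero _ h5)
    have h7 : ContDiff ℝ 1 (fun z => ((cutoff (n * sphereHeight z) : ℝ) : ℂ)) :=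
      Complex.ofRealCLM.contDiff.comp (cutoff.contDiff.comp
        (contDiff_const.mul (contDiff_sphereHeight.of_le (by exact_mod_cast le_top))))
    exact h6.mul h7.contDiffAt
  · push Not at hz
    refine contDiffAt_const.congr_of_eventuallyEq (monomialExt_eventuallyEq_zero (n := n) ?_)
    rw [abs_mul]
    nlinarith

theorem norm_two_I_div_le {z : ℂ} (hz : |sphereHeight z| ≤ 1 / 4) :
    ‖2 * Complex.I / ((1 - Complex.I * z) * (1 + Complex.I * z))‖ ≤ 4 * (bracket z ^ 2)⁻¹ := by
  have h0 := bracket_pos z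
  have h1 := abs_le.mp hz
  have h2 : bracket z ^ 2 / 2 ≤ ‖(1 - Complex.I * z) * (1 + Complex.I * z)‖ := by
    refine (sq_le_sq₀ (by positivity) (norm_nonneg _)).mp ?_
    rw [← Complex.normSq_eq_norm_sq, map_mul, normSq_one_sub, normSq_one_add]
    have h3 : 1 / 4 ≤ (1 + 2 * sphereHeight z) * (1 - 2 * sphereHeight z) := by nlinarith
    have h4 : 0 < (bracket z ^ 2) ^ 2 := by positivity
    nlinarith
  rw [norm_div, norm_mul, Complex.norm_I, mul_one, Complex.norm_ofNat]
  calc 2 / ‖(1 - Complex.I * z) * (1 + Complex.I * z)‖ ≤ 2 / (bracket z ^ 2 / 2) := by gcongr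
    _ = _ := by field_simp; norm_num

theorem exists_fderiv_monomialExt_le : ∃ C : ℝ, 0 ≤ C ∧ ∀ (n : ℤ) (z : ℂ),
    ‖fderiv ℝ (monomialExt n) z‖ ≤ C * (1 + |(n : ℝ)|) * (bracket z ^ 2)⁻¹ ∧
    ∀ N : ℕ, ‖dbar (monomialExt n) z‖ ≤
      C * 8 ^ N * (1 + |(n : ℝ)|) ^ (N + 1) * (|z.im| / bracket z ^ 2) ^ N := by
  obtain ⟨C₀, hC₀, hcut⟩ := exists_deriv_cutoff_le
  refine ⟨Real.exp 1 * (3 * C₀ + 4), by positivity, fun n z => ?_⟩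
  have h0 := bracket_pos z
  have he := Real.exp_pos 1
  -- Both estimates are trivial where the derivative vanishes.
  have htriv : fderiv ℝ (monomialExt n) z = 0 →
      ‖fderiv ℝ (monomialExt n) z‖ ≤ Real.exp 1 * (3 * C₀ + 4) * (1 + |(n : ℝ)|) *
        (bracket z ^ 2)⁻¹ ∧ ∀ N : ℕ, ‖dbar (monomialExt n) z‖ ≤ Real.exp 1 * (3 * C₀ + 4) *
          8 ^ N * (1 + |(n : ℝ)|) ^ (N + 1) * (|z.im| / bracket z ^ 2) ^ N := by
    intro h
    refine ⟨by rw [h, norm_zero]; positivity, fun N => ?_⟩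
    rw [dbar_eq_antiPart, h]
    simp only [antiPart, zero_apply, mul_zero, add_zero, norm_zero]
    positivity
  rcases eq_or_ne n 0 with rfl | hn
  · exact htriv (by rw [monomialExt_zero]; exact fderiv_const_apply 1)
  have hn1 : (1 : ℝ) ≤ |(n : ℝ)| := by exact_mod_cast Int.one_le_abs hn
  rcases lt_or_ge (1 / 4) |(n : ℝ) * sphereHeight z| with hz | hz
  · refine htriv ?_
    rw [(monomialExt_eventuallyEq_zero hz).fderiv_eq]; exact fderiv_const_apply 0
  have hz' : |sphereHeight z| ≤ 1 / 4 := by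
    rw [abs_mul] at hz
    nlinarith [abs_nonneg (sphereHeight z)]
  have hE := norm_circleCharExt_zpow_le hn hz
  have hδ := norm_sphereHeightDeriv_le z
  have hD : ‖Complex.ofRealCLM.comp (sphereHeightDeriv z)‖ ≤ 3 * (bracket z ^ 2)⁻¹ := by
    refine (ContinuousLinearMap.opNorm_comp_le _ _).trans ?_
    rwa [Complex.ofRealCLM_norm, one_mul]
  have hq := norm_two_I_div_le hz'
  have hd := hasFDerivAt_monomialExt n (z := z) (by linarith)
  have hb : (bracket z ^ 2)⁻¹ ≤ 1 := inv_le_one_of_one_le₀ (one_le_pow₀ (one_le_bracket z))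
  rw [dbar_eq_antiPart, hd.fderiv]
  set D := Complex.ofRealCLM.comp (sphereHeightDeriv z)
  set t : ℝ := n * sphereHeight z
  constructor
  · refine (norm_add_le _ _).trans ?_
    have h1 : ‖(1 : ℂ →L[ℝ] ℂ)‖ ≤ 1 := ContinuousLinearMap.norm_id_le
    have h2 := hcut 0 t
    rw [pow_zero, mul_one] at h2
    have h3 : |cutoff t| ≤ 1 := by rw [abs_of_nonneg cutoff.nonneg]; exact cutoff.le_one
    rw [norm_smul, norm_smul]
    simp only [norm_mul, Complex.norm_intCast, Complex.norm_real, Real.norm_eq_abs] at *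
    calc _ ≤ Real.exp 1 * (|(n : ℝ)| * C₀) * (3 * (bracket z ^ 2)⁻¹) +
          1 * (|(n : ℝ)| * Real.exp 1 * (4 * (bracket z ^ 2)⁻¹)) * 1 := by gcongr
      _ = Real.exp 1 * (3 * C₀ + 4) * |(n : ℝ)| * (bracket z ^ 2)⁻¹ := by ring
      _ ≤ _ := by gcongr; linarith
  · intro N
    rw [antiPart_add, antiPart_smul, antiPart_smul, antiPart_one, mul_zero, add_zero]
    have h1 : ‖antiPart D‖ ≤ 3 := (norm_antiPart_le D).trans (hD.trans (by linarith))
    have h2 := hcut N t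
    rw [show |t| = |(n : ℝ)| * (|z.im| / bracket z ^ 2) by
      rw [abs_mul, abs_sphereHeight]] at h2
    simp only [norm_mul, Complex.norm_intCast, Complex.norm_real, Real.norm_eq_abs] at *
    calc _ ≤ Real.exp 1 * (|(n : ℝ)| * (C₀ * (8 * (|(n : ℝ)| * (|z.im| / bracket z ^ 2))) ^ N)) * 3 := by
          gcongr
      _ = Real.exp 1 * (3 * C₀) * 8 ^ N * |(n : ℝ)| ^ (N + 1) * (|z.im| / bracket z ^ 2) ^ N := by
          rw [mul_pow, mul_pow]; ring
      _ ≤ _ := by gcongr <;> linarith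

/-- A smooth function on the circle `ℝ ∪ {∞}` has an almost holomorphic extension to the Riemann
sphere, obtained by extending its Fourier modes. -/
theorem IsCircleSmooth.exists_isStrongAlmostHolExt {f : ℝ → ℂ} (hf : IsCircleSmooth f) :
    ∃ F, IsStrongAlmostHolExt f F := by
  obtain ⟨C, hC, hb⟩ := exists_fderiv_monomialExt_le
  have hcd : ∀ n : ℤ, ContDiff ℝ 1 fun z => circleCoeff f n * monomialExt n z :=
    fun n => contDiff_const.mul (contDiff_monomialExt n)
  have hfd : ∀ (n : ℤ) z, fderiv ℝ (fun z => circleCoeff f n * monomialExt n z) z =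
      circleCoeff f n • fderiv ℝ (monomialExt n) z := fun n z =>
    fderiv_const_mul ((contDiff_monomialExt n).differentiable one_ne_zero z) _
  have hs : ∀ m : ℕ, Summable fun n : ℤ => ‖circleCoeff f n‖ * (1 + |(n : ℝ)|) ^ m := fun m =>
    summable_norm_circleCoeff_mul_pow (hf (m + 2))
  have h0 : ∀ (n : ℤ) z, ‖circleCoeff f n * monomialExt n z‖ ≤
      Real.exp 1 * (‖circleCoeff f n‖ * (1 + |(n : ℝ)|) ^ 0) := fun n z => by
    rw [norm_mul, pow_zero, mul_one, mul_comm]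
    exact mul_le_mul_of_nonneg_right (norm_monomialExt_le n z) (norm_nonneg _)
  have h1' : ∀ (n : ℤ) z, ‖fderiv ℝ (fun z => circleCoeff f n * monomialExt n z) z‖ ≤
      C * (bracket z ^ 2)⁻¹ * (‖circleCoeff f n‖ * (1 + |(n : ℝ)|) ^ 1) := fun n z => by
    rw [hfd, norm_smul, pow_one]
    refine (mul_le_mul_of_nonneg_left (hb n z).1 (norm_nonneg _)).trans (le_of_eq (by ring))
  have h1 : ∀ (n : ℤ) z, ‖fderiv ℝ (fun z => circleCoeff f n * monomialExt n z) z‖ ≤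
      C * (‖circleCoeff f n‖ * (1 + |(n : ℝ)|) ^ 1) := fun n z => by
    refine (h1' n z).trans ?_
    have hb1 : (bracket z ^ 2)⁻¹ ≤ 1 := inv_le_one_of_one_le₀ (one_le_pow₀ (one_le_bracket z))
    exact mul_le_mul_of_nonneg_right (mul_le_of_le_one_right hC hb1) (by positivity)
  have hfz : ∀ z, fderiv ℝ (fun z => ∑' n : ℤ, circleCoeff f n * monomialExt n z) z =
      ∑' n : ℤ, fderiv ℝ (fun z => circleCoeff f n * monomialExt n z) z := fun z =>
    fderiv_tsum_apply ((hs 1).mul_left C) (fun n => (hcd n).differentiable one_ne_zero) h1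
      (.of_norm_bounded ((hs 0).mul_left _) fun n => h0 n 0) z
  refine ⟨fun z => ∑' n : ℤ, circleCoeff f n * monomialExt n z, ?_, fun x => ?_, fun N => ?_,
    C * ∑' n : ℤ, ‖circleCoeff f n‖ * (1 + |(n : ℝ)|) ^ 1, fun z => ?_⟩
  · refine contDiff_tsum (𝕜 := ℝ) (N := 1) (v := fun k n => if k = 0 then
      Real.exp 1 * (‖circleCoeff f n‖ * (1 + |(n : ℝ)|) ^ 0) else
      C * (‖circleCoeff f n‖ * (1 + |(n : ℝ)|) ^ 1)) hcd (fun k _ => ?_) (fun k n z hk => ?_)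
    · split_ifs
      · exact (hs 0).mul_left _
      · exact (hs 1).mul_left _
    · obtain rfl | rfl : k = 0 ∨ k = 1 := by
        have : k ≤ 1 := by exact_mod_cast hk
        lia
      · rw [norm_iteratedFDeriv_zero, if_pos rfl]; exact h0 n z
      · rw [norm_iteratedFDeriv_one, if_neg one_ne_zero]; exact h1 n z
  · simp only [monomialExt_ofReal]
    exact (hasSum_circleCoeff (hf 2) x).tsum_eq
  · refine ⟨C * 8 ^ N * ∑' n : ℤ, ‖circleCoeff f n‖ * (1 + |(n : ℝ)|) ^ (N + 1), fun z => ?_⟩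
    have hsum : Summable fun n : ℤ => fderiv ℝ (fun z => circleCoeff f n * monomialExt n z) z :=
      .of_norm_bounded ((hs 1).mul_left C) fun n => h1 n z
    let Λ : (ℂ →L[ℝ] ℂ) →L[ℝ] ℂ := LinearMap.mkContinuous
      { toFun := antiPart, map_add' := antiPart_add,
        map_smul' := fun a D => by
          simp only [antiPart, smul_apply, Complex.real_smul, RingHom.id_apply]
          ring } 1 fun D => by rw [one_mul]; exact norm_antiPart_le D
    have hΛ : ∀ D, Λ D = antiPart D := fun D => rfl
    rw [dbar_eq_antiPart, hfz, ← hΛ, Λ.map_tsum hsum]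
    have hN := (hs (N + 1)).mul_left (C * 8 ^ N * (|z.im| / bracket z ^ 2) ^ N)
    refine (tsum_of_norm_bounded hN.hasSum fun n => ?_).trans (le_of_eq ?_)
    · rw [hΛ, hfd, antiPart_smul, norm_mul]
      exact (mul_le_mul_of_nonneg_left ((hb n z).2 N) (norm_nonneg _)).trans (le_of_eq (by ring))
    · rw [tsum_mul_left]; ring
  · have hN := (hs 1).mul_left (C * (bracket z ^ 2)⁻¹)
    rw [hfz]
    refine (tsum_of_norm_bounded hN.hasSum fun n => h1' n z).trans (le_of_eq ?_)
    rw [tsum_mul_left]; ring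

/-! ### Lipschitz functions and their weak derivatives -/

theorem integral_fderiv_eq_zero {u : ℂ → ℂ} {C : NNReal} (hu : LipschitzWith C u)
    (hs : HasCompactSupport u) (v : ℂ) : ∫ z, fderiv ℝ u z v = 0 := by
  have hint : Integrable fun z => fderiv ℝ u z v := by
    have hb : Integrable ((tsupport u).indicator fun _ : ℂ => (C : ℝ) * ‖v‖) :=
      (integrable_indicator_iff hs.isCompact.measurableSet).mpr
        (integrableOn_const hs.isCompact.measure_lt_top.ne)
    refine hb.mono' (measurable_fderiv_apply_const ℝ u v).aestronglyMeasurable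
      (Eventually.of_forall fun z => ?_)
    by_cases hz : z ∈ tsupport u
    · rw [Set.indicator_of_mem hz]
      exact (fderiv ℝ u z).le_of_opNorm_le (norm_fderiv_le_of_lipschitz ℝ hu) v
    · rw [Set.indicator_of_notMem hz, fderiv_of_notMem_tsupport ℝ hz]; simp
  have key : ∀ Λ : ℂ →L[ℝ] ℝ, (∀ z, ‖Λ z‖ ≤ ‖z‖) → Λ (∫ z, fderiv ℝ u z v) = 0 := by
    intro Λ hΛ
    have hl : LipschitzWith C fun z => Λ (u z) := by
      refine LipschitzWith.of_dist_le_mul fun x y => ?_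
      rw [dist_eq_norm, ← map_sub]
      exact (hΛ _).trans (by rw [← dist_eq_norm]; exact hu.dist_le_mul x y)
    -- Integration by parts against the constant function `1`.
    have h1 := LipschitzWith.integral_lineDeriv_mul_eq (μ := (volume : Measure ℂ))
      (LipschitzWith.const (1 : ℝ)) hl (hs.comp_left (g := Λ) (map_zero Λ)) (-v)
    have h0 : ∀ x w : ℂ, lineDeriv ℝ (fun _ : ℂ => (1 : ℝ)) x w = 0 := fun x w => by simp [lineDeriv]
    simp only [h0, zero_mul, integral_zero, neg_neg, mul_one] at h1
    rw [← Λ.integral_comp_comm hint, h1]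
    refine integral_congr_ae (hu.ae_differentiableAt.mono fun z hz => ?_)
    have h2 : HasFDerivAt (fun z => Λ (u z)) (Λ.comp (fderiv ℝ u z)) z :=
      Λ.hasFDerivAt.comp z hz.hasFDerivAt
    simp only
    rw [h2.differentiableAt.lineDeriv_eq_fderiv, h2.fderiv]
    rfl
  refine Complex.ext ?_ ?_
  · exact key Complex.reCLM fun z => Complex.abs_re_le_norm z
  · exact key Complex.imCLM fun z => Complex.abs_im_le_norm z

theorem exists_lipschitzWith_mul {u w : ℂ → ℂ} {C D : NNReal} {M N : ℝ} (hu : LipschitzWith C u)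
    (hw : LipschitzWith D w) (hM : ∀ z, ‖u z‖ ≤ M) (hN : ∀ z, ‖w z‖ ≤ N) :
    ∃ K, LipschitzWith K fun z => u z * w z := by
  have hM0 : 0 ≤ M := (norm_nonneg _).trans (hM 0)
  have hN0 : 0 ≤ N := (norm_nonneg _).trans (hN 0)
  refine ⟨(M * D + C * N).toNNReal, LipschitzWith.of_dist_le_mul fun x y => ?_⟩
  have h1 := hu.dist_le_mul x y
  have h2 := hw.dist_le_mul x y
  rw [dist_eq_norm] at h1 h2 ⊢
  calc ‖u x * w x - u y * w y‖ = ‖u x * (w x - w y) + (u x - u y) * w y‖ := by congr 1; ring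
    _ ≤ M * (D * dist x y) + C * dist x y * N := by
        refine (norm_add_le _ _).trans ?_
        rw [norm_mul, norm_mul]
        gcongr
        · exact hM x
        · exact hN y
    _ = _ := by rw [Real.coe_toNNReal _ (by positivity)]; ring

theorem norm_dbar_le_of_lipschitz {u : ℂ → ℂ} {C : NNReal} (hu : LipschitzWith C u) (z : ℂ) :
    ‖dbar u z‖ ≤ C := by
  rw [dbar_eq_antiPart]
  exact (norm_antiPart_le _).trans (norm_fderiv_le_of_lipschitz ℝ hu)

theorem measurable_dbar (u : ℂ → ℂ) : Measurable (dbar u) := by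
  have h1 := measurable_fderiv_apply_const ℝ u 1
  have h2 := measurable_fderiv_apply_const ℝ u Complex.I
  unfold dbar
  fun_prop

theorem dbar_mul {u w : ℂ → ℂ} {z : ℂ} (hu : DifferentiableAt ℝ u z)
    (hw : DifferentiableAt ℝ w z) :
    dbar (fun z => u z * w z) z = u z * dbar w z + dbar u z * w z := by
  simp only [dbar_eq_antiPart]
  rw [fderiv_fun_mul hu hw, antiPart_add, antiPart_smul, antiPart_smul]
  ring

/-- By Rademacher's theorem, the distributional derivative of a bounded Lipschitz function is its
pointwise derivative. -/
theorem HasWeakDbar.of_lipschitz {u : ℂ → ℂ} {C : NNReal} {M : ℝ} (hu : LipschitzWith C u)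
    (hM : ∀ z, ‖u z‖ ≤ M) : HasWeakDbar u (dbar u) := by
  have hloc : LocallyIntegrable (dbar u) :=
    (memLp_top_of_bound (measurable_dbar u).aestronglyMeasurable (C : ℝ)
      (.of_forall (norm_dbar_le_of_lipschitz hu))).locallyIntegrable le_top
  refine ⟨hu.continuous.locallyIntegrable, hloc, fun ψ hψ hs => ?_⟩
  have hψ1 : ContDiff ℝ 1 ψ := hψ.of_le (by exact_mod_cast le_top)
  obtain ⟨D, hD⟩ := hψ1.lipschitzWith_of_hasCompactSupport hs one_ne_zero
  obtain ⟨N, hN⟩ := hs.exists_bound_of_continuous hψ.continuous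
  obtain ⟨K, hK⟩ := exists_lipschitzWith_mul hu hD hM hN
  have hs' : HasCompactSupport fun z => u z * ψ z := hs.mul_left
  have hi : ∀ v, Integrable fun z => fderiv ℝ (fun z => u z * ψ z) z v := fun v => by
    refine ((integrable_indicator_iff hs'.isCompact.measurableSet).mpr
      (integrableOn_const (C := (K : ℝ) * ‖v‖) hs'.isCompact.measure_lt_top.ne)).mono'
      (measurable_fderiv_apply_const ℝ _ v).aestronglyMeasurable (Eventually.of_forall fun z => ?_)
    by_cases hz : z ∈ tsupport fun z => u z * ψ z
    · rw [Set.indicator_of_mem hz]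
      exact (fderiv ℝ _ z).le_of_opNorm_le (norm_fderiv_le_of_lipschitz ℝ hK) v
    · rw [Set.indicator_of_notMem hz, fderiv_of_notMem_tsupport ℝ hz]; simp
  have h0 : ∫ z, dbar (fun z => u z * ψ z) z = 0 := by
    unfold dbar
    rw [integral_const_mul, integral_add (hi 1) ((hi Complex.I).const_mul _), integral_const_mul,
      integral_fderiv_eq_zero hK hs', integral_fderiv_eq_zero hK hs']
    simp
  have h1 : Integrable fun z => u z * dbar ψ z :=
    (hu.continuous.mul (continuous_dbar hψ1)).integrable_of_hasCompactSupport
      (hasCompactSupport_dbar hs).mul_left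
  have h2 : Integrable fun z => dbar u z * ψ z :=
    (hψ.continuous.integrable_of_hasCompactSupport hs).bdd_mul
      (measurable_dbar u).aestronglyMeasurable (.of_forall (norm_dbar_le_of_lipschitz hu))
  have h3 : ∫ z, dbar (fun z => u z * ψ z) z = ∫ z, (u z * dbar ψ z + dbar u z * ψ z) :=
    integral_congr_ae (hu.ae_differentiableAt.mono fun z hz =>
      dbar_mul hz (hψ1.differentiable one_ne_zero z))
  rw [h0, integral_add h1 h2] at h3
  exact eq_neg_of_add_eq_zero_left h3.symm

theorem HasWeakDbar.ae_eq {F φ φ' : ℂ → ℂ} (h : HasWeakDbar F φ) (h' : HasWeakDbar F φ') :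
    ∀ᵐ z, φ z = φ' z := by
  refine ae_eq_of_integral_contDiff_smul_eq h.locallyIntegrable_dbar h'.locallyIntegrable_dbar
    fun ψ hψ hs => ?_
  have hψ' : ContDiff ℝ ∞ fun z => (ψ z : ℂ) := Complex.ofRealCLM.contDiff.comp hψ
  have hs' : HasCompactSupport fun z => (ψ z : ℂ) := hs.comp_left (g := Complex.ofReal) rfl
  have h1 := h.integral_eq _ hψ' hs'
  rw [h'.integral_eq _ hψ' hs', neg_inj] at h1
  simp only [Complex.real_smul, mul_comm (ψ _ : ℂ)]
  exact h1.symm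

/-! ### The chain rule for a Lipschitz function after a `C¹` map -/

theorem norm_linPart_le (D : ℂ →L[ℝ] ℂ) : ‖linPart D‖ ≤ ‖D‖ := by
  have h1 : ‖D 1‖ ≤ ‖D‖ := by simpa using D.le_opNorm 1
  have h2 : ‖D Complex.I‖ ≤ ‖D‖ := by simpa using D.le_opNorm Complex.I
  unfold linPart
  rw [norm_mul]
  have h3 := norm_sub_le (D 1) (Complex.I * D Complex.I)
  rw [norm_mul, Complex.norm_I, one_mul] at h3
  have : ‖(1 / 2 : ℂ)‖ = 1 / 2 := by simp
  rw [this]; linarith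

theorem norm_le_norm_linPart_add (D : ℂ →L[ℝ] ℂ) : ‖D‖ ≤ ‖linPart D‖ + ‖antiPart D‖ := by
  refine D.opNorm_le_bound (by positivity) fun v => ?_
  rw [apply_eq_linPart_add_antiPart D v, add_mul]
  refine (norm_add_le _ _).trans (le_of_eq ?_)
  rw [norm_mul, norm_mul, RCLike.norm_conj]

theorem norm_antiPart_comp_le (A D : ℂ →L[ℝ] ℂ) :
    ‖antiPart (A.comp D)‖ ≤ ‖A‖ * ‖antiPart D‖ + ‖antiPart A‖ * ‖D‖ := by
  have h : antiPart (A.comp D) =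
      linPart A * antiPart D + antiPart A * (starRingEnd ℂ) (linPart D) := by
    have h1 := apply_eq_linPart_add_antiPart A (D 1)
    have h2 := apply_eq_linPart_add_antiPart A (D Complex.I)
    rw [antiPart, ContinuousLinearMap.comp_apply, ContinuousLinearMap.comp_apply, h1, h2]
    simp only [antiPart, linPart, map_mul, map_sub, Complex.conj_I, map_div₀, map_one, map_ofNat]
    ring
  rw [h]
  refine (norm_add_le _ _).trans ?_
  rw [norm_mul, norm_mul, RCLike.norm_conj]
  have h1 := norm_linPart_le A
  have h2 := norm_linPart_le D
  gcongr

/-- A real-linear map of `ℂ` that is not invertible has `|p| = |q|`. -/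
theorem norm_linPart_eq_of_not_injective {D : ℂ →L[ℝ] ℂ} (hD : ¬ Function.Injective D) :
    ‖linPart D‖ = ‖antiPart D‖ := by
  rw [injective_iff_map_eq_zero] at hD
  push Not at hD
  obtain ⟨v, hv, hv0⟩ := hD
  rw [apply_eq_linPart_add_antiPart] at hv
  have h1 := congrArg norm (eq_neg_of_add_eq_zero_left hv)
  rw [norm_neg, norm_mul, norm_mul, RCLike.norm_conj] at h1
  exact mul_right_cancel₀ (norm_ne_zero_iff.mpr hv0) h1

/-- Where its derivative is injective, a `C¹` map pulls null sets back to null sets. -/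
theorem measure_injective_fderiv_inter_preimage_eq_zero {F : ℂ → ℂ} (hF : ContDiff ℝ 1 F)
    {N : Set ℂ} (hN : volume N = 0) :
    volume {z | Function.Injective (fderiv ℝ F z) ∧ F z ∈ N} = 0 := by
  refine measure_null_of_locally_null _ fun z hz => ?_
  obtain ⟨hinj, -⟩ := hz
  let e : ℂ ≃L[ℝ] ℂ := (LinearEquiv.ofInjectiveEndo (fderiv ℝ F z : ℂ →ₗ[ℝ] ℂ) hinj).toContinuousLinearEquiv
  have he : (e : ℂ →L[ℝ] ℂ) = fderiv ℝ F z := by ext v; rfl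
  have hd : HasFDerivAt F (e : ℂ →L[ℝ] ℂ) z := by
    rw [he]; exact (hF.differentiable one_ne_zero z).hasFDerivAt
  have hat : ContDiffAt ℝ 1 F z := hF.contDiffAt
  set I := hat.localInverse hd one_ne_zero
  have h1 : ∀ᶠ x in 𝓝 z, I (F x) = x :=
    (hat.hasStrictFDerivAt' hd one_ne_zero).eventually_left_inverse
  have h2 : ∀ᶠ x in 𝓝 z, DifferentiableAt ℝ I (F x) := by
    have h3 : ContDiffAt ℝ 1 I (F z) := hat.to_localInverse hd one_ne_zero
    have h4 : ∀ᶠ y in 𝓝 (F z), ContDiffAt ℝ 1 I y := h3.eventually (by simp)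
    exact (hF.continuous.continuousAt.eventually h4).mono fun x hx => hx.differentiableAt one_ne_zero
  -- Locally the preimage is the image of a null set under the differentiable local inverse `I`.
  refine ⟨{x | I (F x) = x ∧ DifferentiableAt ℝ I (F x)} ∩
    {z | Function.Injective (fderiv ℝ F z) ∧ F z ∈ N},
    inter_mem (mem_nhdsWithin_of_mem_nhds (h1.and h2)) self_mem_nhdsWithin, ?_⟩
  have h5 : volume (I '' {y | DifferentiableAt ℝ I y ∧ y ∈ N}) = 0 :=
    addHaar_image_eq_zero_of_differentiableOn_of_addHaar_eq_zero volume
      (fun y hy => hy.1.differentiableWithinAt) (measure_mono_null (fun y hy => hy.2) hN)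
  refine measure_mono_null (fun x hx => ?_) h5
  exact ⟨F x, ⟨hx.1.2, hx.2.2⟩, hx.1.1⟩

/-- Here `G` need not be differentiable at `F z`. -/
theorem norm_fderiv_comp_le {G F : ℂ → ℂ} {L : NNReal} (hG : LipschitzWith L G) {z : ℂ}
    (hF : DifferentiableAt ℝ F z) : ‖fderiv ℝ (G ∘ F) z‖ ≤ L * ‖fderiv ℝ F z‖ := by
  have key : ∀ ε > 0, ‖fderiv ℝ (G ∘ F) z‖ ≤ L * (‖fderiv ℝ F z‖ + ε) := by
    intro ε hε
    refine norm_fderiv_le_of_lip' ℝ (by positivity) ?_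
    have h1 := (hF.hasFDerivAt.isLittleO.def hε)
    filter_upwards [h1] with x hx
    have h2 : ‖F x - F z‖ ≤ (‖fderiv ℝ F z‖ + ε) * ‖x - z‖ := by
      have h3 := (fderiv ℝ F z).le_opNorm (x - z)
      have h4 := norm_add_le (F x - F z - fderiv ℝ F z (x - z)) (fderiv ℝ F z (x - z))
      rw [sub_add_cancel] at h4
      linarith
    have h3 := hG.dist_le_mul (F x) (F z)
    rw [dist_eq_norm, dist_eq_norm] at h3
    refine h3.trans ?_
    rw [mul_assoc]
    gcongr
  have hlim : Tendsto (fun ε : ℝ => L * (‖fderiv ℝ F z‖ + ε)) (𝓝[>] 0)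
      (𝓝 (L * (‖fderiv ℝ F z‖ + 0))) :=
    ((tendsto_const_nhds.add tendsto_id).const_mul _).mono_left nhdsWithin_le_nhds
  rw [add_zero] at hlim
  exact ge_of_tendsto hlim (eventually_mem_nhdsWithin.mono fun ε hε => key ε hε)

/-- The estimate for `∂(G ∘ F)/∂z̄` that replaces the chain rule. Where `F` is not a local
diffeomorphism, `∇F` is controlled by `∂F/∂z̄` alone. -/
theorem ae_norm_dbar_comp_le {G F : ℂ → ℂ} {L : NNReal} (hG : LipschitzWith L G)
    (hF : ContDiff ℝ 1 F) {p : ℂ → Prop} (hp : ∀ᵐ ζ, p ζ) :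
    ∀ᵐ z, ‖dbar (G ∘ F) z‖ ≤ 2 * L * ‖dbar F z‖ ∨
      (p (F z) ∧ ‖dbar (G ∘ F) z‖ ≤ L * ‖dbar F z‖ + ‖dbar G (F z)‖ * ‖fderiv ℝ F z‖) := by
  -- Points mapped by a local diffeomorphism to bad points of `G` form a null set.
  have hN : volume {ζ | ¬ (p ζ ∧ DifferentiableAt ℝ G ζ)} = 0 :=
    ae_iff.mp (hp.and hG.ae_differentiableAt)
  have h0 := measure_injective_fderiv_inter_preimage_eq_zero hF hN
  filter_upwards [measure_eq_zero_iff_ae_notMem.mp h0] with z hz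
  have hFz : DifferentiableAt ℝ F z := hF.differentiable one_ne_zero z
  by_cases hinj : Function.Injective (fderiv ℝ F z)
  · right
    obtain ⟨h1, h2⟩ : p (F z) ∧ DifferentiableAt ℝ G (F z) := by
      by_contra hcon
      exact hz ⟨hinj, hcon⟩
    refine ⟨h1, ?_⟩
    rw [dbar_eq_antiPart, fderiv_comp z h2 hFz, dbar_eq_antiPart, dbar_eq_antiPart]
    refine (norm_antiPart_comp_le _ _).trans ?_
    have := norm_fderiv_le_of_lipschitz ℝ (x₀ := F z) hG
    gcongr
  · left
    have h1 := norm_le_norm_linPart_add (fderiv ℝ F z)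
    rw [norm_linPart_eq_of_not_injective hinj] at h1
    rw [dbar_eq_antiPart, dbar_eq_antiPart]
    calc _ ≤ L * ‖fderiv ℝ F z‖ := (norm_antiPart_le _).trans (norm_fderiv_comp_le hG hFz)
      _ ≤ L * (‖antiPart (fderiv ℝ F z)‖ + ‖antiPart (fderiv ℝ F z)‖) := by gcongr
      _ = _ := by ring

/-! ### Composition of almost holomorphic and flat extensions -/

namespace IsStrongAlmostHolExt

variable {f : ℝ → ℂ} {F : ℂ → ℂ}

theorem exists_grad_bound (h : IsStrongAlmostHolExt f F) :
    ∃ C : ℝ, 0 ≤ C ∧ ∀ z : ℂ, ‖fderiv ℝ F z‖ ≤ C * (bracket z ^ 2)⁻¹ := by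
  obtain ⟨C, hC⟩ := h.grad_bound
  refine ⟨|C|, abs_nonneg C, fun z => (hC z).trans ?_⟩
  have := bracket_pos z
  gcongr
  exact le_abs_self C

theorem exists_lipschitzWith (h : IsStrongAlmostHolExt f F) : ∃ L, LipschitzWith L F := by
  obtain ⟨C, hC0, hC⟩ := h.exists_grad_bound
  refine ⟨C.toNNReal, lipschitzWith_of_nnnorm_fderiv_le (𝕜 := ℝ)
    (h.contDiff.differentiable one_ne_zero) fun z => ?_⟩
  rw [← NNReal.coe_le_coe, coe_nnnorm, Real.coe_toNNReal _ hC0]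
  exact (hC z).trans (mul_le_of_le_one_right hC0
    (inv_le_one_of_one_le₀ (one_le_pow₀ (one_le_bracket z))))

theorem norm_sub_re_le (h : IsStrongAlmostHolExt f F) {C : ℝ} (hC0 : 0 ≤ C)
    (hC : ∀ z : ℂ, ‖fderiv ℝ F z‖ ≤ C * (bracket z ^ 2)⁻¹) (z : ℂ) :
    ‖F z - f z.re‖ ≤ C * (1 + z.re ^ 2)⁻¹ * |z.im| := by
  have hs : Convex ℝ {w : ℂ | w.re = z.re} := by
    have h1 := (convex_singleton z.re).linear_preimage Complex.reLm
    exact h1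
  have h1 := hs.norm_image_sub_le_of_norm_fderiv_le (𝕜 := ℝ) (f := F)
    (C := C * (1 + z.re ^ 2)⁻¹) (x := (z.re : ℂ)) (y := z)
    (fun w _ => h.contDiff.differentiable one_ne_zero w) (fun w hw => (hC w).trans ?_) (by simp)
    (by simp)
  · rw [h.extends_fun] at h1
    refine h1.trans (le_of_eq ?_)
    congr 1
    have h2 : z - z.re = z.im * Complex.I := by
      rw [sub_eq_iff_eq_add', Complex.re_add_im]
    rw [h2, norm_mul, Complex.norm_I, mul_one, Complex.norm_real, Real.norm_eq_abs]
  · have h2 : 1 + z.re ^ 2 ≤ bracket w ^ 2 := by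
      rw [bracket_sq, ← Complex.normSq_eq_norm_sq, Complex.normSq_apply,
        show w.re = z.re from hw]
      nlinarith [mul_self_nonneg w.im]
    gcongr

theorem norm_add_sub_le (h : IsStrongAlmostHolExt f F) {C : ℝ} (hC0 : 0 ≤ C)
    (hC : ∀ z : ℂ, ‖fderiv ℝ F z‖ ≤ C * (bracket z ^ 2)⁻¹) (z : ℂ) {T : ℝ} (hT : 0 ≤ T) :
    ‖F (z + T) - F z‖ ≤ C * Real.pi * (√(1 + z.im ^ 2))⁻¹ := by
  set s := √(1 + z.im ^ 2) with hs
  have hs0 : 0 < s := Real.sqrt_pos.mpr (by positivity)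
  have hs2 : s ^ 2 = 1 + z.im ^ 2 := Real.sq_sqrt (by positivity)
  have hd : ∀ t : ℝ, HasDerivAt (fun t : ℝ => F (z + t) - F z) (fderiv ℝ F (z + t) 1) t := by
    intro t
    have h1 : HasDerivAt (fun t : ℝ => z + (t : ℂ)) 1 t := by
      simpa using (HasDerivAt.ofReal_comp (hasDerivAt_id t)).const_add z
    exact ((h.contDiff.differentiable one_ne_zero _).hasFDerivAt.comp_hasDerivAt t h1).sub_const _
  -- The comparison function is a primitive of `C / (s² + (x + t)²)`.
  have hB : ∀ t : ℝ, HasDerivAt (fun t : ℝ => C / s * (Real.arctan ((z.re + t) / s) -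
      Real.arctan (z.re / s))) (C * (bracket (z + t) ^ 2)⁻¹) t := by
    intro t
    have h1 : HasDerivAt (fun t : ℝ => (z.re + t) / s) (1 / s) t :=
      ((hasDerivAt_id t).const_add z.re).div_const s
    refine ((h1.arctan.sub_const _).const_mul (C / s)).congr_deriv ?_
    have h2 : bracket (z + t) ^ 2 = s ^ 2 + (z.re + t) ^ 2 := by
      rw [bracket_sq, ← Complex.normSq_eq_norm_sq, Complex.normSq_apply, hs2]
      simp; ring
    rw [h2]
    field_simp
  have h1 := image_norm_le_of_norm_deriv_right_le_deriv_boundary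
    (f := fun t : ℝ => F (z + t) - F z) (a := 0) (b := T)
    (fun t _ => (hd t).continuousAt.continuousWithinAt) (fun t _ => (hd t).hasDerivWithinAt)
    (by simp) hB (fun t _ => ?_) (Set.right_mem_Icc.mpr hT)
  · refine h1.trans ?_
    have h2 := Real.arctan_lt_pi_div_two ((z.re + T) / s)
    have h3 := Real.neg_pi_div_two_lt_arctan (z.re / s)
    calc C / s * (Real.arctan ((z.re + T) / s) - Real.arctan (z.re / s)) ≤ C / s * Real.pi := by
          gcongr; linarith
      _ = _ := by ring
  · refine le_trans ?_ (hC (z + t))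
    simpa using (fderiv ℝ F (z + t)).le_opNorm 1

/-- Estimate along the path from `z` horizontally to `z + T` and then vertically to the real line. -/
theorem norm_sub_le (h : IsStrongAlmostHolExt f F) {C : ℝ} (hC0 : 0 ≤ C)
    (hC : ∀ z : ℂ, ‖fderiv ℝ F z‖ ≤ C * (bracket z ^ 2)⁻¹) (z : ℂ) {T : ℝ} (hT : 0 ≤ T) :
    ‖F z - f (z.re + T)‖ ≤
      C * Real.pi * (√(1 + z.im ^ 2))⁻¹ + C * (1 + (z.re + T) ^ 2)⁻¹ * |z.im| := by
  have h1 := h.norm_add_sub_le hC0 hC z hT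
  have h2 := h.norm_sub_re_le hC0 hC (z + T)
  rw [show (z + T).re = z.re + T by simp, show (z + T).im = z.im by simp] at h2
  rw [norm_sub_rev] at h1
  have h3 := norm_add_le (F z - F (z + T)) (F (z + T) - f (z.re + T))
  rw [sub_add_sub_cancel] at h3
  linarith

theorem exists_norm_le (h : IsStrongAlmostHolExt f F) {M : ℝ} (hM : ∀ x, ‖f x‖ ≤ M) :
    ∃ C : ℝ, ∀ z, ‖F z‖ ≤ C := by
  obtain ⟨C, hC0, hC⟩ := h.exists_grad_bound
  refine ⟨C * Real.pi + C + M, fun z => ?_⟩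
  -- This shift makes `|Re z + T| ≥ |Im z|`.
  have h1 := h.norm_sub_le hC0 hC z (T := |z.re| + |z.im|) (by positivity)
  have h2 : (√(1 + z.im ^ 2))⁻¹ ≤ 1 :=
    inv_le_one_of_one_le₀ (Real.one_le_sqrt.mpr (by nlinarith [sq_nonneg z.im]))
  have h3 : (1 + (z.re + (|z.re| + |z.im|)) ^ 2)⁻¹ * |z.im| ≤ 1 := by
    rw [inv_mul_le_iff₀ (by positivity), mul_one]
    have h4 := neg_abs_le z.re
    have h5 := abs_nonneg z.im
    nlinarith
  have h4 := hM (z.re + (|z.re| + |z.im|))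
  have h5 := norm_add_le (F z - f (z.re + (|z.re| + |z.im|))) (f (z.re + (|z.re| + |z.im|)))
  rw [sub_add_cancel] at h5
  have h6 : C * Real.pi * (√(1 + z.im ^ 2))⁻¹ ≤ C * Real.pi :=
    mul_le_of_le_one_right (by positivity) h2
  have h7 : C * (1 + (z.re + (|z.re| + |z.im|)) ^ 2)⁻¹ * |z.im| ≤ C := by
    rw [mul_assoc]; exact mul_le_of_le_one_right hC0 h3
  linarith

/-- The distance from `F z` to the range of `f` is at most a multiple of the distance from `z` to the
circle `ℝ ∪ {∞}` in the Riemann sphere: near the real line `F z` is compared with `f (Re z)`, away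
from it with the values of `f` near infinity. -/
theorem exists_infDist_le (h : IsStrongAlmostHolExt f F) : ∃ C : ℝ, 0 ≤ C ∧ ∀ z,
    Metric.infDist (F z) (closure (Set.range f)) ≤ C * (|z.im| / bracket z ^ 2) := by
  obtain ⟨C, hC0, hC⟩ := h.exists_grad_bound
  have hpi := Real.pi_gt_three
  have hd : ∀ z x, Metric.infDist (F z) (closure (Set.range f)) ≤ ‖F z - f x‖ := fun z x => by
    rw [← dist_eq_norm]
    exact Metric.infDist_le_dist_of_mem (subset_closure (Set.mem_range_self x))
  refine ⟨2 * C * Real.pi, by positivity, fun z => ?_⟩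
  have hb : bracket z ^ 2 = 1 + z.re ^ 2 + z.im ^ 2 := by
    rw [bracket_sq, ← Complex.normSq_eq_norm_sq, Complex.normSq_apply]; ring
  have hy := abs_nonneg z.im
  rw [hb]
  rcases le_total (z.im ^ 2) (1 + z.re ^ 2) with hz | hz
  · refine (hd z z.re).trans ((h.norm_sub_re_le hC0 hC z).trans ?_)
    have h1 : (1 + z.re ^ 2)⁻¹ ≤ 2 / (1 + z.re ^ 2 + z.im ^ 2) := by
      rw [inv_eq_one_div, div_le_div_iff₀ (by positivity) (by positivity)]
      linarith
    calc C * (1 + z.re ^ 2)⁻¹ * |z.im| ≤ C * (2 / (1 + z.re ^ 2 + z.im ^ 2)) * |z.im| := by gcongr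
      _ = 2 * C * 1 * (|z.im| / (1 + z.re ^ 2 + z.im ^ 2)) := by ring
      _ ≤ _ := by gcongr; linarith
  · have h1 : Metric.infDist (F z) (closure (Set.range f)) ≤
        C * Real.pi * (√(1 + z.im ^ 2))⁻¹ := by
      have h2 : Tendsto (fun T : ℝ => C * Real.pi * (√(1 + z.im ^ 2))⁻¹ +
          C * (1 + (z.re + T) ^ 2)⁻¹ * |z.im|) atTop
          (𝓝 (C * Real.pi * (√(1 + z.im ^ 2))⁻¹ + C * 0 * |z.im|)) := by
        refine tendsto_const_nhds.add ((Tendsto.const_mul C ?_).mul_const _)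
        refine Tendsto.inv_tendsto_atTop (tendsto_atTop_add_const_left _ _ ?_)
        exact (tendsto_pow_atTop two_ne_zero).comp (tendsto_atTop_add_const_left _ _ tendsto_id)
      rw [mul_zero, zero_mul, add_zero] at h2
      exact ge_of_tendsto h2 ((eventually_ge_atTop 0).mono fun T hT =>
        (hd z _).trans (h.norm_sub_le hC0 hC z hT))
    have hy2 : |z.im| ^ 2 = z.im ^ 2 := sq_abs _
    have hy0 : 0 < |z.im| := by
      rcases hy.eq_or_lt with h0 | h0
      · rw [← h0] at hy2; nlinarith [sq_nonneg z.re]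
      · exact h0
    have h2 : (√(1 + z.im ^ 2))⁻¹ ≤ |z.im|⁻¹ := by
      refine inv_anti₀ hy0 ?_
      rw [← Real.sqrt_sq_eq_abs]
      exact Real.sqrt_le_sqrt (by linarith)
    have h3 : |z.im|⁻¹ ≤ 2 * (|z.im| / (1 + z.re ^ 2 + z.im ^ 2)) := by
      rw [inv_eq_one_div, ← mul_div_assoc, div_le_div_iff₀ hy0 (by positivity)]
      nlinarith
    calc _ ≤ C * Real.pi * (2 * (|z.im| / (1 + z.re ^ 2 + z.im ^ 2))) :=
          h1.trans (by gcongr; exact h2.trans h3)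
      _ = _ := by ring

end IsStrongAlmostHolExt

theorem div_bracket_sq_pow_le (z : ℂ) (N₀ N₁ : ℕ) :
    (|z.im| / bracket z ^ 2) ^ (N₀ + N₁) ≤ (bracket z ^ N₁)⁻¹ * |z.im| ^ N₀ := by
  have h0 := bracket_pos z
  have h1 := one_le_bracket z
  have h2 : |z.im| / bracket z ^ 2 ≤ |z.im| :=
    div_le_self (abs_nonneg _) (one_le_pow₀ h1)
  have h3 : |z.im| / bracket z ^ 2 ≤ (bracket z)⁻¹ := by
    rw [div_le_iff₀ (by positivity), sq, inv_mul_cancel_left₀ h0.ne']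
    exact abs_im_le_bracket z
  rw [pow_add, mul_comm, ← inv_pow]
  gcongr

theorem exists_bracket_bound_of_pow_bound {φ : ℂ → ℂ}
    (h : ∀ N : ℕ, ∃ C : ℝ, 0 ≤ C ∧ ∀ᵐ z, ‖φ z‖ ≤ C * (|z.im| / bracket z ^ 2) ^ N) (N₀ N₁ : ℕ) :
    ∃ C : ℝ, ∀ᵐ z : ℂ, ‖φ z‖ ≤ C * (bracket z ^ N₁)⁻¹ * |z.im| ^ N₀ := by
  obtain ⟨C, hC0, hC⟩ := h (N₀ + N₁)
  refine ⟨C, hC.mono fun z hz => hz.trans ?_⟩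
  rw [mul_assoc]
  exact mul_le_mul_of_nonneg_left (div_bracket_sq_pow_le z N₀ N₁) hC0

theorem IsStrongAlmostHolExt.exists_dbar_bound {f : ℝ → ℂ} {F : ℂ → ℂ}
    (h : IsStrongAlmostHolExt f F) (N : ℕ) :
    ∃ C : ℝ, 0 ≤ C ∧ ∀ z : ℂ, ‖dbar F z‖ ≤ C * (|z.im| / bracket z ^ 2) ^ N := by
  obtain ⟨C, hC⟩ := h.dbar_bound N
  refine ⟨|C|, abs_nonneg C, fun z => (hC z).trans ?_⟩
  have := bracket_pos z
  gcongr
  exact le_abs_self C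

theorem IsStrongAlmostHolExt.isAlmostHolExt {f : ℝ → ℂ} {F : ℂ → ℂ}
    (h : IsStrongAlmostHolExt f F) {M : ℝ} (hM : ∀ x, ‖f x‖ ≤ M) :
    IsAlmostHolExt f F (dbar F) := by
  obtain ⟨L, hL⟩ := h.exists_lipschitzWith
  obtain ⟨C, hC⟩ := h.exists_norm_le hM
  refine ⟨hL.continuous, ⟨C, hC⟩, h.extends_fun, .of_lipschitz hL hC,
    exists_bracket_bound_of_pow_bound fun N => ?_⟩
  obtain ⟨C, hC0, hC⟩ := h.exists_dbar_bound N
  exact ⟨C, hC0, .of_forall hC⟩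

theorem IsFlatLipschitzExt.exists_dbar_bound {K : Set ℂ} {g G γ : ℂ → ℂ}
    (h : IsFlatLipschitzExt K g G γ) (N : ℕ) :
    ∃ C : ℝ, 0 ≤ C ∧ ∀ᵐ ζ : ℂ, ‖dbar G ζ‖ ≤ C * Metric.infDist ζ K ^ N := by
  obtain ⟨L, hL⟩ := h.lipschitz
  obtain ⟨M, hM⟩ := h.bounded
  obtain ⟨C, hC⟩ := h.dbar_bound N
  refine ⟨|C|, abs_nonneg C, ?_⟩
  filter_upwards [hC, h.dbar_eq.ae_eq (.of_lipschitz hL hM)] with ζ h1 h2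
  rw [← h2]
  refine h1.trans ?_
  have := Metric.infDist_nonneg (x := ζ) (s := K)
  gcongr
  exact le_abs_self C

/-- The composition of a flat extension of `g` with a strong almost holomorphic extension of `f` is an
almost holomorphic extension of `g ∘ f`. -/
theorem IsFlatLipschitzExt.comp {f : ℝ → ℂ} {F g G γ : ℂ → ℂ}
    (hG : IsFlatLipschitzExt (closure (Set.range f)) g G γ) (hF : IsStrongAlmostHolExt f F) :
    IsAlmostHolExt (g ∘ f) (G ∘ F) (dbar (G ∘ F)) := by
  obtain ⟨L, hL⟩ := hG.lipschitz
  obtain ⟨L', hL'⟩ := hF.exists_lipschitzWith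
  obtain ⟨M, hM⟩ := hG.bounded
  have hGF : LipschitzWith (L * L') (G ∘ F) := hL.comp hL'
  refine ⟨hGF.continuous, ⟨M, fun z => hM _⟩, fun x => ?_, .of_lipschitz hGF fun z => hM _,
    exists_bracket_bound_of_pow_bound fun N => ?_⟩
  · rw [Function.comp_apply, Function.comp_apply, hF.extends_fun]
    exact hG.extends_fun _ (subset_closure (Set.mem_range_self x))
  obtain ⟨C₁, hC₁, h1⟩ := hF.exists_dbar_bound N
  obtain ⟨C₂, hC₂, h2⟩ := hG.exists_dbar_bound N
  obtain ⟨C₃, hC₃, h3⟩ := hF.exists_infDist_le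
  refine ⟨2 * L * C₁ + C₂ * C₃ ^ N * L', by positivity, ?_⟩
  filter_upwards [ae_norm_dbar_comp_le hL hF.contDiff h2] with z hz
  have h0 : 0 ≤ |z.im| / bracket z ^ 2 := by have := bracket_pos z; positivity
  have h4 := h1 z
  have h5 : 0 ≤ C₂ * C₃ ^ N * L' * (|z.im| / bracket z ^ 2) ^ N := by positivity
  rcases hz with hz | ⟨hp, hz⟩
  · calc _ ≤ 2 * L * (C₁ * (|z.im| / bracket z ^ 2) ^ N) := hz.trans (by gcongr)
      _ ≤ _ := by linarith
  · have h6 : ‖dbar G (F z)‖ ≤ C₂ * (C₃ * (|z.im| / bracket z ^ 2)) ^ N := by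
      refine hp.trans ?_
      have := Metric.infDist_nonneg (x := F z) (s := closure (Set.range f))
      gcongr
      exact h3 z
    have h7 : ‖fderiv ℝ F z‖ ≤ L' := norm_fderiv_le_of_lipschitz ℝ hL'
    have h8 : 0 ≤ L * (C₁ * (|z.im| / bracket z ^ 2) ^ N) := by positivity
    calc _ ≤ L * (C₁ * (|z.im| / bracket z ^ 2) ^ N) +
          C₂ * (C₃ * (|z.im| / bracket z ^ 2)) ^ N * L' := hz.trans (by gcongr)
      _ ≤ _ := by rw [mul_pow]; linarith

/-- Multiplication by a cutoff function makes the support of a flat extension compact. -/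
theorem IsFlatLipschitzExt.exists_hasCompactSupport {K : Set ℂ} {g G γ : ℂ → ℂ}
    (hG : IsFlatLipschitzExt K g G γ) (hK : Bornology.IsBounded K) (hne : K.Nonempty) :
    ∃ G' γ' : ℂ → ℂ, IsFlatLipschitzExt K g G' γ' ∧ HasCompactSupport G' := by
  obtain ⟨L, hL⟩ := hG.lipschitz
  obtain ⟨M, hM⟩ := hG.bounded
  have hM0 : 0 ≤ M := (norm_nonneg _).trans (hM 0)
  obtain ⟨R, hR0, hR⟩ := hK.subset_closedBall_lt 0 0
  let χ : ContDiffBump (0 : ℂ) := ⟨R + 1, R + 2, by linarith, by linarith⟩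
  have hχ : ContDiff ℝ 1 fun z => (χ z : ℂ) := Complex.ofRealCLM.contDiff.comp χ.contDiff
  have hs : HasCompactSupport fun z => (χ z : ℂ) :=
    χ.hasCompactSupport.comp_left (g := Complex.ofReal) rfl
  have hχ1 : ∀ z, ‖(χ z : ℂ)‖ ≤ 1 := fun z => by
    rw [Complex.norm_real, Real.norm_of_nonneg χ.nonneg]; exact χ.le_one
  obtain ⟨D, hD⟩ := hχ.lipschitzWith_of_hasCompactSupport hs one_ne_zero
  obtain ⟨L', hL'⟩ := exists_lipschitzWith_mul hL hD hM hχ1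
  have hM' : ∀ z, ‖G z * χ z‖ ≤ M := fun z => by
    rw [norm_mul, ← mul_one M]
    exact mul_le_mul (hM z) (hχ1 z) (norm_nonneg _) hM0
  have hin : ∀ z ∈ Metric.closedBall (0 : ℂ) (R + 1), χ z = 1 := fun z hz =>
    χ.one_of_mem_closedBall hz
  refine ⟨fun z => G z * χ z, dbar fun z => G z * χ z,
    ⟨⟨M, hM'⟩, ⟨L', hL'⟩, fun ζ hζ => ?_, .of_lipschitz hL' hM', fun N => ?_⟩, hs.mul_left⟩
  · rw [hin ζ (Metric.closedBall_subset_closedBall (by linarith) (hR hζ)), Complex.ofReal_one,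
      mul_one, hG.extends_fun ζ hζ]
  · obtain ⟨C, hC0, hC⟩ := hG.exists_dbar_bound N
    refine ⟨C + M * D, ?_⟩
    filter_upwards [hC, hL.ae_differentiableAt] with ζ h1 h2
    have hd := Metric.infDist_nonneg (x := ζ) (s := K)
    rw [dbar_mul h2 (hχ.differentiable one_ne_zero ζ)]
    have h3 : ‖dbar G ζ * χ ζ‖ ≤ C * Metric.infDist ζ K ^ N := by
      rw [norm_mul, ← mul_one (C * _)]
      exact mul_le_mul h1 (hχ1 ζ) (norm_nonneg _) (by positivity)
    -- The derivative of the cutoff vanishes near `K`, and away from `K` the distance is at least `1`.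
    have h4 : ‖G ζ * dbar (fun z => (χ z : ℂ)) ζ‖ ≤ M * D * Metric.infDist ζ K ^ N := by
      by_cases hζ : ‖ζ‖ < R + 1
      · have h5 : (fun z => (χ z : ℂ)) =ᶠ[𝓝 ζ] fun _ => 1 := by
          filter_upwards [Metric.isOpen_ball.mem_nhds (mem_ball_zero_iff.mpr hζ)] with z hz
          rw [hin z (Metric.ball_subset_closedBall hz), Complex.ofReal_one]
        rw [dbar, h5.fderiv_eq]
        simp only [fderiv_fun_const, Pi.zero_apply, zero_apply, mul_zero, add_zero, norm_zero]
        positivity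
      · push Not at hζ
        have h5 : 1 ≤ Metric.infDist ζ K := by
          rw [Metric.le_infDist hne]
          intro y hy
          have h6 := hR hy
          rw [mem_closedBall_zero_iff] at h6
          have h7 := norm_sub_norm_le ζ y
          rw [dist_eq_norm]; linarith
        rw [norm_mul]
        calc ‖G ζ‖ * ‖dbar (fun z => (χ z : ℂ)) ζ‖ ≤ M * D * 1 := by
              rw [mul_one]
              exact mul_le_mul (hM ζ) (norm_dbar_le_of_lipschitz hD ζ) (norm_nonneg _) hM0
          _ ≤ _ := by gcongr; exact one_le_pow₀ h5
    rw [add_mul]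
    refine (norm_add_le _ _).trans ?_
    linarith

/-! ### The Cauchy–Green formulas -/

namespace IsAlmostHolExt

variable {f : ℝ → ℂ} {F φ : ℂ → ℂ}

theorem isFlatDensity (h : IsAlmostHolExt f F φ) : IsFlatDensity φ :=
  ⟨h.dbar_eq.locallyIntegrable_dbar.aestronglyMeasurable, h.dbar_bound⟩

theorem exists_eq_cauchyTransform (h : IsAlmostHolExt f F φ) :
    ∃ c : ℂ, Tendsto F (cocompact ℂ) (𝓝 c) ∧ ∀ z, F z = c + cauchyTransform φ z := by
  obtain ⟨C, hC⟩ := h.dbar_bound 0 2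
  refine h.dbar_eq.exists_eq_cauchyTransform h.continuous h.bounded (ε := 1) (C := C) one_pos
    (hC.mono fun z hz => ?_)
  rw [show (-1 - 1 : ℝ) = -((2 : ℕ) : ℝ) by norm_num, Real.rpow_neg (bracket_pos z).le,
    Real.rpow_natCast]
  simpa using hz

theorem memE (h : IsAlmostHolExt f F φ) : MemE f := by
  obtain ⟨c, -, hc⟩ := h.exists_eq_cauchyTransform
  exact h.isFlatDensity.memE fun x => by rw [← h.extends_fun, hc]

theorem tendsto_real (h : IsAlmostHolExt f F φ) {c : ℂ} (hc : Tendsto F (cocompact ℂ) (𝓝 c)) :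
    Tendsto f (cocompact ℝ) (𝓝 c) := by
  have h1 : Tendsto (fun x : ℝ => (x : ℂ)) (cocompact ℝ) (cocompact ℂ) :=
    Complex.isometry_ofReal.isClosedEmbedding.tendsto_cocompact
  exact (hc.comp h1).congr h.extends_fun

end IsAlmostHolExt

theorem exists_norm_circleCoeff_inv_ofReal_sub_le (m : ℕ) : ∃ C : ℝ, 0 ≤ C ∧
    ∀ w : ℂ, w.im ≠ 0 → ∀ n : ℤ,
      ‖circleCoeff (fun x : ℝ => ((x : ℂ) - w)⁻¹) n‖ * (1 + |(n : ℝ)|) ^ m ≤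
        C * axisWeight w ^ (1 + 3 * m) := by
  obtain ⟨C, hC0, hC⟩ := exists_circleDeriv_inv_ofReal_sub_pow_le m 1
  refine ⟨2 ^ m * (C + 1), by positivity, fun w hw n => ?_⟩
  have h1 := one_le_axisWeight w
  have h2 : 0 < axisWeight w ^ (1 + 3 * m) := pow_pos (axisWeight_pos w) _
  rw [mul_assoc]
  refine norm_circleCoeff_mul_pow_le (isCircleSmooth_inv_ofReal_sub hw m) (fun x => ?_)
    (fun x => ?_) n
  · refine ((norm_inv_ofReal_sub_le hw x).trans (inv_abs_im_le_axisWeight w)).trans ?_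
    have h3 : axisWeight w ≤ axisWeight w ^ (1 + 3 * m) := le_self_pow₀ h1 (by lia)
    nlinarith
  · have h3 := hC w hw x
    rw [pow_one] at h3
    nlinarith

section Operators

variable {B : Type*} [NormedAddCommGroup B] [NormedSpace ℂ B] [CompleteSpace B]
  {P : B →ₗ.[ℂ] B}

/-- The calculus of the Cayley transform is given by the Cauchy–Green formula of any almost
holomorphic extension. -/
theorem IsTemperate.circleCalc_eq_cauchyGreen (hP : IsTemperate P) {f : ℝ → ℂ} {F φ : ℂ → ℂ}
    (h : IsAlmostHolExt f F φ) {c : ℂ} (hc : Tendsto F (cocompact ℂ) (𝓝 c)) :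
    Integrable (fun z => φ z • opResolvent P z) ∧
      circleCalc hP.cayley f = cauchyGreen c φ (opResolvent P) := by
  obtain ⟨C, M, hU⟩ := hP.exists_hasPolyGrowth
  have hφ := h.isFlatDensity
  have hpi : (Real.pi : ℂ) ≠ 0 := by exact_mod_cast Real.pi_ne_zero
  have hF : ∀ x : ℝ, f x = c + ∫ w, ((Real.pi : ℂ)⁻¹ * φ w) * ((x : ℂ) - w)⁻¹ := by
    obtain ⟨c', hc', he⟩ := h.exists_eq_cauchyTransform
    intro x
    rw [← h.extends_fun, he, tendsto_nhds_unique hc hc', cauchyTransform, ← integral_const_mul]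
    simp only [mul_assoc]
  obtain ⟨D, hD0, hD⟩ := exists_norm_circleCoeff_inv_ofReal_sub_le (M + 2)
  have hm : Measurable (Function.uncurry fun (w : ℂ) (x : ℝ) => ((x : ℂ) - w)⁻¹) := by
    unfold Function.uncurry; fun_prop
  have key := circleCalc_integral hU (hφ.1.const_mul _) hm
    (((hφ.integrable_mul_axisWeight_pow (1 + 3 * (M + 2))).const_mul (‖(Real.pi : ℂ)⁻¹‖ * D)))
    (hφ.ae_eq_zero_or.mono fun w hw => ?_) hF
  · have hae : ∀ᵐ w, ((Real.pi : ℂ)⁻¹ * φ w) • circleCalc hP.cayley (fun x : ℝ => ((x : ℂ) - w)⁻¹) =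
        -(Real.pi : ℂ)⁻¹ • (φ w • opResolvent P w) := by
      filter_upwards [hφ.ae_eq_zero_or] with w hw
      rcases hw with hw | hw
      · simp [hw]
      · rw [hP.circleCalc_inv_ofReal_sub hw, mul_smul, neg_smul, smul_neg, smul_neg]
    constructor
    · refine ((key.1.congr hae).smul (-(Real.pi : ℂ))).congr (.of_forall fun w => ?_)
      simp only [Pi.smul_apply, smul_smul]
      rw [neg_mul, neg_mul, mul_neg, neg_neg, mul_inv_cancel_left₀ hpi]
    · rw [key.2, integral_congr_ae hae, integral_smul, neg_smul, ← sub_eq_add_neg]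
      rfl
  · rcases hw with hw | hw
    · left; rw [hw, mul_zero]
    · refine Or.inr ⟨isCircleSmooth_inv_ofReal_sub hw, fun n => ?_⟩
      rw [norm_mul]
      refine (mul_le_mul_of_nonneg_left (hD w hw n) (by positivity)).trans (le_of_eq (by ring))

theorem IsTemperate.isFunctionOf (hP : IsTemperate P) {f : ℝ → ℂ} {F φ : ℂ → ℂ}
    (h : IsAlmostHolExt f F φ) : IsFunctionOf P f (circleCalc hP.cayley f) := by
  obtain ⟨c, hc, -⟩ := h.exists_eq_cauchyTransform
  refine ⟨h.memE, ⟨F, φ, h⟩, c, h.tendsto_real hc, fun F' φ' h' => ?_⟩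
  obtain ⟨c', hc', -⟩ := h'.exists_eq_cauchyTransform
  rw [tendsto_nhds_unique (h.tendsto_real hc) (h'.tendsto_real hc')]
  exact hP.circleCalc_eq_cauchyGreen h' hc'

end Operators

section Bounded

variable {f : ℝ → ℂ}

theorem infDist_le_norm_sub (f : ℝ → ℂ) (ζ : ℂ) (x : ℝ) :
    Metric.infDist ζ (closure (Set.range f)) ≤ ‖ζ - f x‖ := by
  rw [← dist_eq_norm]
  exact Metric.infDist_le_dist_of_mem (subset_closure (Set.mem_range_self x))

theorem IsCircleSmooth.exists_norm_circleCoeff_inv_sub_le (hf : IsCircleSmooth f) (m : ℕ) :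
    ∃ C : ℝ, 0 ≤ C ∧ ∀ (ζ : ℂ) (d : ℝ), 0 < d → (∀ x, d ≤ ‖ζ - f x‖) → ∀ n : ℤ,
      ‖circleCoeff (fun x => (ζ - f x)⁻¹) n‖ * (1 + |(n : ℝ)|) ^ m ≤
        C * (d⁻¹ * (1 + d⁻¹) ^ m) := by
  obtain ⟨C, hC0, hC⟩ := exists_circleDeriv_inv_sub_le hf m 1 (fun _ => 1) (IsCircleSmooth.const 1)
  refine ⟨2 ^ m * (C + 1), by positivity, fun ζ d hd hζ n => ?_⟩
  have hd' : 0 < d⁻¹ := by positivity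
  have h2 : 1 ≤ (1 + d⁻¹) ^ m := one_le_pow₀ (by linarith)
  have h3 : d⁻¹ ≤ d⁻¹ * (1 + d⁻¹) ^ m := le_mul_of_one_le_right hd'.le h2
  rw [mul_assoc]
  refine norm_circleCoeff_mul_pow_le (hf.inv_sub hd hζ m) (fun x => ?_) (fun x => ?_) n
  · rw [norm_inv]
    have h1 := inv_anti₀ hd (hζ x)
    nlinarith
  · have h4 := hC ζ d hd hζ x
    have h5 : ((fun _ => 1) * (fun x => (ζ - f x)⁻¹) ^ 1 : ℝ → ℂ) = fun x => (ζ - f x)⁻¹ := by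
      ext x; simp
    rw [h5, pow_one] at h4
    nlinarith

theorem isBounded_closure_range (hf : IsCircleSmooth f) :
    Bornology.IsBounded (closure (Set.range f)) := by
  obtain ⟨M, -, hM⟩ := hf.exists_bound
  refine Bornology.IsBounded.closure (isBounded_iff_forall_norm_le.mpr ⟨M, ?_⟩)
  rintro _ ⟨x, rfl⟩
  exact hM x

theorem exists_bracket_le_infDist {K : Set ℂ} (hK : Bornology.IsBounded K) (hne : K.Nonempty) :
    ∃ R : ℝ, 0 < R ∧ ∀ ζ, bracket ζ ≤ R * (1 + Metric.infDist ζ K) := by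
  obtain ⟨R, hR0, hR⟩ := hK.subset_closedBall_lt 0 0
  refine ⟨1 + R, by linarith, fun ζ => ?_⟩
  have h1 : ‖ζ‖ - R ≤ Metric.infDist ζ K := by
    rw [Metric.le_infDist hne]
    intro y hy
    have h2 := hR hy
    rw [mem_closedBall_zero_iff] at h2
    have h3 := norm_sub_norm_le ζ y
    rw [dist_eq_norm]; linarith
  have h2 := bracket_le_one_add_norm ζ
  have h3 := Metric.infDist_nonneg (x := ζ) (s := K)
  nlinarith

/-- A flat density with decay at infinity controls all negative powers of the distance to `K`. -/
theorem exists_flat_mul_inv_infDist_le {K : Set ℂ} (hK : Bornology.IsBounded K) (hne : K.Nonempty)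
    {γ : ℂ → ℂ} (hγ : ∀ N : ℕ, ∃ C : ℝ, ∀ᵐ ζ : ℂ, ‖γ ζ‖ ≤ C * Metric.infDist ζ K ^ N)
    {ε C : ℝ} (hε : 0 < ε) (hdec : ∀ᵐ ζ, ‖γ ζ‖ ≤ C * bracket ζ ^ (-1 - ε)) (m : ℕ) :
    ∃ D : ℝ, ∀ᵐ ζ : ℂ, 0 < Metric.infDist ζ K →
      ‖γ ζ‖ * ((Metric.infDist ζ K)⁻¹ * (1 + (Metric.infDist ζ K)⁻¹) ^ m) ≤
        D * bracket ζ ^ (-2 - ε) := by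
  obtain ⟨R, hR0, hR⟩ := exists_bracket_le_infDist hK hne
  obtain ⟨C', hC'⟩ := hγ (m + 1)
  refine ⟨2 ^ m * |C'| * (R * 2) ^ (2 + ε) + 2 ^ m * |C| * (R * 2), ?_⟩
  filter_upwards [hC', hdec] with ζ h1 h2 hd
  set d := Metric.infDist ζ K
  have hb := bracket_pos ζ
  have hRζ := hR ζ
  have hp : 0 < bracket ζ ^ (-2 - ε) := Real.rpow_pos_of_pos hb _
  rw [add_mul]
  -- Near `K` the flatness of `γ` absorbs the powers of `1 / d`; far from `K` the factor `1 / d` gives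
  -- one more power of decay.
  rcases le_total d 1 with hd1 | hd1
  · have h3 : 1 + d⁻¹ ≤ 2 * d⁻¹ := by
      have := one_le_inv_iff₀.mpr ⟨hd, hd1⟩
      linarith
    have h4 : 1 ≤ (R * 2) ^ (2 + ε) * bracket ζ ^ (-2 - ε) := by
      rw [show (-2 - ε) = -(2 + ε) by ring, Real.rpow_neg hb.le, ← div_eq_mul_inv,
        one_le_div (by positivity)]
      exact Real.rpow_le_rpow hb.le (hRζ.trans (by gcongr; linarith)) (by linarith)
    have h5 : 0 ≤ 2 ^ m * |C| * (R * 2) * bracket ζ ^ (-2 - ε) := by positivity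
    calc ‖γ ζ‖ * (d⁻¹ * (1 + d⁻¹) ^ m) ≤ (|C'| * d ^ (m + 1)) * (d⁻¹ * (2 * d⁻¹) ^ m) := by
          gcongr
          exact h1.trans (by gcongr; exact le_abs_self C')
      _ = 2 ^ m * |C'| * 1 := by rw [mul_pow, inv_pow, pow_succ]; field_simp
      _ ≤ 2 ^ m * |C'| * ((R * 2) ^ (2 + ε) * bracket ζ ^ (-2 - ε)) := by gcongr
      _ ≤ _ := by linarith
  · have h3 : 1 + d⁻¹ ≤ 2 := by
      have := inv_le_one_of_one_le₀ hd1
      linarith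
    have h4 : d⁻¹ ≤ R * 2 * bracket ζ ^ (-1 : ℝ) := by
      rw [Real.rpow_neg_one, ← div_eq_mul_inv, inv_eq_one_div, div_le_div_iff₀ hd hb]
      nlinarith
    have h5 : 0 ≤ 2 ^ m * |C'| * (R * 2) ^ (2 + ε) * bracket ζ ^ (-2 - ε) := by positivity
    calc ‖γ ζ‖ * (d⁻¹ * (1 + d⁻¹) ^ m) ≤ (|C| * bracket ζ ^ (-1 - ε)) *
          ((R * 2 * bracket ζ ^ (-1 : ℝ)) * 2 ^ m) := by
          gcongr
          exact h2.trans (by gcongr; exact le_abs_self C)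
      _ = 2 ^ m * |C| * (R * 2) * (bracket ζ ^ (-1 - ε) * bracket ζ ^ (-1 : ℝ)) := by ring
      _ = 2 ^ m * |C| * (R * 2) * bracket ζ ^ (-2 - ε) := by
          rw [← Real.rpow_add hb]; congr 2; ring
      _ ≤ _ := by linarith

variable {B : Type*} [NormedAddCommGroup B] [NormedSpace ℂ B] [CompleteSpace B]
  {U : (B →L[ℂ] B)ˣ} {C : ℝ} {M : ℕ}

theorem spectrum_circleCalc_subset (hU : HasPolyGrowth U C M) (hf : IsCircleSmooth f) :
    spectrum ℂ (circleCalc U f) ⊆ closure (Set.range f) := by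
  intro ζ hζ
  by_contra hcon
  have hne : (closure (Set.range f)).Nonempty := (Set.range_nonempty f).closure
  exact hζ (circleCalc_inv_sub hU hf ((isClosed_closure.notMem_iff_infDist_pos hne).mp hcon)
    (infDist_le_norm_sub f ζ)).1

/-- The calculus of a composition `g ∘ f` is the Cauchy–Green calculus of `g` applied to that of
`f`. -/
theorem isCauchyGreenFunctionOf_circleCalc (hU : HasPolyGrowth U C M) (hf : IsCircleSmooth f)
    {g G₀ γ₀ : ℂ → ℂ} (hG₀ : IsFlatLipschitzExt (closure (Set.range f)) g G₀ γ₀) :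
    IsCauchyGreenFunctionOf (closure (Set.range f)) g (circleCalc U f) (circleCalc U (g ∘ f)) := by
  have hne : (closure (Set.range f)).Nonempty := (Set.range_nonempty f).closure
  have hbd := isBounded_closure_range hf
  refine ⟨spectrum_circleCalc_subset hU hf, hG₀.exists_hasCompactSupport hbd hne,
    fun G γ hG ⟨ε, hε, D, hdec⟩ => ?_⟩
  obtain ⟨L, hL⟩ := hG.lipschitz
  obtain ⟨c, hc, he⟩ := hG.dbar_eq.exists_eq_cauchyTransform hL.continuous hG.bounded hε hdec
  refine ⟨c, hc, ?_⟩
  have hpi : (Real.pi : ℂ) ≠ 0 := by exact_mod_cast Real.pi_ne_zero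
  have hF : ∀ x : ℝ, (g ∘ f) x = c + ∫ ζ, (-(Real.pi : ℂ)⁻¹ * γ ζ) * (ζ - f x)⁻¹ := by
    intro x
    rw [Function.comp_apply, ← hG.extends_fun _ (subset_closure (Set.mem_range_self x)), he,
      cauchyTransform, ← integral_const_mul]
    congr 2
    ext ζ
    rw [← neg_sub ζ, inv_neg]; ring
  -- `K` may have positive measure, but `γ` vanishes on it.
  have h0 : ∀ᵐ ζ, γ ζ = 0 ∨ 0 < Metric.infDist ζ (closure (Set.range f)) := by
    obtain ⟨C₁, hC₁⟩ := hG.dbar_bound 1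
    refine hC₁.mono fun ζ hζ => ?_
    rcases (Metric.infDist_nonneg (x := ζ) (s := closure (Set.range f))).eq_or_lt with h1 | h1
    · left
      rw [← h1] at hζ
      simpa using hζ
    · exact Or.inr h1
  obtain ⟨D₁, hD₁, hcoeff⟩ := hf.exists_norm_circleCoeff_inv_sub_le (M + 2)
  obtain ⟨D₂, hD₂⟩ := exists_flat_mul_inv_infDist_le hbd hne hG.dbar_bound hε hdec (M + 2)
  have hm : Measurable (Function.uncurry fun (ζ : ℂ) (x : ℝ) => (ζ - f x)⁻¹) := by
    have := hf.contDiff.continuous.measurable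
    unfold Function.uncurry; fun_prop
  have key := circleCalc_integral hU
    (hG.dbar_eq.locallyIntegrable_dbar.aestronglyMeasurable.const_mul _) hm
    ((integrable_bracket_rpow hε).const_mul (‖-(Real.pi : ℂ)⁻¹‖ * D₁ * D₂)) ?_ hF
  · have hae : ∀ᵐ ζ, (-(Real.pi : ℂ)⁻¹ * γ ζ) • circleCalc U (fun x => (ζ - f x)⁻¹) =
        -(Real.pi : ℂ)⁻¹ • (γ ζ • resolvent (circleCalc U f) ζ) := by
      filter_upwards [h0] with ζ hζ
      rcases hζ with hζ | hζ
      · simp [hζ]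
      · rw [(circleCalc_inv_sub hU hf hζ (infDist_le_norm_sub f ζ)).2, mul_smul]
    constructor
    · refine ((key.1.congr hae).smul (-(Real.pi : ℂ))).congr (.of_forall fun w => ?_)
      simp only [Pi.smul_apply, smul_smul]
      rw [neg_mul, neg_mul, mul_neg, neg_neg, mul_inv_cancel_left₀ hpi]
    · rw [key.2, integral_congr_ae hae, integral_smul, neg_smul, ← sub_eq_add_neg]
      rfl
  · filter_upwards [h0, hD₂] with ζ hζ h2
    rcases hζ with hζ | hζ
    · left; rw [hζ, mul_zero]
    · have hd := infDist_le_norm_sub f ζ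
      refine Or.inr ⟨hf.inv_sub hζ hd, fun n => ?_⟩
      have h3 := hcoeff ζ _ hζ hd n
      have h4 := h2 hζ
      rw [norm_mul]
      calc _ ≤ ‖-(Real.pi : ℂ)⁻¹‖ * ‖γ ζ‖ * (D₁ *
            ((Metric.infDist ζ (closure (Set.range f)))⁻¹ *
              (1 + (Metric.infDist ζ (closure (Set.range f)))⁻¹) ^ (M + 2))) :=
            mul_le_mul_of_nonneg_left h3 (by positivity)
        _ = ‖-(Real.pi : ℂ)⁻¹‖ * D₁ * (‖γ ζ‖ *
            ((Metric.infDist ζ (closure (Set.range f)))⁻¹ *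
              (1 + (Metric.infDist ζ (closure (Set.range f)))⁻¹) ^ (M + 2))) := by ring
        _ ≤ ‖-(Real.pi : ℂ)⁻¹‖ * D₁ * (D₂ * bracket ζ ^ (-2 - ε)) :=
            mul_le_mul_of_nonneg_left h4 (by positivity)
        _ = _ := by ring

end Bounded

end

end SmoothCalculus

theorem mainTheorem2 {B : Type*} [NormedAddCommGroup B] [NormedSpace ℂ B] [CompleteSpace B]
    (P : B →ₗ.[ℂ] B) (hP : SmoothCalculus.IsTemperate P)
    (f : ℝ → ℂ) (hf : SmoothCalculus.MemE f)
    (g : ℂ → ℂ) (hg : ContinuousOn g (closure (Set.range f)))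
    (hext : ∃ G γ : ℂ → ℂ,
      SmoothCalculus.IsFlatLipschitzExt (closure (Set.range f)) g G γ) :
    ∃ A H : B →L[ℂ] B,
      -- `A = f(P)`
      SmoothCalculus.IsFunctionOf P f A ∧
      -- `H = (g ∘ f)(P)`
      SmoothCalculus.IsFunctionOf P (g ∘ f) H ∧
      -- `H = g(f(P))`
      SmoothCalculus.IsCauchyGreenFunctionOf (closure (Set.range f)) g A H ∧
      -- the formula for `H` through the composed extension `z ↦ G (F z)` of `g ∘ f`
      (∃ F : ℂ → ℂ, SmoothCalculus.IsStrongAlmostHolExt f F) ∧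
      ∀ F G γ : ℂ → ℂ, SmoothCalculus.IsStrongAlmostHolExt f F →
        SmoothCalculus.IsFlatLipschitzExt (closure (Set.range f)) g G γ →
        ∃ (c : ℂ) (η : ℂ → ℂ),
          SmoothCalculus.IsAlmostHolExt (g ∘ f) (G ∘ F) η ∧
          Tendsto (G ∘ F) (cocompact ℂ) (𝓝 c) ∧
          Integrable (fun z => η z • SmoothCalculus.opResolvent P z) ∧
          H = SmoothCalculus.cauchyGreen c η (SmoothCalculus.opResolvent P) := by
  have hs := hf.isCircleSmooth
  obtain ⟨M, -, hM⟩ := hs.exists_bound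
  obtain ⟨F₀, hF₀⟩ := hs.exists_isStrongAlmostHolExt
  obtain ⟨G₀, γ₀, hG₀⟩ := hext
  obtain ⟨C, N, hU⟩ := hP.exists_hasPolyGrowth
  refine ⟨SmoothCalculus.circleCalc hP.cayley f, SmoothCalculus.circleCalc hP.cayley (g ∘ f),
    hP.isFunctionOf (hF₀.isAlmostHolExt hM), hP.isFunctionOf (hG₀.comp hF₀),
    SmoothCalculus.isCauchyGreenFunctionOf_circleCalc hU hs hG₀, ⟨F₀, hF₀⟩,
    fun F G γ hF hG => ?_⟩
  have h := hG.comp hF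
  obtain ⟨c, hc, -⟩ := h.exists_eq_cauchyTransform
  exact ⟨c, SmoothCalculus.dbar (G ∘ F), h, hc, hP.circleCalc_eq_cauchyGreen h hc⟩
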